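/- \textbf{Setting.} Let $K\ge 2$, $M=K^2$, and let $s_1,\dots,s_M$ be the square $M$-QAM constellation of unit mean power, i.e. the points $\sqrt{\tfrac{3}{2(M-1)}}\,\big((2i-K+1)+\jmath(2l-K+1)\big)$, $0\le i,l<K$. Let $P>0$, $\eta>2$, $r_0>0$, $\lambda>0$, $N_0>0$. A user at the origin is served by a base station at distance $r_0$. The interfering base stations form a Poisson point process of intensity $\lambda$ on $\{x\in\mathbb R^2:\|x\|>r_0\}$, enumerated as $x_1,x_2,\dots$ with distances $r_k=\|x_k\|$. The received signal is $$y_0=\sqrt P\,s_0h_0r_0^{-\eta/2}+i_{agg}+n,\qquad i_{agg}=\lim_{N\to\infty}\sum_{k=1}^{N}\sqrt P\,s_kh_kr_k^{-\eta/2},$$ where the symbols $s_0$ (intended) and $s_k$ (interfering; $k\ge1$) are i.i.d. and uniform on the $M$-QAM constellation, the channels $h_0,h_1,\dots$ are i.i.d. $\mathcal{CN}(0,1)$, $n\sim\mathcal{CN}(0,N_0)$, and the locations, symbols, channels and noise are mutually independent. (In sums over the constellation below, $s_m$ denotes the $m$-th constellation point.) Put $w_1=2\frac{\sqrt M-1}{\sqrt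 M}$, $w_2=-\big(\frac{\sqrt M-1}{\sqrt M}\big)^2$, $\beta_1=\beta_2=\frac{3}{2(M-1)}$, $\operatorname{erfc}(x)=\frac{2}{\sqrt\pi}\int_x^\infty e^{-t^2}\,dt$, ${}_1F_1(a;b;x)=\sum_{n\ge0}\frac{(a)_n}{(b)_n}\frac{x^n}{n!}$, and $$\bar{\mathcal S}(r_0)=\sum_{c=1}^2 w_c\left(1-\frac{c}{\sqrt\pi}\int_0^\infty\frac{\operatorname{erfc}(\sqrt z\,\mathbf 1_{\{c=2\}})}{\sqrt z}\exp\left\{-z\Big(1+\frac{N_0r_0^\eta}{P\beta_c}\Big)-\pi\lambda r_0^2\Big(\frac1M\sum_{m=1}^M{}_1F_1\Big(-\frac2\eta;1-\frac2\eta;-\frac{z|s_m|^2}{\beta_c}\Big)-1\Big)\right\}dz\right).$$ \textbf{Theorem.} The series defining $i_{agg}$ converges almost surely, the integrals in $\bar{\mathcal S}(r_0)$ converge absolutely, and $\bar{\mathcal S}(r_0)$ is exactly the downlink average symbol error probability at distance $r_0$, in both of the following senses. \begin{enumerate} \item There is a random variable $V\ge0$ such that $i_{agg}$ is equal in distribution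 to $\sqrt V\,G$ with $G\sim\mathcal{CN}(0,1)$ independent of $V$; and for every such $V$, taken independent of $h_0$, $$\mathbb E\left[w_1\operatorname{erfc}\big(\sqrt{\beta_1\Upsilon}\big)+w_2\operatorname{erfc}^2\big(\sqrt{\beta_2\Upsilon}\big)\right]=\bar{\mathcal S}(r_0),\qquad \Upsilon=\frac{P|h_0|^2r_0^{-\eta}}{N_0+V}.$$ \item Suppose a receiver knows $h_0$ and decides for a constellation point $\hat s$ that maximizes the Gaussian likelihood $a\mapsto\frac{1}{\pi v}\exp\big(-|y_0-\sqrt P h_0r_0^{-\eta/2}a|^2/v\big)$ (coherent maximum likelihood detection, interference plus noise being treated as Gaussian noise of some variance $v>0$, which may depend on the realization, with ties broken arbitrarily). Then $\mathbb P(\hat s\ne s_0)=\bar{\mathcal S}(r_0)$. \end{enumerate} -/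

import Mathlib

open Real Set Filter Topology MeasureTheory ProbabilityTheory
open scoped NNReal ENNReal

noncomputable section

namespace CellularASEP

/-! ### Special functions -/

/-- The complementary error function `erfc x = (2/√π) ∫_x^∞ exp(-t²) dt`. -/
def erfc (x : ℝ) : ℝ := 2 / √π * ∫ t in Ioi x, rexp (-t ^ 2)

/-- Kummer's confluent hypergeometric function
`₁F₁(a; b; x) = ∑ₙ (a)ₙ / (b)ₙ · xⁿ / n!`, with `(·)ₙ` the rising factorial. -/
def hyp1F1 (a b x : ℝ) : ℝ :=
  ∑' n : ℕ, (ascPochhammer ℝ n).eval a / (ascPochhammer ℝ n).eval b * (x ^ n / n.factorial)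

/-! ### Circularly symmetric complex Gaussians and Poisson point processes -/

/-- `CN(0, v)`: real and imaginary parts are independent `N(0, v/2)`. -/
def complexGaussian (v : ℝ≥0) : Measure ℂ :=
  ((gaussianReal 0 (v / 2)).prod (gaussianReal 0 (v / 2))).map (fun p => (⟨p.1, p.2⟩ : ℂ))

/-- The number of points of the (enumerated) random configuration `x` that lie in `B`. -/
def pointCount {Ω E : Type*} (x : ℕ → Ω → E) (B : Set E) (ω : Ω) : ℕ∞ :=
  {k : ℕ | x k ω ∈ B}.encard

/-- `x` is a (measurable) enumeration of the points of a Poisson point process with intensity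
measure `Λ`: the number of points in a set of finite intensity is Poisson with mean `Λ B`, and
the numbers of points in disjoint sets are independent. -/
structure IsPoissonPointProcess {Ω E : Type*} [MeasurableSpace Ω] [MeasurableSpace E]
    (μ : Measure Ω) (x : ℕ → Ω → E) (Λ : Measure E) : Prop where
  measurable : ∀ k, Measurable (x k)
  count_law : ∀ B : Set E, MeasurableSet B → Λ B ≠ ∞ → ∀ n : ℕ,
    μ {ω | pointCount x B ω = n} = poissonMeasure (Λ B).toNNReal {n}
  count_indep : ∀ (m : ℕ) (B : Fin m → Set E), (∀ i, MeasurableSet (B i)) →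
    (∀ i, Λ (B i) ≠ ∞) → Pairwise (fun i j => Disjoint (B i) (B j)) →
    iIndepFun (fun i => pointCount x (B i)) μ

/-! ### Square QAM -/

/-- The unit-power square QAM constellation with `M = K²` symbols: the grid of the points
`(2i - (K-1)) + j (2l - (K-1))`, `0 ≤ i, l < K`, scaled to have mean square modulus `1`. -/
def qam (K : ℕ) (p : Fin K × Fin K) : ℂ :=
  (√(3 / (2 * ((K : ℝ) ^ 2 - 1))) : ℝ) *
    (⟨2 * (p.1 : ℝ) - (K - 1), 2 * (p.2 : ℝ) - (K - 1)⟩ : ℂ)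

/-- `w₁ = 2 (√M - 1)/√M` and `w₂ = -((√M - 1)/√M)²`. -/
def qamWeight (M : ℕ) (c : ℕ) : ℝ :=
  if c = 1 then 2 * ((√M - 1) / √M) else -((√M - 1) / √M) ^ 2

/-- `β₁ = β₂ = 3 / (2 (M - 1))`. -/
def qamBeta (M : ℕ) : ℝ := 3 / (2 * ((M : ℝ) - 1))

/-- The `M`-QAM symbol error probability
`w₁ erfc √(β₁ Υ) + w₂ erfc² √(β₂ Υ)` at signal-to-noise ratio `Υ`. -/
def qamSEP (M : ℕ) (snr : ℝ) : ℝ :=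
  qamWeight M 1 * erfc √(qamBeta M * snr) + qamWeight M 2 * erfc √(qamBeta M * snr) ^ 2

/-! ### The downlink -/

/-- The random elements of the downlink, given the serving distance `r₀`.
* `x k` is the location of the `k`-th interfering base station (the user is at the origin); the
  interferers form a Poisson point process of intensity `lam` on the plane outside the disc of
  radius `r₀`;
* `s 0` is the intended symbol, `s (k+1)` is the symbol sent by the interferer at `x k`; they are
  i.i.d., equiprobable on the constellation;
* `h 0` is the intended channel, `h (k+1)` the channel of the interferer at `x k`; they are
  i.i.d. `CN(0,1)` (Rayleigh fading);
* `n ∼ CN(0, N₀)` is the noise.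

Locations, symbols, channels and noise are mutually independent. -/
structure IsDownlink {Ω : Type*} [MeasurableSpace Ω] (μ : Measure Ω) (lam r₀ : ℝ) (N₀ : ℝ≥0)
    (K : ℕ) (x : ℕ → Ω → EuclideanSpace ℝ (Fin 2)) (s h : ℕ → Ω → ℂ) (n : Ω → ℂ) : Prop where
  poisson : IsPoissonPointProcess μ x
    (ENNReal.ofReal lam • (volume : Measure (EuclideanSpace ℝ (Fin 2))).restrict {p | r₀ < ‖p‖})
  measurable_s : ∀ k, Measurable (s k)
  measurable_h : ∀ k, Measurable (h k)
  measurable_n : Measurable n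
  law_s : ∀ k, HasLaw (s k) (uniformOn (range (qam K))) μ
  law_h : ∀ k, HasLaw (h k) (complexGaussian 1) μ
  law_n : HasLaw n (complexGaussian N₀) μ
  iIndep_s : iIndepFun s μ
  iIndep_h : iIndepFun h μ
  indep_x : IndepFun (fun ω k => x k ω) (fun ω => (fun k => s k ω, fun k => h k ω, n ω)) μ
  indep_s : IndepFun (fun ω k => s k ω) (fun ω => (fun k => h k ω, n ω)) μ
  indep_h : IndepFun (fun ω k => h k ω) n μ

section Signals

variable {Ω : Type*} (P η r₀ : ℝ) (x : ℕ → Ω → EuclideanSpace ℝ (Fin 2)) (s h : ℕ → Ω → ℂ)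
  (n : Ω → ℂ)

/-- The contribution `∑_{k<N} √P s_k h_k r_k^{-η/2}` of the first `N` interferers. -/
def partialInterference (N : ℕ) (ω : Ω) : ℂ :=
  ∑ k ∈ Finset.range N, (√P : ℂ) * s (k + 1) ω * h (k + 1) ω * (‖x k ω‖ ^ (-η / 2) : ℝ)

/-- The aggregate interference `i_agg`, the limit of the partial sums over the interferers. -/
def interference (ω : Ω) : ℂ :=
  limUnder atTop (fun N => partialInterference P η x s h N ω)

/-- The complex gain `√P h₀ r₀^{-η/2}` of the link to the serving base station. -/
def gain (ω : Ω) : ℂ := (√P : ℂ) * h 0 ω * (r₀ ^ (-η / 2) : ℝ)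

/-- The received baseband signal `y₀ = √P s₀ h₀ r₀^{-η/2} + i_agg + n`. -/
def received (ω : Ω) : ℂ :=
  gain P η r₀ h ω * s 0 ω + interference P η x s h ω + n ω

end Signals

/-- The likelihood of the symbol `a` when `y` is received over a channel of gain `c` in circularly
symmetric complex Gaussian noise of variance `v`. -/
def likelihood (v : ℝ) (c y a : ℂ) : ℝ := 1 / (π * v) * rexp (-‖y - c * a‖ ^ 2 / v)

/-- `shat` is a decision that the coherent maximum likelihood detector for the constellation `S`
may take on receiving `y`, if it knows the channel gain `c` and treats the interference plus noise
as Gaussian noise of variance `v`. -/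
def IsMLDecision (S : Set ℂ) (v : ℝ) (c y shat : ℂ) : Prop :=
  shat ∈ S ∧ ∀ a ∈ S, likelihood v c y a ≤ likelihood v c y shat

/-! ### The conditionally Gaussian representation -/

/-- The law `ν` of a random variance `V ≥ 0` gives a conditionally Gaussian
equivalent-in-distribution representation of `i`: `i` has the law of `√V · G`, with `G ∼ CN(0,1)`
independent of `V`. -/
def IsEiDRepresentation {Ω : Type*} [MeasurableSpace Ω] (μ : Measure Ω) (i : Ω → ℂ)
    (ν : Measure ℝ≥0) : Prop :=
  HasLaw i ((ν.prod (complexGaussian 1)).map (fun p => (√(p.1 : ℝ) : ℂ) * p.2)) μ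

/-- The conditional SINR `P |g|² r₀^{-η} / (N₀ + v)`, given the intended channel `g` and the
conditional variance `v` of the interference. -/
def condSINR (P η r₀ : ℝ) (N₀ : ℝ≥0) (g : ℂ) (v : ℝ≥0) : ℝ :=
  P * ‖g‖ ^ 2 * r₀ ^ (-η) / (N₀ + v)

/-- The symbol error probability at the conditional SINR, averaged over the interference variance
(with law `ν`) and the independent intended channel `h₀ ∼ CN(0,1)`. -/
def averageSEP (M : ℕ) (P η r₀ : ℝ) (N₀ : ℝ≥0) (ν : Measure ℝ≥0) : ℝ :=
  ∫ q, qamSEP M (condSINR P η r₀ N₀ q.2 q.1) ∂(ν.prod (complexGaussian 1))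

/-- The integrand of the closed form (`M = K²`):
`erfc(√z 1_{c=2}) / √z · exp{ -z (1 + N₀ r₀^η / (P β_c))
    - π λ r₀² ((1/M) ∑ₘ ₁F₁(-2/η; 1-2/η; -z |sₘ|²/β_c) - 1) }`. -/
def asepIntegrand (K : ℕ) (P η r₀ lam : ℝ) (N₀ : ℝ≥0) (c : ℕ) (z : ℝ) : ℝ :=
  erfc (if c = 2 then √z else 0) / √z *
    rexp (-z * (1 + N₀ * r₀ ^ η / (P * qamBeta (K ^ 2)))
      - π * lam * r₀ ^ 2 *
        (1 / ((K ^ 2 : ℕ) : ℝ) * ∑ m : Fin K × Fin K,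
          hyp1F1 (-2 / η) (1 - 2 / η) (-(z * ‖qam K m‖ ^ 2 / qamBeta (K ^ 2))) - 1))

/-- The closed form `∑_{c=1}^2 w_c (1 - (c/√π) ∫_0^∞ …  dz)`. -/
def asepFormula (K : ℕ) (P η r₀ lam : ℝ) (N₀ : ℝ≥0) : ℝ :=
  ∑ c ∈ Finset.Icc 1 2, qamWeight (K ^ 2) c *
    (1 - c / √π * ∫ z in Ioi (0 : ℝ), asepIntegrand K P η r₀ lam N₀ c z)

end CellularASEP

end

noncomputable section

namespace CellularASEP

/-! ### The function `exp (-y)` on `[0, ∞]` -/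

/-! Given the locations and symbols, the interference is a series of independent complex Gaussians
with fixed coefficients, so it is `CN(0, V)` with `V = P ∑ |s_k|² r_k^{-η}`. This `V` is almost
surely finite because `‖p‖^{-η}` is integrable over the plane outside the disc when `η > 2`.
Convergence of the series then follows conditionally, from the convergence of L²-bounded
martingales.

The Laplace transform of `V` is explicit. Averaging over the symbols first, at frozen locations,
leaves a product `∏ φ(x_k)` over the Poisson points, with `φ(p) = E exp(-t P |s|² ‖p‖^{-η})`. The
Laplace functional (`IsPoissonPointProcess.laplace`) turns this into `exp(-λ ∫ (1 - φ))`. In polar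
coordinates, expanding the exponential and integrating term by term gives the Kummer function
(`integral_Ioi_mul_one_sub_exp`). The characteristic function of the interference at `ξ` is this
transform at `‖ξ‖²/4`. Hence every conditionally Gaussian representation has the same Laplace
transform of its variance, which is all that the error formula uses.

For the average, `erfc(√u)^c` is one minus the integral over `[0, u]` of an explicit kernel
(`erfc_sqrt_pow`). By Fubini its mean is an integral of the kernel against the tail of the SINR.
Since `|h₀|²` is exponential, that tail is the Laplace transform of `N₀ + V` at `z r₀^η / (P β)`,
which produces the closed form (`asepIntegrand_eq`). The integrals converge because the integrand is
an integrable kernel times a probability.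

For the detector, the likelihood decreases with distance whatever the assumed variance, so the
decision is a nearest point. After division by the gain, the disturbance is conditionally `CN(0,
1/Υ)`, and decision cells are products of slabs. The error event is caught between the complements
of the closed-cell and open-cell events, which have equal probability because Gaussian laws do not
charge boundaries. Summing the cell masses gives one minus the conditional error probability
(`sum_complexGaussian_cells`), and averaging it gives the first part again. -/

/-- `exp (-y)` for `y ∈ [0, ∞]`, with value `0` at `∞`. -/
def expNeg (y : ℝ≥0∞) : ℝ≥0∞ := EReal.exp (-(y : EReal))

@[simp] lemma expNeg_zero : expNeg 0 = 1 := by simp [expNeg]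

@[simp] lemma expNeg_top : expNeg ∞ = 0 := by simp [expNeg]

lemma expNeg_ofReal {r : ℝ} (hr : 0 ≤ r) :
    expNeg (ENNReal.ofReal r) = ENNReal.ofReal (rexp (-r)) := by
  rw [expNeg, EReal.coe_ennreal_ofReal, max_eq_left hr, ← EReal.coe_neg, EReal.exp_coe]

lemma expNeg_add (a b : ℝ≥0∞) : expNeg (a + b) = expNeg a * expNeg b := by
  simp only [expNeg, EReal.exp_neg, EReal.coe_ennreal_add, EReal.exp_add]
  -- The inverse is multiplicative on `[0, ∞]` except for `0 · ∞`; this case is excluded because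
  -- neither exponent is `-∞`.
  have h : ∀ y : ℝ≥0∞, EReal.exp (y : EReal) ≠ 0 := fun y => by
    simp [EReal.exp_eq_zero_iff, EReal.coe_ennreal_ne_bot]
  exact ENNReal.mul_inv (Or.inl (h a)) (Or.inr (h b))

lemma expNeg_antitone : Antitone expNeg := fun a b hab => by
  simpa [expNeg] using hab

lemma expNeg_le_one (y : ℝ≥0∞) : expNeg y ≤ 1 := by
  simpa using expNeg_antitone (zero_le (a := y))

lemma expNeg_ne_top (y : ℝ≥0∞) : expNeg y ≠ ∞ :=
  ((expNeg_le_one y).trans_lt ENNReal.one_lt_top).ne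

lemma continuous_expNeg : Continuous expNeg :=
  ENNReal.continuous_exp.comp (continuous_neg.comp continuous_coe_ennreal_ereal)

lemma measurable_expNeg : Measurable expNeg := continuous_expNeg.measurable

lemma expNeg_sum {ι : Type*} (s : Finset ι) (f : ι → ℝ≥0∞) :
    expNeg (∑ i ∈ s, f i) = ∏ i ∈ s, expNeg (f i) := by
  classical
  induction s using Finset.induction_on with
  | empty => simp
  | insert a s ha ih => rw [Finset.sum_insert ha, Finset.prod_insert ha, expNeg_add, ih]

lemma expNeg_mul_natCast (c : ℝ≥0∞) (n : ℕ) : expNeg (c * n) = expNeg c ^ n := by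
  have := expNeg_sum (Finset.range n) (fun _ => c)
  simpa [mul_comm] using this

lemma tendsto_expNeg_sum (f : ℕ → ℝ≥0∞) :
    Tendsto (fun N => ∏ k ∈ Finset.range N, expNeg (f k)) atTop (𝓝 (expNeg (∑' k, f k))) := by
  simp only [← expNeg_sum]
  exact (continuous_expNeg.tendsto _).comp ENNReal.summable.hasSum.tendsto_sum_nat

lemma one_sub_expNeg_le (y : ℝ≥0∞) : 1 - expNeg y ≤ y := by
  rcases eq_or_ne y ∞ with rfl | hy
  · simp
  · rw [← ENNReal.ofReal_toReal hy, expNeg_ofReal ENNReal.toReal_nonneg, ← ENNReal.ofReal_one,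
      ← ENNReal.ofReal_sub _ (exp_pos _).le]
    apply ENNReal.ofReal_le_ofReal
    linarith [add_one_le_exp (-y.toReal)]

/-! ### The Laplace functional of a Poisson point process -/

/-- The Poisson generating function at `q = e^{-c}`: `∑ e^{-r} (q r)^n / n! = e^{-(1-q) r}`. The
value `c = ∞` is included, with `q = 0` and `0 ^ 0 = 1`. -/
lemma lintegral_expNeg_poissonMeasure (r : ℝ≥0) (c : ℝ≥0∞) :
    ∫⁻ n, expNeg (c * n) ∂(poissonMeasure r) = expNeg ((1 - expNeg c) * r) := by
  obtain ⟨q, hq⟩ : ∃ q : ℝ≥0, expNeg c = q := ⟨(expNeg c).toNNReal, by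
    rw [ENNReal.coe_toNNReal (expNeg_ne_top c)]⟩
  have hq1 : (q : ℝ) ≤ 1 := by
    have := expNeg_le_one c
    rw [hq] at this
    exact_mod_cast this
  simp only [lintegral_countable', expNeg_mul_natCast, hq, poissonMeasure_singleton]
  have h1 : ∀ n : ℕ, (q : ℝ≥0∞) ^ n * ENNReal.ofReal (rexp (-r) * r ^ n / n.factorial)
      = ENNReal.ofReal (rexp (-r) * ((q * r : ℝ) ^ n / n.factorial)) := by
    intro n
    rw [← ENNReal.ofReal_coe_nnreal, ← ENNReal.ofReal_pow q.coe_nonneg, ← ENNReal.ofReal_mul (by positivity)]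
    congr 1
    rw [mul_pow]; ring
  simp only [h1]
  have hs := (NormedSpace.expSeries_div_hasSum_exp ((q : ℝ) * r)).mul_left (rexp (-r))
  rw [← ENNReal.ofReal_tsum_of_nonneg (fun n => by positivity) hs.summable, hs.tsum_eq,
    ← Real.exp_eq_exp_ℝ, ← Real.exp_add]
  have h2 : ((1 - (q : ℝ≥0∞)) * r) = ENNReal.ofReal ((1 - q) * r) := by
    rw [ENNReal.ofReal_mul (by linarith), ENNReal.ofReal_sub _ q.coe_nonneg, ENNReal.ofReal_one,
      ENNReal.ofReal_coe_nnreal, ENNReal.ofReal_coe_nnreal]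
  rw [h2, expNeg_ofReal (mul_nonneg (by linarith) r.coe_nonneg)]
  congr 2; ring

lemma pointCount_eq_tsum {Ω E : Type*} (x : ℕ → Ω → E) (B : Set E) (ω : Ω) :
    (pointCount x B ω : ℝ≥0∞) = ∑' k, B.indicator 1 (x k ω) := by
  rw [pointCount, ← ENNReal.tsum_set_one, tsum_subtype {k | x k ω ∈ B} (fun _ => 1)]
  rfl

section Poisson

variable {Ω E : Type*} [MeasurableSpace Ω] [MeasurableSpace E] {μ : Measure Ω}
  {x : ℕ → Ω → E} {Λ : Measure E}

lemma measurable_pointCount (hx : ∀ k, Measurable (x k)) {B : Set E} (hB : MeasurableSet B) :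
    Measurable (pointCount x B) := by
  have h : Measurable (fun ω => (pointCount x B ω : ℝ≥0∞)) := by
    simp only [pointCount_eq_tsum]
    exact Measurable.tsum fun k => (measurable_one.indicator hB).comp (hx k)
  refine measurable_to_countable' fun n => ?_
  have : pointCount x B ⁻¹' {n} = (fun ω => (pointCount x B ω : ℝ≥0∞)) ⁻¹' {(n : ℝ≥0∞)} := by
    ext ω; simp
  rw [this]
  exact h (measurableSet_singleton _)

/-- The definition prescribes only the finite values of the count. Both sides have total mass one,
so their masses at `⊤` agree too. -/
lemma IsPoissonPointProcess.map_pointCount [IsProbabilityMeasure μ]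
    (hx : IsPoissonPointProcess μ x Λ) {B : Set E} (hB : MeasurableSet B) (hΛ : Λ B ≠ ∞) :
    μ.map (pointCount x B) = (poissonMeasure (Λ B).toNNReal).map (fun n : ℕ => (n : ℕ∞)) := by
  have hm := measurable_pointCount hx.measurable hB
  have hc : Measurable (fun n : ℕ => (n : ℕ∞)) := measurable_from_top
  have h1 : ∀ n : ℕ, μ.map (pointCount x B) {(n : ℕ∞)} =
      (poissonMeasure (Λ B).toNNReal).map (fun n : ℕ => (n : ℕ∞)) {(n : ℕ∞)} := by
    intro n
    rw [Measure.map_apply hm (measurableSet_singleton _),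
      Measure.map_apply hc (measurableSet_singleton _)]
    have : (fun n : ℕ => (n : ℕ∞)) ⁻¹' {(n : ℕ∞)} = {n} := by ext; simp
    rw [this, ← hx.count_law B hB hΛ n]
    rfl
  have := Measure.isProbabilityMeasure_map (μ := μ) hm.aemeasurable
  have := Measure.isProbabilityMeasure_map (μ := poissonMeasure (Λ B).toNNReal) hc.aemeasurable
  have hR : range (fun n : ℕ => (n : ℕ∞)) = {⊤}ᶜ := by
    ext n
    induction n using ENat.recTopCoe <;> simp
  have h2 : μ.map (pointCount x B) {⊤}ᶜ =
      (poissonMeasure (Λ B).toNNReal).map (fun n : ℕ => (n : ℕ∞)) {⊤}ᶜ := by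
    rw [← hR, ← iUnion_singleton_eq_range, measure_iUnion, measure_iUnion]
    · simp only [h1]
    · intro i j hij; simpa using hij
    · intro i; exact measurableSet_singleton _
    · intro i j hij; simpa using hij
    · intro i; exact measurableSet_singleton _
  refine Measure.ext_of_singleton fun n => ?_
  induction n using ENat.recTopCoe with
  | coe n => exact h1 n
  | top =>
    rw [← compl_compl ({⊤} : Set ℕ∞), prob_compl_eq_one_sub (measurableSet_singleton _).compl,
      prob_compl_eq_one_sub (measurableSet_singleton _).compl, h2]

lemma IsPoissonPointProcess.lintegral_expNeg_mul_pointCount [IsProbabilityMeasure μ]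
    (hx : IsPoissonPointProcess μ x Λ) {B : Set E} (hB : MeasurableSet B) (hΛ : Λ B ≠ ∞)
    (c : ℝ≥0∞) :
    ∫⁻ ω, expNeg (c * pointCount x B ω) ∂μ = expNeg ((1 - expNeg c) * Λ B) := by
  have hm := measurable_pointCount hx.measurable hB
  have hg : Measurable (fun n : ℕ∞ => expNeg (c * n)) := measurable_from_top
  rw [← lintegral_map (f := fun n : ℕ∞ => expNeg (c * n)) hg hm, hx.map_pointCount hB hΛ,
    lintegral_map hg measurable_from_top]
  simpa [ENNReal.coe_toNNReal hΛ] using lintegral_expNeg_poissonMeasure (Λ B).toNNReal c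

/-- A simple `f` makes the sum over points a combination of the counts of its level sets, which are
independent Poisson variables, so the Laplace transform factorizes. The level `0` is left out: its
fibre may have infinite intensity and contributes nothing. -/
lemma IsPoissonPointProcess.lintegral_expNeg_simpleFunc [IsProbabilityMeasure μ]
    (hx : IsPoissonPointProcess μ x Λ) (f : SimpleFunc E ℝ≥0∞)
    (hf : ∀ c, c ≠ 0 → Λ (f ⁻¹' {c}) ≠ ∞) :
    ∫⁻ ω, expNeg (∑' k, f (x k ω)) ∂μ = expNeg (∫⁻ p, (1 - expNeg (f p)) ∂Λ) := by
  classical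
  set s : Finset ℝ≥0∞ := f.range.filter (· ≠ 0) with hs
  set e := s.equivFin
  set c : Fin s.card → ℝ≥0∞ := fun i => (e.symm i : ℝ≥0∞) with hc
  set B : Fin s.card → Set E := fun i => f ⁻¹' {c i} with hBdef
  have hc0 : ∀ i, c i ≠ 0 := fun i => (Finset.mem_filter.1 (e.symm i).2).2
  have hB : ∀ i, MeasurableSet (B i) := fun i => f.measurableSet_fiber _
  have hΛ : ∀ i, Λ (B i) ≠ ∞ := fun i => hf _ (hc0 i)
  have hdisj : Pairwise fun i j => Disjoint (B i) (B j) := by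
    intro i j hij
    refine Disjoint.preimage f (disjoint_singleton.2 fun h => hij ?_)
    exact e.symm.injective (Subtype.ext h)
  -- Applied twice: with `g = id` for the sum over points and with `g = 1 - expNeg` for the
  -- intensity integral.
  have hdec : ∀ (g : ℝ≥0∞ → ℝ≥0∞), g 0 = 0 → ∀ p,
      g (f p) = ∑ i, g (c i) * (B i).indicator 1 p := by
    intro g hg p
    by_cases hp : f p = 0
    · rw [hp, hg, Finset.sum_eq_zero]
      intro i _
      rw [indicator_of_notMem, mul_zero]
      intro h
      exact hc0 i (by rw [← hp]; exact h.symm)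
    · have hmem : f p ∈ s := Finset.mem_filter.2 ⟨f.mem_range_self p, hp⟩
      rw [Finset.sum_eq_single (e ⟨f p, hmem⟩)]
      · have : c (e ⟨f p, hmem⟩) = f p := by simp [hc]
        rw [indicator_of_mem, this]
        · simp
        · simp [hBdef, this]
      · intro i _ hi
        rw [indicator_of_notMem, mul_zero]
        intro h
        apply hi
        exact e.symm_apply_eq.1 (Subtype.ext h.symm)
      · simp
  have hsum : ∀ ω, ∑' k, f (x k ω) = ∑ i, c i * (pointCount x (B i) ω : ℝ≥0∞) := by
    intro ω
    simp only [pointCount_eq_tsum, ← ENNReal.tsum_mul_left]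
    rw [← Summable.tsum_finsetSum fun _ _ => ENNReal.summable]
    exact tsum_congr fun k => hdec id rfl _
  have hint : ∫⁻ p, (1 - expNeg (f p)) ∂Λ = ∑ i, (1 - expNeg (c i)) * Λ (B i) := by
    have : ∀ p, 1 - expNeg (f p) = ∑ i, (1 - expNeg (c i)) * (B i).indicator 1 p :=
      hdec (fun y => 1 - expNeg y) (by simp)
    simp only [this]
    rw [lintegral_finsetSum]
    · refine Finset.sum_congr rfl fun i _ => ?_
      rw [lintegral_const_mul _ (measurable_one.indicator (hB i)), lintegral_indicator_one (hB i)]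
    · intro i _
      exact (measurable_one.indicator (hB i)).const_mul _
  have hind : iIndepFun (fun i ω => expNeg (c i * pointCount x (B i) ω)) μ :=
    (hx.count_indep _ B hB hΛ hdisj).comp (fun i n => expNeg (c i * (n : ℝ≥0∞)))
      fun i => measurable_from_top
  simp only [hsum, hint, expNeg_sum]
  rw [lintegral_prod_eq_prod_lintegral_of_indepFun _ _ hind]
  · exact Finset.prod_congr rfl fun i _ => hx.lintegral_expNeg_mul_pointCount (hB i) (hΛ i) _
  · intro i
    exact (measurable_from_top (f := fun n : ℕ∞ => expNeg (c i * (n : ℝ≥0∞)))).comp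
      (measurable_pointCount hx.measurable (hB i))

/-- The Laplace functional of a Poisson point process. -/
theorem IsPoissonPointProcess.laplace [IsProbabilityMeasure μ] [SigmaFinite Λ]
    (hx : IsPoissonPointProcess μ x Λ) {f : E → ℝ≥0∞} (hf : Measurable f) :
    ∫⁻ ω, expNeg (∑' k, f (x k ω)) ∂μ = expNeg (∫⁻ p, (1 - expNeg (f p)) ∂Λ) := by
  -- Restricting to spanning sets gives every nonzero level finite intensity while keeping the
  -- approximation monotone.
  set F : ℕ → SimpleFunc E ℝ≥0∞ := fun n =>
    (SimpleFunc.eapprox f n).restrict (spanningSets Λ n) with hF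
  have hFa : ∀ n p, F n p = (spanningSets Λ n).indicator (SimpleFunc.eapprox f n) p := fun n p => by
    rw [hF, SimpleFunc.restrict_apply _ (measurableSet_spanningSets Λ n)]
  have hmono : ∀ p, Monotone fun n => F n p := by
    intro p m n hmn
    simp only [hFa]
    by_cases hp : p ∈ spanningSets Λ m
    · rw [indicator_of_mem hp, indicator_of_mem (monotone_spanningSets Λ hmn hp)]
      exact SimpleFunc.monotone_eapprox f hmn p
    · rw [indicator_of_notMem hp]; exact zero_le
  have hlim : ∀ p, Tendsto (fun n => F n p) atTop (𝓝 (f p)) := by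
    intro p
    refine (SimpleFunc.tendsto_eapprox hf p).congr' ?_
    filter_upwards [eventually_ge_atTop (spanningSetsIndex Λ p)] with n hn
    rw [hFa, indicator_of_mem (monotone_spanningSets Λ hn (mem_spanningSetsIndex Λ p))]
  have hfin : ∀ n c, c ≠ 0 → Λ (F n ⁻¹' {c}) ≠ ∞ := by
    intro n c hc
    refine ne_top_of_le_ne_top (measure_spanningSets_lt_top Λ n).ne (measure_mono fun p hp => ?_)
    by_contra h
    have : F n p = c := hp
    rw [hFa, indicator_of_notMem h] at this
    exact hc this.symm
  have hL : Tendsto (fun n => ∫⁻ ω, expNeg (∑' k, F n (x k ω)) ∂μ) atTop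
      (𝓝 (∫⁻ ω, expNeg (∑' k, f (x k ω)) ∂μ)) := by
    refine tendsto_lintegral_of_dominated_convergence (fun _ => 1) (fun n => ?_)
      (fun n => ae_of_all _ fun ω => expNeg_le_one _) (by simp) (ae_of_all _ fun ω => ?_)
    · exact measurable_expNeg.comp (Measurable.tsum fun k =>
        (F n).measurable.comp (hx.measurable k))
    · refine (continuous_expNeg.tendsto _).comp ?_
      -- The sum over points is an integral against counting measure, so monotone convergence
      -- applies to it.
      simp only [← lintegral_count]
      exact lintegral_tendsto_of_tendsto_of_monotone
        (fun n => (measurable_of_countable _).aemeasurable)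
        (ae_of_all _ fun k => hmono _) (ae_of_all _ fun k => hlim _)
  have hR : Tendsto (fun n => expNeg (∫⁻ p, (1 - expNeg (F n p)) ∂Λ)) atTop
      (𝓝 (expNeg (∫⁻ p, (1 - expNeg (f p)) ∂Λ))) := by
    refine (continuous_expNeg.tendsto _).comp ?_
    refine lintegral_tendsto_of_tendsto_of_monotone
      (fun n => (measurable_const.sub (measurable_expNeg.comp (F n).measurable)).aemeasurable)
      (ae_of_all _ fun p m n hmn => tsub_le_tsub_left (expNeg_antitone (hmono p hmn)) _)
      (ae_of_all _ fun p => ?_)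
    exact ((ENNReal.continuous_sub_left ENNReal.one_ne_top).tendsto _).comp
      ((continuous_expNeg.tendsto _).comp (hlim p))
  simp only [fun n => hx.lintegral_expNeg_simpleFunc (F n) (hfin n)] at hL
  exact tendsto_nhds_unique hL hR

/-- A functional of a Poisson point process whose intensity integral is finite is almost surely
finite. -/
theorem IsPoissonPointProcess.ae_tsum_lt_top [IsProbabilityMeasure μ] [SigmaFinite Λ]
    (hx : IsPoissonPointProcess μ x Λ) {f : E → ℝ≥0∞} (hf : Measurable f)
    (hint : ∫⁻ p, f p ∂Λ ≠ ∞) :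
    ∀ᵐ ω ∂μ, ∑' k, f (x k ω) < ∞ := by
  have hm : Measurable fun ω => ∑' k, f (x k ω) :=
    Measurable.tsum fun k => hf.comp (hx.measurable k)
  have hset : MeasurableSet {ω | ∑' k, f (x k ω) < ∞} := measurableSet_lt hm measurable_const
  -- Since `e^{-∞} = 0`, the Laplace functional of `f / n` is at most the probability that the sum
  -- is finite. By `1 - e^{-y} ≤ y` it is at least `exp(-(∫ f) / n)`, which tends to `1`.
  have hbound : ∀ n : ℕ, expNeg ((n : ℝ≥0∞)⁻¹ * ∫⁻ p, f p ∂Λ) ≤ μ {ω | ∑' k, f (x k ω) < ∞} := by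
    intro n
    have hn : (n : ℝ≥0∞)⁻¹ ≠ 0 := by simp
    calc expNeg ((n : ℝ≥0∞)⁻¹ * ∫⁻ p, f p ∂Λ)
        ≤ expNeg (∫⁻ p, (1 - expNeg ((n : ℝ≥0∞)⁻¹ * f p)) ∂Λ) := by
          refine expNeg_antitone ?_
          rw [← lintegral_const_mul _ hf]
          exact lintegral_mono fun p => one_sub_expNeg_le _
      _ = ∫⁻ ω, expNeg (∑' k, (n : ℝ≥0∞)⁻¹ * f (x k ω)) ∂μ := (hx.laplace (hf.const_mul _)).symm
      _ ≤ ∫⁻ ω, {ω | ∑' k, f (x k ω) < ∞}.indicator 1 ω ∂μ := by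
          refine lintegral_mono fun ω => ?_
          by_cases h : ∑' k, f (x k ω) < ∞
          · rw [indicator_of_mem (by exact h)]; exact expNeg_le_one _
          · have h' : ∑' k, f (x k ω) = ∞ := by simpa using h
            simp [ENNReal.tsum_mul_left, h', ENNReal.mul_top hn]
      _ = _ := lintegral_indicator_one hset
  have hlim : Tendsto (fun n : ℕ => expNeg ((n : ℝ≥0∞)⁻¹ * ∫⁻ p, f p ∂Λ)) atTop (𝓝 1) := by
    have h0 : Tendsto (fun n : ℕ => (n : ℝ≥0∞)⁻¹ * ∫⁻ p, f p ∂Λ) atTop (𝓝 0) := by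
      simpa using ENNReal.Tendsto.mul_const ENNReal.tendsto_inv_nat_nhds_zero (Or.inr hint)
    simpa [Function.comp_def] using (continuous_expNeg.tendsto 0).comp h0
  have h1 : 1 ≤ μ {ω | ∑' k, f (x k ω) < ∞} := le_of_tendsto' hlim hbound
  exact (prob_compl_eq_zero_iff hset).2 (le_antisymm prob_le_one h1)

end Poisson

/-! ### Circularly symmetric complex Gaussian laws -/

lemma measurable_complexMk : Measurable (fun p : ℝ × ℝ => (⟨p.1, p.2⟩ : ℂ)) :=
  Complex.measurableEquivRealProd.symm.measurable

instance isProbabilityMeasure_complexGaussian (v : ℝ≥0) :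
    IsProbabilityMeasure (complexGaussian v) :=
  Measure.isProbabilityMeasure_map measurable_complexMk.aemeasurable

lemma charFun_complexGaussian (v : ℝ≥0) (ξ : ℂ) :
    charFun (complexGaussian v) ξ = (rexp (-(v * ‖ξ‖ ^ 2 / 4)) : ℂ) := by
  rw [charFun_apply, complexGaussian, integral_map measurable_complexMk.aemeasurable
    (Continuous.aestronglyMeasurable (by fun_prop))]
  have h : ∀ p : ℝ × ℝ, Complex.exp ((inner ℝ (⟨p.1, p.2⟩ : ℂ) ξ : ℝ) * Complex.I)
      = Complex.exp (ξ.re * p.1 * Complex.I) * Complex.exp (ξ.im * p.2 * Complex.I) := by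
    intro p
    rw [← Complex.exp_add, Complex.inner]
    congr 1
    simp [Complex.mul_re]
    ring
  simp only [h]
  rw [integral_prod_mul (fun s : ℝ => Complex.exp (ξ.re * s * Complex.I))
    (fun s : ℝ => Complex.exp (ξ.im * s * Complex.I)),
    ← charFun_apply_real, ← charFun_apply_real, charFun_gaussianReal, charFun_gaussianReal,
    ← Complex.exp_add, Complex.ofReal_exp, ← Complex.normSq_eq_norm_sq, Complex.normSq_apply]
  congr 1
  push_cast
  ring

/-- Circular symmetry: `⟨w z, ξ⟩ = ⟨z, w̄ ξ⟩`, and the characteristic function sees only the modulus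
of its argument, so the phase of `w` disappears. -/
lemma map_mul_complexGaussian (w : ℂ) (v : ℝ≥0) :
    (complexGaussian v).map (fun z => w * z) = complexGaussian (‖w‖₊ ^ 2 * v) := by
  have hm : Measurable fun z : ℂ => w * z := measurable_const_mul w
  have := Measure.isProbabilityMeasure_map (μ := complexGaussian v) hm.aemeasurable
  refine Measure.ext_of_charFun (funext fun ξ => ?_)
  have h : charFun ((complexGaussian v).map (fun z => w * z)) ξ
      = charFun (complexGaussian v) (starRingEnd ℂ w * ξ) := by
    rw [charFun_apply, charFun_apply, integral_map hm.aemeasurable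
      (Continuous.aestronglyMeasurable (by fun_prop))]
    congr with z
    simp only [Complex.inner]
    congr 3
    simp [Complex.mul_re]
    ring
  rw [h, charFun_complexGaussian, charFun_complexGaussian]
  congr 3
  simp [mul_pow]
  ring

lemma complexGaussian_reProdIm (v : ℝ≥0) {A B : Set ℝ} (hA : MeasurableSet A)
    (hB : MeasurableSet B) :
    complexGaussian v {z | z.re ∈ A ∧ z.im ∈ B} =
      gaussianReal 0 (v / 2) A * gaussianReal 0 (v / 2) B := by
  have hm : MeasurableSet {z : ℂ | z.re ∈ A ∧ z.im ∈ B} :=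
    (Complex.measurable_re hA).inter (Complex.measurable_im hB)
  rw [complexGaussian, Measure.map_apply measurable_complexMk hm, ← Measure.prod_prod]
  rfl

lemma complexGaussian_singleton_zero {v : ℝ≥0} (hv : v ≠ 0) : complexGaussian v {0} = 0 := by
  have : ({0} : Set ℂ) = {z | z.re ∈ ({0} : Set ℝ) ∧ z.im ∈ ({0} : Set ℝ)} := by
    ext z; simp [Complex.ext_iff]
  have := nullSingletonClass_gaussianReal (μ := 0) (v := v / 2) (by simpa using hv)
  rw [‹({0} : Set ℂ) = _›, complexGaussian_reProdIm _ (measurableSet_singleton _)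
    (measurableSet_singleton _), measure_singleton, zero_mul]

/-- Polar coordinates: the density is `π⁻¹ e^{-r²}`, and the angle contributes `2π`. -/
lemma lintegral_complexGaussian_one_norm_sq {f : ℝ → ℝ≥0∞} (hf : Measurable f) :
    ∫⁻ g, f (‖g‖ ^ 2) ∂(complexGaussian 1) =
      ∫⁻ r in Ioi (0 : ℝ), ENNReal.ofReal (2 * r * rexp (-r ^ 2)) * f (r ^ 2) := by
  have hv : (1 / 2 : ℝ≥0) ≠ 0 := by norm_num
  have hd : Measurable fun p : ℝ × ℝ => ENNReal.ofReal (π⁻¹ * rexp (-(p.1 ^ 2 + p.2 ^ 2))) := by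
    fun_prop
  have hprod : ((gaussianReal 0 (1 / 2)).prod (gaussianReal 0 (1 / 2))) =
      (volume : Measure (ℝ × ℝ)).withDensity
        fun p => ENNReal.ofReal (π⁻¹ * rexp (-(p.1 ^ 2 + p.2 ^ 2))) := by
    rw [gaussianReal_of_var_ne_zero _ hv, prod_withDensity (measurable_gaussianPDF _ _)
      (measurable_gaussianPDF _ _), ← Measure.volume_eq_prod]
    congr with p
    rw [gaussianPDF, gaussianPDF, ← ENNReal.ofReal_mul (gaussianPDFReal_nonneg _ _ _),
      gaussianPDFReal, gaussianPDFReal]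
    congr 1
    have h2 : √(2 * π * ((1 / 2 : ℝ≥0) : ℝ)) = √π := by congr 1; push_cast; ring
    rw [h2, mul_mul_mul_comm, ← mul_inv, Real.mul_self_sqrt pi_pos.le, ← Real.exp_add]
    congr 2
    push_cast
    ring
  have hm : Measurable fun g : ℂ => f (‖g‖ ^ 2) := hf.comp (by fun_prop)
  rw [complexGaussian, lintegral_map hm measurable_complexMk, hprod,
    lintegral_withDensity_eq_lintegral_mul _ hd
      (g := fun p : ℝ × ℝ => f (‖(⟨p.1, p.2⟩ : ℂ)‖ ^ 2)) (hm.comp measurable_complexMk),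
    ← lintegral_comp_polarCoord_symm]
  have hpol : ∀ p ∈ polarCoord.target, ENNReal.ofReal p.1 •
      ((fun p : ℝ × ℝ => ENNReal.ofReal (π⁻¹ * rexp (-(p.1 ^ 2 + p.2 ^ 2)))) *
        fun p : ℝ × ℝ => f (‖(⟨p.1, p.2⟩ : ℂ)‖ ^ 2)) (polarCoord.symm p)
      = ENNReal.ofReal (π⁻¹ * (p.1 * rexp (-p.1 ^ 2))) * f (p.1 ^ 2) := by
    intro p hp
    have hp0 : 0 < p.1 := hp.1
    have hsq : (p.1 * Real.cos p.2) ^ 2 + (p.1 * Real.sin p.2) ^ 2 = p.1 ^ 2 := by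
      rw [mul_pow, mul_pow, ← mul_add, Real.cos_sq_add_sin_sq, mul_one]
    simp only [Pi.mul_apply, polarCoord_symm_apply, smul_eq_mul, ← Complex.normSq_eq_norm_sq,
      Complex.normSq_mk, ← sq, hsq]
    rw [← mul_assoc, ← ENNReal.ofReal_mul hp0.le]
    congr 2
    ring
  rw [setLIntegral_congr_fun polarCoord.open_target.measurableSet hpol, polarCoord_target,
    Measure.volume_eq_prod, ← Measure.prod_restrict,
    lintegral_prod _ (by fun_prop)]
  refine setLIntegral_congr_fun measurableSet_Ioi fun r hr => ?_
  have hr0 : 0 < r := hr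
  simp only [lintegral_const, Measure.restrict_apply_univ, Real.volume_Ioo]
  rw [mul_right_comm, ← ENNReal.ofReal_mul (by positivity)]
  congr 2
  field_simp
  ring

/-- The squared modulus of a `CN(0,1)` variable is a standard exponential variable. -/
lemma complexGaussian_one_le_norm_sq {s : ℝ} (hs : 0 ≤ s) :
    (complexGaussian 1).real {g | s ≤ ‖g‖ ^ 2} = rexp (-s) := by
  have hset : MeasurableSet {g : ℂ | s ≤ ‖g‖ ^ 2} :=
    measurableSet_le measurable_const (by fun_prop)
  have hd : ∀ r : ℝ, HasDerivAt (fun r => -rexp (-r ^ 2)) (2 * r * rexp (-r ^ 2)) r := by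
    intro r
    have := ((hasDerivAt_pow 2 r).neg.exp).neg
    convert! this using 1
    simp; ring
  have hlim : Tendsto (fun r : ℝ => -rexp (-r ^ 2)) atTop (𝓝 0) := by
    have := (Real.tendsto_exp_neg_atTop_nhds_zero.comp
      (tendsto_pow_atTop (α := ℝ) two_ne_zero)).neg
    simpa [Function.comp_def] using this
  have hnn : ∀ r ∈ Ioi √s, 0 ≤ 2 * r * rexp (-r ^ 2) := fun r hr => by
    have : 0 < r := (Real.sqrt_nonneg s).trans_lt hr
    positivity
  have hI := integral_Ioi_of_hasDerivAt_of_nonneg' (fun r _ => hd r) hnn hlim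
  have hi := integrableOn_Ioi_deriv_of_nonneg' (fun r _ => hd r) hnn hlim
  have hl : complexGaussian 1 {g | s ≤ ‖g‖ ^ 2} = ENNReal.ofReal (rexp (-s)) := by
    rw [← lintegral_indicator_one hset]
    have h1 : ∀ g : ℂ, {g : ℂ | s ≤ ‖g‖ ^ 2}.indicator (1 : ℂ → ℝ≥0∞) g
        = (Ici s).indicator 1 (‖g‖ ^ 2) := fun g => rfl
    simp only [h1]
    rw [lintegral_complexGaussian_one_norm_sq (measurable_one.indicator measurableSet_Ici)]
    have h2 : ∀ r ∈ Ioi (0 : ℝ), ENNReal.ofReal (2 * r * rexp (-r ^ 2)) *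
        (Ici s).indicator 1 (r ^ 2) =
        (Ici √s).indicator (fun r => ENNReal.ofReal (2 * r * rexp (-r ^ 2))) r := by
      intro r hr
      have : s ≤ r ^ 2 ↔ √s ≤ r := (Real.sqrt_le_left (le_of_lt hr)).symm
      by_cases h : s ≤ r ^ 2
      · rw [indicator_of_mem (mem_Ici.2 h), indicator_of_mem (mem_Ici.2 (this.1 h)), Pi.one_apply,
          mul_one]
      · rw [indicator_of_notMem (by simpa using h), indicator_of_notMem (by rwa [mem_Ici, ← this]),
          mul_zero]
    rw [setLIntegral_congr_fun measurableSet_Ioi h2, lintegral_indicator measurableSet_Ici,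
      Measure.restrict_restrict measurableSet_Ici, Measure.restrict_congr_set (t := Ioi √s) ?_,
      ← ofReal_integral_eq_lintegral_ofReal hi
        ((ae_restrict_iff' measurableSet_Ioi).2 (ae_of_all _ hnn)), hI,
      Real.sq_sqrt hs, zero_sub, neg_neg]
    refine (Ioi_ae_eq_Ici.symm.inter (ae_eq_refl (Ioi 0))).trans ?_
    rw [inter_eq_left.2 (Ioi_subset_Ioi (Real.sqrt_nonneg s))]
    exact ae_eq_refl _
  rw [measureReal_def, hl, ENNReal.toReal_ofReal (exp_pos _).le]

/-- The characteristic function of a variance mixture of complex Gaussian laws. -/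
lemma charFun_map_mul_complexGaussian_one {α : Type*} [MeasurableSpace α] (ν : Measure α)
    [IsProbabilityMeasure ν] {w : α → ℂ} (hw : Measurable w) (ξ : ℂ) :
    charFun ((ν.prod (complexGaussian 1)).map (fun p => w p.1 * p.2)) ξ =
      ((∫ a, rexp (-(‖w a‖ ^ 2 * ‖ξ‖ ^ 2 / 4)) ∂ν : ℝ) : ℂ) := by
  have hm : Measurable fun p : α × ℂ => w p.1 * p.2 := (hw.comp measurable_fst).mul measurable_snd
  have hc : Continuous fun z : ℂ => Complex.exp ((inner ℝ z ξ : ℝ) * Complex.I) := by fun_prop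
  rw [charFun_apply, integral_map hm.aemeasurable hc.aestronglyMeasurable, integral_prod]
  · rw [← integral_complex_ofReal]
    congr with a
    have h := charFun_complexGaussian (‖w a‖₊ ^ 2 * 1) ξ
    rw [← map_mul_complexGaussian, charFun_apply,
      integral_map (measurable_const_mul _).aemeasurable hc.aestronglyMeasurable] at h
    rw [h]
    simp
  · refine Integrable.mono' (integrable_const (1 : ℝ))
      (hc.measurable.comp hm).aestronglyMeasurable (ae_of_all _ fun p => ?_)
    rw [Complex.norm_exp_ofReal_mul_I]

/-! ### Almost sure convergence of series of independent random variables -/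

/-- A series of independent centred square-integrable random variables with summable variances
converges almost surely. -/
theorem ae_exists_tendsto_sum_of_iIndepFun {Ω : Type*} [MeasurableSpace Ω] {μ : Measure Ω}
    {X : ℕ → Ω → ℝ} (hm : ∀ k, Measurable (X k)) (hind : iIndepFun X μ)
    (h2 : ∀ k, MemLp (X k) 2 μ) (h0 : ∀ k, μ[X k] = 0)
    (hv : Summable fun k => variance (X k) μ) :
    ∀ᵐ ω ∂μ, ∃ c, Tendsto (fun N => ∑ k ∈ Finset.range N, X k ω) atTop (𝓝 c) := by
  have hP : IsProbabilityMeasure μ := hind.isProbabilityMeasure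
  have hsm : ∀ k, StronglyMeasurable (X k) := fun k => (hm k).stronglyMeasurable
  set ℱ := Filtration.natural X hsm
  -- The sum runs up to index `n` inclusive, so that `f n` is measurable for the natural filtration
  -- at time `n`.
  set f : ℕ → Ω → ℝ := fun n ω => ∑ k ∈ Finset.range (n + 1), X k ω with hf
  have hf2 : ∀ n, MemLp (f n) 2 μ := fun n => memLp_finsetSum _ fun k _ => h2 k
  have hfint : ∀ n, Integrable (f n) μ := fun n => (hf2 n).integrable one_le_two
  have hadp : StronglyAdapted ℱ f := fun n =>
    Finset.stronglyMeasurable_fun_sum _ fun k hk =>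
      (Filtration.stronglyAdapted_natural hsm k).mono
        (ℱ.mono (Nat.lt_succ_iff.1 (Finset.mem_range.1 hk)))
  have hmart : Martingale f ℱ μ := by
    refine martingale_of_condExp_sub_eq_zero_nat hadp hfint fun n => ?_
    have : f (n + 1) - f n = X (n + 1) := by
      ext ω; simp [hf, Finset.sum_range_succ _ (n + 1)]
    rw [this]
    refine (hind.condExp_natural_ae_eq_of_lt hsm (Nat.lt_succ_self n)).trans ?_
    simp only [h0]
    exact ae_eq_refl _
  have hmean : ∀ n, ∫ ω, f n ω ∂μ = 0 := fun n => by
    rw [integral_finsetSum _ fun k _ => (h2 k).integrable one_le_two]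
    exact Finset.sum_eq_zero fun k _ => h0 k
  have hsq : ∀ n, ∫ ω, f n ω ^ 2 ∂μ ≤ ∑' k, variance (X k) μ := by
    intro n
    rw [← variance_of_integral_eq_zero (hf2 n).aemeasurable (hmean n)]
    have : f n = ∑ k ∈ Finset.range (n + 1), X k := by ext ω; simp [hf]
    rw [this, IndepFun.variance_sum (fun k _ => h2 k) fun i _ j _ hij => hind.indepFun hij]
    exact hv.sum_le_tsum _ fun k _ => variance_nonneg _ _
  -- The submartingale theorem asks for an L¹ bound; `|f| ≤ 1 + f²` supplies it from the summable
  -- variances.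
  have hbdd : ∀ n, eLpNorm (f n) 1 μ ≤ (1 + ∑' k, variance (X k) μ).toNNReal := by
    intro n
    rw [eLpNorm_one_eq_lintegral_enorm, ← ofReal_integral_norm_eq_lintegral_enorm (hfint n),
      ← ENNReal.ofReal]
    refine ENNReal.ofReal_le_ofReal ?_
    calc ∫ ω, ‖f n ω‖ ∂μ ≤ ∫ ω, (1 + f n ω ^ 2) ∂μ := by
          refine integral_mono (hfint n).norm ((integrable_const 1).add (hf2 n).integrable_sq)
            fun ω => ?_
          simp only [Real.norm_eq_abs]
          nlinarith [sq_nonneg (|f n ω| - 1), sq_abs (f n ω), abs_nonneg (f n ω)]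
      _ = 1 + ∫ ω, f n ω ^ 2 ∂μ := by
          rw [integral_add (integrable_const 1) (hf2 n).integrable_sq]; simp
      _ ≤ _ := by linarith [hsq n]
  filter_upwards [hmart.submartingale.exists_ae_tendsto_of_bdd hbdd] with ω ⟨c, hc⟩
  exact ⟨c, (tendsto_add_atTop_iff_nat 1).1 hc⟩

/-! ### Series of independent complex Gaussians -/

lemma map_re_complexGaussian (v : ℝ≥0) :
    (complexGaussian v).map Complex.re = gaussianReal 0 (v / 2) := by
  rw [complexGaussian, Measure.map_map Complex.measurable_re measurable_complexMk]
  exact (Measure.map_fst_prod (μ := gaussianReal 0 (v / 2))).trans (by simp)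

lemma map_im_complexGaussian (v : ℝ≥0) :
    (complexGaussian v).map Complex.im = gaussianReal 0 (v / 2) := by
  rw [complexGaussian, Measure.map_map Complex.measurable_im measurable_complexMk]
  exact (Measure.map_snd_prod (μ := gaussianReal 0 (v / 2))).trans (by simp)

lemma map_mul_of_map_eq_complexGaussian {Ω : Type*} [MeasurableSpace Ω] {μ : Measure Ω}
    {h : Ω → ℂ} (hm : Measurable h) (hlaw : μ.map h = complexGaussian 1) (a : ℂ) :
    μ.map (fun ω => a * h ω) = complexGaussian (‖a‖₊ ^ 2) := by
  have : (fun ω => a * h ω) = (fun z => a * z) ∘ h := rfl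
  rw [this, ← Measure.map_map (measurable_const_mul a) hm, hlaw, map_mul_complexGaussian, mul_one]

/-- A series of independent complex Gaussian variables with summable variances converges almost
surely. -/
theorem ae_exists_tendsto_sum_complexGaussian {Ω : Type*} [MeasurableSpace Ω] {μ : Measure Ω}
    {h : ℕ → Ω → ℂ} (hm : ∀ k, Measurable (h k)) (hind : iIndepFun h μ)
    (hlaw : ∀ k, μ.map (h k) = complexGaussian 1) {a : ℕ → ℂ}
    (ha : Summable fun k => ‖a k‖ ^ 2) :
    ∀ᵐ ω ∂μ, ∃ c, Tendsto (fun N => ∑ k ∈ Finset.range N, a k * h k ω) atTop (𝓝 c) := by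
  -- `L` stands for the real or the imaginary part: either one maps `CN(0, v)` to `N(0, v/2)`, so
  -- the real summands are centred with variance `‖a k‖² / 2`.
  have key : ∀ L : ℂ → ℝ, Measurable L →
      (∀ v, (complexGaussian v).map L = gaussianReal 0 (v / 2)) →
      ∀ᵐ ω ∂μ, ∃ c, Tendsto (fun N => ∑ k ∈ Finset.range N, L (a k * h k ω)) atTop (𝓝 c) := by
    intro L hL hLlaw
    have hXm : ∀ k, Measurable fun ω => L (a k * h k ω) := fun k =>
      hL.comp ((hm k).const_mul (a k))
    have hX : ∀ k, μ.map (fun ω => L (a k * h k ω)) = gaussianReal 0 (‖a k‖₊ ^ 2 / 2) := by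
      intro k
      have : (fun ω => L (a k * h k ω)) = L ∘ fun ω => a k * h k ω := rfl
      rw [this, ← Measure.map_map hL ((hm k).const_mul (a k)),
        map_mul_of_map_eq_complexGaussian (hm k) (hlaw k), hLlaw]
    refine ae_exists_tendsto_sum_of_iIndepFun hXm
      (hind.comp (fun k z => L (a k * z)) fun k => hL.comp (measurable_const_mul _)) ?_ ?_ ?_
    · intro k
      have := memLp_id_gaussianReal (μ := 0) (v := ‖a k‖₊ ^ 2 / 2) 2
      rw [← hX k, memLp_map_measure_iff aestronglyMeasurable_id (hXm k).aemeasurable] at this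
      exact this
    · intro k
      have := integral_id_gaussianReal (μ := 0) (v := ‖a k‖₊ ^ 2 / 2)
      rwa [← hX k, integral_map (f := fun x => x) (hXm k).aemeasurable
        aestronglyMeasurable_id] at this
    · have hvar : ∀ k, variance (fun ω => L (a k * h k ω)) μ = ‖a k‖ ^ 2 / 2 := by
        intro k
        have := variance_id_gaussianReal (μ := 0) (v := ‖a k‖₊ ^ 2 / 2)
        rw [← hX k, variance_id_map (hXm k).aemeasurable] at this
        rw [this]; simp
      simp only [hvar]
      exact ha.div_const 2
  filter_upwards [key _ Complex.measurable_re map_re_complexGaussian,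
    key _ Complex.measurable_im map_im_complexGaussian] with ω ⟨c, hc⟩ ⟨d, hd⟩
  refine ⟨⟨c, d⟩, ?_⟩
  have hcd : Tendsto (fun N => (((∑ k ∈ Finset.range N, (a k * h k ω).re : ℝ) : ℂ) +
      ((∑ k ∈ Finset.range N, (a k * h k ω).im : ℝ) : ℂ) * Complex.I)) atTop
      (𝓝 ((c : ℂ) + (d : ℂ) * Complex.I)) :=
    ((Complex.continuous_ofReal.tendsto c).comp hc).add
      (((Complex.continuous_ofReal.tendsto d).comp hd).mul_const _)
  rw [Complex.mk_eq_add_mul_I]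
  refine hcd.congr fun N => ?_
  rw [← Complex.re_sum, ← Complex.im_sum, Complex.re_add_im]

/-! ### Rearranging independent random variables -/

/-- If `A` is independent of `(B, C)` and `B` is independent of `C`, then `B` is independent of
`(A, C)`. -/
lemma indepFun_prodMk_swap {Ω α β γ : Type*} [MeasurableSpace Ω] [MeasurableSpace α]
    [MeasurableSpace β] [MeasurableSpace γ] {μ : Measure Ω} [IsProbabilityMeasure μ]
    {A : Ω → α} {B : Ω → β} {C : Ω → γ} (hA : Measurable A) (hB : Measurable B)
    (hC : Measurable C) (h1 : IndepFun A (fun ω => (B ω, C ω)) μ) (h2 : IndepFun B C μ) :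
    IndepFun B (fun ω => (A ω, C ω)) μ := by
  have hAC : IndepFun A C μ := h1.comp measurable_id measurable_snd
  have := Measure.isProbabilityMeasure_map (μ := μ) hA.aemeasurable
  have := Measure.isProbabilityMeasure_map (μ := μ) hB.aemeasurable
  have := Measure.isProbabilityMeasure_map (μ := μ) hC.aemeasurable
  have := Measure.isProbabilityMeasure_map (μ := μ) (hB.prodMk (hA.prodMk hC)).aemeasurable
  have e1 := (indepFun_iff_map_prod_eq_prod_map_map hA.aemeasurable
    (hB.prodMk hC).aemeasurable).1 h1
  have e2 := (indepFun_iff_map_prod_eq_prod_map_map hB.aemeasurable hC.aemeasurable).1 h2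
  have e3 := (indepFun_iff_map_prod_eq_prod_map_map hA.aemeasurable hC.aemeasurable).1 hAC
  rw [indepFun_iff_map_prod_eq_prod_map_map hB.aemeasurable (hA.prodMk hC).aemeasurable, e3]
  refine Measure.ext_prod₃ fun {s t u} hs ht hu => ?_
  have e := congrArg (fun m => m (t ×ˢ s ×ˢ u)) e1
  simp only [e2, Measure.prod_prod] at e
  rw [Measure.prod_prod, Measure.prod_prod, Measure.map_apply (hB.prodMk (hA.prodMk hC))
    (hs.prod (ht.prod hu)), mul_left_comm, ← e, Measure.map_apply (hA.prodMk (hB.prodMk hC))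
    (ht.prod (hs.prod hu))]
  congr 1
  ext ω
  simp only [mem_preimage, mem_prod]
  tauto

/-- The first variable of an independent sequence is independent of the sequence of the others. -/
lemma indepFun_zero_succ {Ω α : Type*} [MeasurableSpace Ω] [MeasurableSpace α]
    {μ : Measure Ω} {f : ℕ → Ω → α} (hf : ∀ k, Measurable (f k)) (hind : iIndepFun f μ) :
    IndepFun (f 0) (fun ω k => f (k + 1) ω) μ := by
  have h := indep_iSup_of_disjoint (S := {0}) (T := {k | 0 < k}) (fun k => (hf k).comap_le)
    (iIndepFun_iff_iIndep .. |>.1 hind) (by simp)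
  rw [IndepFun_iff_Indep]
  refine indep_of_indep_of_le h (le_iSup₂_of_le 0 rfl le_rfl) ?_
  rw [← measurable_iff_comap_le]
  refine @measurable_pi_lambda _ _ _ (_) _ _ fun k => ?_
  exact (comap_measurable (f (k + 1))).mono (le_iSup₂_of_le (k + 1) (Nat.succ_pos k) le_rfl) le_rfl

namespace IsDownlink

variable {Ω : Type*} [MeasurableSpace Ω] {μ : Measure Ω} [IsProbabilityMeasure μ] {lam r₀ : ℝ}
  {N₀ : ℝ≥0} {K : ℕ} {x : ℕ → Ω → EuclideanSpace ℝ (Fin 2)} {s h : ℕ → Ω → ℂ} {n : Ω → ℂ}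

/-- This is the independence that allows locations and symbols to be frozen while the channels stay
i.i.d. Gaussian. -/
lemma indep_h_xs (H : IsDownlink μ lam r₀ N₀ K x s h n) :
    IndepFun (fun ω k => h k ω) (fun ω => ((fun k => x k ω), (fun k => s k ω))) μ := by
  have mx := measurable_pi_lambda _ H.poisson.measurable
  have ms := measurable_pi_lambda _ H.measurable_s
  have mh := measurable_pi_lambda _ H.measurable_h
  refine indepFun_prodMk_swap mx mh ms ?_ ?_
  · exact H.indep_x.comp measurable_id
      (show Measurable fun p : (ℕ → ℂ) × (ℕ → ℂ) × ℂ => (p.2.1, p.1) by fun_prop)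
  · exact (H.indep_s.comp measurable_id measurable_fst).symm

lemma indep_n_xsh (H : IsDownlink μ lam r₀ N₀ K x s h n) :
    IndepFun n (fun ω => ((fun k => x k ω), (fun k => s k ω), fun k => h k ω)) μ := by
  have mx := measurable_pi_lambda _ H.poisson.measurable
  have ms := measurable_pi_lambda _ H.measurable_s
  have mh := measurable_pi_lambda _ H.measurable_h
  have h1 : IndepFun n (fun ω => ((fun k => s k ω), fun k => h k ω)) μ := by
    refine indepFun_prodMk_swap ms H.measurable_n mh ?_ H.indep_h.symm
    exact H.indep_s.comp measurable_id (measurable_snd.prodMk measurable_fst)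
  refine indepFun_prodMk_swap mx H.measurable_n (ms.prodMk mh) ?_ h1
  exact H.indep_x.comp measurable_id
    (show Measurable fun p : (ℕ → ℂ) × (ℕ → ℂ) × ℂ => (p.2.2, p.1, p.2.1) by fun_prop)

/-- The intended symbol is independent of everything else. -/
lemma indep_s_zero (H : IsDownlink μ lam r₀ N₀ K x s h n) :
    IndepFun (s 0) (fun ω => (h 0 ω, (fun k => x k ω), (fun k => s (k + 1) ω),
      (fun k => h (k + 1) ω), n ω)) μ := by
  have mx := measurable_pi_lambda _ H.poisson.measurable
  have ms := measurable_pi_lambda _ H.measurable_s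
  have ms' := measurable_pi_lambda _ fun k => H.measurable_s (k + 1)
  have mh := measurable_pi_lambda _ H.measurable_h
  have h1 : IndepFun (s 0) (fun ω => ((fun k => h k ω, n ω), fun k => s (k + 1) ω)) μ := by
    refine indepFun_prodMk_swap (mh.prodMk H.measurable_n) (H.measurable_s 0) ms' ?_
      (indepFun_zero_succ H.measurable_s H.iIndep_s)
    exact H.indep_s.symm.comp measurable_id
      (show Measurable fun f : ℕ → ℂ => (f 0, fun k => f (k + 1)) by fun_prop)
  have h2 := indepFun_prodMk_swap mx (H.measurable_s 0)
    ((mh.prodMk H.measurable_n).prodMk ms') (H.indep_x.comp measurable_id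
      (show Measurable fun p : (ℕ → ℂ) × (ℕ → ℂ) × ℂ =>
        (p.1 0, (p.2, fun k => p.1 (k + 1))) by fun_prop)) h1
  exact h2.comp measurable_id (show Measurable fun p :
    (ℕ → EuclideanSpace ℝ (Fin 2)) × ((ℕ → ℂ) × ℂ) × (ℕ → ℂ) =>
      (p.2.1.1 0, p.1, p.2.2, (fun k => p.2.1.1 (k + 1)), p.2.1.2) by fun_prop)

/-- The intended channel is independent of the interference and the noise. -/
lemma indep_h_zero (H : IsDownlink μ lam r₀ N₀ K x s h n) :
    IndepFun (h 0) (fun ω => ((fun k => x k ω), (fun k => s (k + 1) ω),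
      (fun k => h (k + 1) ω), n ω)) μ := by
  have mx := measurable_pi_lambda _ H.poisson.measurable
  have ms' := measurable_pi_lambda _ fun k => H.measurable_s (k + 1)
  have mh := measurable_pi_lambda _ H.measurable_h
  have mh' := measurable_pi_lambda _ fun k => H.measurable_h (k + 1)
  have h1 : IndepFun (h 0) (fun ω => (n ω, fun k => h (k + 1) ω)) μ :=
    indepFun_prodMk_swap H.measurable_n (H.measurable_h 0) mh' (H.indep_h.symm.comp measurable_id
      (show Measurable fun f : ℕ → ℂ => (f 0, fun k => f (k + 1)) by fun_prop))
      (indepFun_zero_succ H.measurable_h H.iIndep_h)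
  have h2 := indepFun_prodMk_swap ms' (H.measurable_h 0) (H.measurable_n.prodMk mh')
    (H.indep_s.comp (show Measurable fun (f : ℕ → ℂ) (k : ℕ) => f (k + 1) by fun_prop)
      (show Measurable fun p : (ℕ → ℂ) × ℂ => (p.1 0, (p.2, fun k => p.1 (k + 1))) by fun_prop)) h1
  have h3 := indepFun_prodMk_swap mx (H.measurable_h 0)
    (ms'.prodMk (H.measurable_n.prodMk mh')) (H.indep_x.comp measurable_id
      (show Measurable fun p : (ℕ → ℂ) × (ℕ → ℂ) × ℂ =>
        (p.2.1 0, ((fun k => p.1 (k + 1)), (p.2.2, fun k => p.2.1 (k + 1)))) by fun_prop)) h2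
  exact h3.comp measurable_id (show Measurable fun p :
    (ℕ → EuclideanSpace ℝ (Fin 2)) × (ℕ → ℂ) × ℂ × (ℕ → ℂ) =>
      (p.1, p.2.1, p.2.2.2, p.2.2.1) by fun_prop)

end IsDownlink

/-! ### The intensity integral as a confluent hypergeometric function -/

lemma ascPochhammer_eval_mul_add (a : ℝ) (n : ℕ) :
    (ascPochhammer ℝ n).eval a * (a + n) = a * (ascPochhammer ℝ n).eval (a + 1) := by
  rw [← ascPochhammer_succ_eval, ascPochhammer_succ_left]
  simp

/-- When the lower parameter is the upper one plus one, the Pochhammer quotient telescopes. The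
coefficients `a / (a + n)` that remain are those produced by integrating powers. -/
lemma ascPochhammer_eval_div {a : ℝ} (ha : 0 < a + 1) {n : ℕ} (hn : a + n ≠ 0) :
    (ascPochhammer ℝ n).eval a / (ascPochhammer ℝ n).eval (a + 1) = a / (a + n) := by
  rw [div_eq_div_iff (ascPochhammer_pos n _ ha).ne' hn, ascPochhammer_eval_mul_add]

/-- Expand `1 - e^{-c y^{-η}}` and integrate term by term. Each power `y^{1 - η(n+1)}` is integrable
at infinity because `η > 2`; the denominators are at least `η - 2`, so an exponential series
dominates the integrals of the norms. -/
lemma hasSum_integral_Ioi_mul_one_sub_exp {η : ℝ} (hη : 2 < η) {r₀ : ℝ} (hr₀ : 0 < r₀) (c : ℝ) :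
    HasSum (fun n : ℕ => -((-c) ^ (n + 1) / (n + 1).factorial) *
        (r₀ ^ (2 - η * (n + 1)) / (η * (n + 1) - 2)))
      (∫ y in Ioi r₀, y * (1 - rexp (-(c * y ^ (-η))))) := by
  have hexp : ∀ n : ℕ, 1 - η * (n + 1) < -1 := fun n => by
    have : (0 : ℝ) ≤ n := n.cast_nonneg
    nlinarith
  set F : ℕ → ℝ → ℝ := fun n y => -((-c) ^ (n + 1) / (n + 1).factorial) * y ^ (1 - η * (n + 1))
    with hF
  have hFi : ∀ n, Integrable (F n) (volume.restrict (Ioi r₀)) := fun n =>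
    (integrableOn_Ioi_rpow_of_lt (hexp n) hr₀).const_mul _
  have hI : ∀ n : ℕ, ∫ y in Ioi r₀, y ^ (1 - η * (n + 1)) =
      r₀ ^ (2 - η * (n + 1)) / (η * (n + 1) - 2) := fun n => by
    rw [integral_Ioi_rpow_of_lt (hexp n) hr₀]
    have h1 : 1 - η * (n + 1) + 1 = 2 - η * (n + 1) := by ring
    rw [h1, ← neg_sub (η * (n + 1)) 2, neg_div_neg_eq]
  have hFsum : Summable fun n => ∫ y in Ioi r₀, ‖F n y‖ := by
    have hn : ∀ n, ∫ y in Ioi r₀, ‖F n y‖ =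
        |c| ^ (n + 1) / (n + 1).factorial * (r₀ ^ (2 - η * (n + 1)) / (η * (n + 1) - 2)) := by
      intro n
      rw [← hI n, ← integral_const_mul]
      refine setIntegral_congr_fun measurableSet_Ioi fun y hy => ?_
      have hy0 : 0 < y := hr₀.trans hy
      simp only [hF]
      rw [norm_mul, norm_neg, norm_div, norm_pow, norm_neg, Real.norm_eq_abs, Real.norm_natCast,
        Real.norm_of_nonneg (rpow_nonneg hy0.le _)]
    simp only [hn]
    have hs := (summable_nat_add_iff 1).2 (Real.summable_pow_div_factorial (|c| * r₀ ^ (-η)))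
    refine Summable.of_nonneg_of_le (fun n => ?_) (fun n => ?_) (hs.mul_left (r₀ ^ 2 / (η - 2)))
    · have : 0 < η * (n + 1) - 2 := by linarith [hexp n]
      positivity
    · have h2 : r₀ ^ (2 - η * (n + 1)) = r₀ ^ 2 * (r₀ ^ (-η)) ^ (n + 1) := by
        rw [← rpow_natCast (r₀ ^ (-η)), ← rpow_mul hr₀.le, ← rpow_natCast r₀ 2, ← rpow_add hr₀]
        push_cast; congr 1; ring
      have h3 : η - 2 ≤ η * (n + 1) - 2 := by
        have : (0 : ℝ) ≤ n := n.cast_nonneg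
        nlinarith
      rw [h2, mul_pow]
      calc |c| ^ (n + 1) / (n + 1).factorial *
            (r₀ ^ 2 * (r₀ ^ (-η)) ^ (n + 1) / (η * (n + 1) - 2))
          ≤ |c| ^ (n + 1) / (n + 1).factorial * (r₀ ^ 2 * (r₀ ^ (-η)) ^ (n + 1) / (η - 2)) := by
            have h4 : 0 < η - 2 := by linarith
            gcongr
        _ = _ := by ring
  have hsum := hasSum_integral_of_summable_integral_norm hFi hFsum
  have hterm : ∀ n, ∫ y in Ioi r₀, F n y = -((-c) ^ (n + 1) / (n + 1).factorial) *
        (r₀ ^ (2 - η * (n + 1)) / (η * (n + 1) - 2)) := fun n => by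
    rw [← hI n, ← integral_const_mul]
  simp only [hterm] at hsum
  have hcongr : ∫ y in Ioi r₀, y * (1 - rexp (-(c * y ^ (-η)))) = ∫ y in Ioi r₀, ∑' n, F n y := by
    refine setIntegral_congr_fun measurableSet_Ioi fun y hy => ?_
    have hy0 : 0 < y := hr₀.trans hy
    have he := (hasSum_nat_add_iff' 1).2 (NormedSpace.expSeries_div_hasSum_exp (-(c * y ^ (-η))))
    rw [← Real.exp_eq_exp_ℝ] at he
    have he' := (he.mul_left (-y)).tsum_eq
    simp only [Finset.range_one, Finset.sum_singleton, pow_zero, Nat.factorial_zero, Nat.cast_one,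
      div_one] at he'
    have : y * (1 - rexp (-(c * y ^ (-η)))) = -y * (rexp (-(c * y ^ (-η))) - 1) := by ring
    simp only [this]
    rw [← he']
    refine tsum_congr fun n => ?_
    have h2 : y ^ (1 - η * (n + 1)) = y * (y ^ (-η)) ^ (n + 1) := by
      rw [← rpow_natCast (y ^ (-η)), ← rpow_mul hy0.le]
      nth_rewrite 2 [← rpow_one y]
      rw [← rpow_add hy0]
      push_cast; congr 1; ring
    simp only [hF, h2]
    rw [neg_mul_eq_neg_mul, mul_pow]
    ring
  rw [hcongr]
  exact hsum

/-- For `a = -2/η` one has `a / (a + n + 1) = -2 / (η(n+1) - 2)`, so the `n`-th integrated term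
times `2 / r₀²` is the Kummer term of index `n + 1`. The absent zeroth term accounts for the `-1`.
-/
lemma integral_Ioi_mul_one_sub_exp {η : ℝ} (hη : 2 < η) {r₀ : ℝ} (hr₀ : 0 < r₀) (c : ℝ) :
    ∫ y in Ioi r₀, y * (1 - rexp (-(c * y ^ (-η)))) =
      r₀ ^ 2 / 2 * (hyp1F1 (-2 / η) (1 - 2 / η) (-(c * r₀ ^ (-η))) - 1) := by
  have hs := hasSum_integral_Ioi_mul_one_sub_exp hη hr₀ c
  have hη0 : 0 < η := by linarith
  have ha : 0 < -2 / η + 1 := by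
    have : 2 / η < 1 := (div_lt_one hη0).2 hη
    rw [neg_div]; linarith
  have hab : 1 - 2 / η = -2 / η + 1 := by ring
  set u : ℕ → ℝ := fun n => (ascPochhammer ℝ n).eval (-2 / η) /
    (ascPochhammer ℝ n).eval (-2 / η + 1) * ((-(c * r₀ ^ (-η))) ^ n / n.factorial) with hu
  have hterm : ∀ n : ℕ, 2 / r₀ ^ 2 * (-((-c) ^ (n + 1) / (n + 1).factorial) *
        (r₀ ^ (2 - η * (n + 1)) / (η * (n + 1) - 2))) = u (n + 1) := by
    intro n
    have h2 : r₀ ^ (2 - η * (n + 1)) = r₀ ^ 2 * (r₀ ^ (-η)) ^ (n + 1) := by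
      rw [← rpow_natCast (r₀ ^ (-η)), ← rpow_mul hr₀.le, ← rpow_natCast r₀ 2, ← rpow_add hr₀]
      push_cast; congr 1; ring
    have h3 : 0 < η * (n + 1) - 2 := by
      have : (0 : ℝ) ≤ n := n.cast_nonneg
      nlinarith
    have h4 : -2 / η + ((n + 1 : ℕ) : ℝ) = (η * (n + 1) - 2) / η := by
      field_simp; push_cast; ring
    have h5 : -2 / η + ((n + 1 : ℕ) : ℝ) ≠ 0 := by rw [h4]; positivity
    simp only [hu]
    rw [ascPochhammer_eval_div ha h5, h4, h2, neg_mul_eq_neg_mul, mul_pow]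
    field_simp
  have hs2 := hs.mul_left (2 / r₀ ^ 2)
  simp only [hterm] at hs2
  have hs3 := (hasSum_nat_add_iff 1).1 hs2
  have hu0 : u 0 = 1 := by simp [hu]
  rw [hyp1F1, hab, hs3.tsum_eq]
  simp only [Finset.range_one, Finset.sum_singleton, hu0]
  field_simp
  ring

/-- The Laplace exponent of the interference caused by transmitters of a given power. -/
lemma lintegral_one_sub_exp_norm_rpow {η : ℝ} (hη : 2 < η) {r₀ : ℝ} (hr₀ : 0 < r₀) {c : ℝ}
    (hc : 0 ≤ c) :
    ∫⁻ p in {p : EuclideanSpace ℝ (Fin 2) | r₀ < ‖p‖},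
        ENNReal.ofReal (1 - rexp (-(c * ‖p‖ ^ (-η)))) =
      ENNReal.ofReal (π * r₀ ^ 2 *
        (hyp1F1 (-2 / η) (1 - 2 / η) (-(c * r₀ ^ (-η))) - 1)) := by
  set F : ℝ → ℝ := (Ioi r₀).indicator fun y => 1 - rexp (-(c * y ^ (-η))) with hF
  have hset : MeasurableSet {p : EuclideanSpace ℝ (Fin 2) | r₀ < ‖p‖} :=
    measurableSet_lt measurable_const measurable_norm
  have hF0 : ∀ y, 0 ≤ F y := fun y => by
    refine indicator_nonneg (fun y hy => ?_) y
    have : 0 < y := hr₀.trans hy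
    have : rexp (-(c * y ^ (-η))) ≤ 1 := exp_le_one_iff.2 (by
      have := rpow_nonneg this.le (-η)
      nlinarith [mul_nonneg hc this])
    linarith
  have hind : (fun y : ℝ => y ^ (Module.finrank ℝ (EuclideanSpace ℝ (Fin 2)) - 1) • F y) =
      (Ioi r₀).indicator fun y => y * (1 - rexp (-(c * y ^ (-η)))) := by
    ext y
    by_cases hy : y ∈ Ioi r₀ <;> simp [hF, hy]
  have hint : Integrable (fun p : EuclideanSpace ℝ (Fin 2) => F ‖p‖) := by
    rw [integrable_fun_norm_addHaar volume, hind]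
    refine Integrable.integrableOn ?_
    rw [integrable_indicator_iff measurableSet_Ioi]
    -- The majorant comes from `1 - e^{-u} ≤ u` and the planar Jacobian `y`.
    have hmaj : IntegrableOn (fun y : ℝ => c * y ^ (1 - η)) (Ioi r₀) :=
      (integrableOn_Ioi_rpow_of_lt (by linarith) hr₀).const_mul c
    refine Integrable.mono' hmaj ?_ ((ae_restrict_iff' measurableSet_Ioi).2
      (ae_of_all _ fun y hy => ?_))
    · exact Measurable.aestronglyMeasurable (by fun_prop)
    · have hy0 : 0 < y := hr₀.trans hy
      have h0 := hF0 y
      simp only [hF, indicator_of_mem hy] at h0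
      rw [norm_mul, Real.norm_of_nonneg hy0.le, Real.norm_of_nonneg h0, sub_eq_add_neg 1 η,
        rpow_add hy0, rpow_one]
      have := add_one_le_exp (-(c * y ^ (-η)))
      nlinarith
  have h1 : ∀ p : EuclideanSpace ℝ (Fin 2),
      {p : EuclideanSpace ℝ (Fin 2) | r₀ < ‖p‖}.indicator
        (fun p => ENNReal.ofReal (1 - rexp (-(c * ‖p‖ ^ (-η))))) p = ENNReal.ofReal (F ‖p‖) := by
    intro p
    by_cases hp : r₀ < ‖p‖ <;> simp [hF, hp]
  rw [← lintegral_indicator hset]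
  simp only [h1]
  rw [← ofReal_integral_eq_lintegral_ofReal hint (ae_of_all _ fun p => hF0 _),
    integral_fun_norm_addHaar volume, hind, setIntegral_indicator measurableSet_Ioi,
    inter_eq_right.2 (Ioi_subset_Ioi hr₀.le), integral_Ioi_mul_one_sub_exp hη hr₀, measureReal_def,
    InnerProductSpace.volume_ball_of_dim_even (k := 1) (by simp)]
  congr 1
  simp [pi_pos.le]
  ring

lemma lintegral_norm_rpow_lt_top {η : ℝ} (hη : 2 < η) {r₀ : ℝ} (hr₀ : 0 < r₀) :
    ∫⁻ p in {p : EuclideanSpace ℝ (Fin 2) | r₀ < ‖p‖}, ENNReal.ofReal (‖p‖ ^ (-η)) < ∞ := by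
  have hset : MeasurableSet {p : EuclideanSpace ℝ (Fin 2) | r₀ < ‖p‖} :=
    measurableSet_lt measurable_const measurable_norm
  have hint : Integrable
      (fun p : EuclideanSpace ℝ (Fin 2) => (Ioi r₀).indicator (fun y : ℝ => y ^ (-η)) ‖p‖) := by
    rw [integrable_fun_norm_addHaar volume]
    have hind : (fun y : ℝ => y ^ (Module.finrank ℝ (EuclideanSpace ℝ (Fin 2)) - 1) •
        (Ioi r₀).indicator (fun y : ℝ => y ^ (-η)) y) =
        (Ioi r₀).indicator fun y => y ^ (1 - η) := by
      ext y
      by_cases hy : y ∈ Ioi r₀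
      · have hy0 : 0 < y := hr₀.trans hy
        simp [hy, sub_eq_add_neg, rpow_add hy0]
      · simp [hy]
    rw [hind]
    refine Integrable.integrableOn ?_
    rw [integrable_indicator_iff measurableSet_Ioi]
    exact integrableOn_Ioi_rpow_of_lt (by linarith) hr₀
  have h1 : IntegrableOn (fun p : EuclideanSpace ℝ (Fin 2) => ‖p‖ ^ (-η)) {p | r₀ < ‖p‖} := by
    rw [← integrable_indicator_iff hset]
    exact hint
  exact h1.lintegral_lt_top

/-! ### Integrating over independent random variables separately -/

section Indep

variable {Ω α β : Type*} [MeasurableSpace Ω] [MeasurableSpace α] [MeasurableSpace β]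
  {μ : Measure Ω} [IsProbabilityMeasure μ] {A : Ω → α} {B : Ω → β}

/-- Here and in the next two lemmas, independence lets `B` be sampled at a second point `ω'`.
Integrating over `ω'` with `ω` fixed plays the role of conditioning on `A`. -/
lemma lintegral_prodMk_of_indepFun (hA : Measurable A) (hB : Measurable B) (h : IndepFun A B μ)
    {F : α × β → ℝ≥0∞} (hF : Measurable F) :
    ∫⁻ ω, F (A ω, B ω) ∂μ = ∫⁻ ω, ∫⁻ ω', F (A ω, B ω') ∂μ ∂μ := by
  have := Measure.isProbabilityMeasure_map (μ := μ) hB.aemeasurable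
  rw [← lintegral_map hF (hA.prodMk hB),
    (indepFun_iff_map_prod_eq_prod_map_map hA.aemeasurable hB.aemeasurable).1 h,
    lintegral_prod _ hF.aemeasurable, lintegral_map hF.lintegral_prod_right' hA]
  refine lintegral_congr fun ω => ?_
  rw [lintegral_map (f := fun b => F (A ω, b)) (hF.comp measurable_prodMk_left) hB]

lemma integral_prodMk_of_indepFun {E : Type*} [NormedAddCommGroup E] [NormedSpace ℝ E]
    (hA : Measurable A) (hB : Measurable B) (h : IndepFun A B μ)
    {F : α × β → E} (hF : StronglyMeasurable F) {C : ℝ} (hC : ∀ p, ‖F p‖ ≤ C) :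
    ∫ ω, F (A ω, B ω) ∂μ = ∫ ω, ∫ ω', F (A ω, B ω') ∂μ ∂μ := by
  have := Measure.isProbabilityMeasure_map (μ := μ) hA.aemeasurable
  have := Measure.isProbabilityMeasure_map (μ := μ) hB.aemeasurable
  rw [← integral_map (hA.prodMk hB).aemeasurable hF.aestronglyMeasurable,
    (indepFun_iff_map_prod_eq_prod_map_map hA.aemeasurable hB.aemeasurable).1 h,
    integral_prod _ (Integrable.mono' (integrable_const C) hF.aestronglyMeasurable
      (ae_of_all _ hC)),
    integral_map hA.aemeasurable hF.integral_prod_right'.aestronglyMeasurable]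
  congr with ω
  rw [integral_map (f := fun b => F (A ω, b)) hB.aemeasurable
    (hF.comp_measurable measurable_prodMk_left).aestronglyMeasurable]

lemma ae_prodMk_of_indepFun (hA : Measurable A) (hB : Measurable B) (h : IndepFun A B μ)
    {S : Set (α × β)} (hS : MeasurableSet S) (hae : ∀ᵐ ω ∂μ, ∀ᵐ ω' ∂μ, (A ω, B ω') ∈ S) :
    ∀ᵐ ω ∂μ, (A ω, B ω) ∈ S := by
  have hI := lintegral_prodMk_of_indepFun hA hB h (F := Sᶜ.indicator 1)
    (measurable_one.indicator hS.compl)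
  have h0 : ∫⁻ ω, ∫⁻ ω', Sᶜ.indicator (1 : α × β → ℝ≥0∞) (A ω, B ω') ∂μ ∂μ = 0 := by
    rw [← lintegral_zero (μ := μ)]
    refine lintegral_congr_ae (hae.mono fun ω hω => ?_)
    simp only []
    rw [← lintegral_zero (μ := μ)]
    refine lintegral_congr_ae (hω.mono fun ω' hω' => ?_)
    simp [hω']
  have hm : Measurable fun ω => Sᶜ.indicator (1 : α × β → ℝ≥0∞) (A ω, B ω) :=
    (measurable_one.indicator hS.compl).comp (hA.prodMk hB)
  rw [h0, lintegral_eq_zero_iff hm] at hI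
  filter_upwards [hI] with ω hω
  by_contra hn
  simp [hn] at hω

end Indep

/-! ### Averages over the constellation -/

lemma qam_scale_pos {K : ℕ} (hK : 2 ≤ K) : 0 < √(3 / (2 * ((K : ℝ) ^ 2 - 1))) := by
  have : (2 : ℝ) ≤ K := by exact_mod_cast hK
  exact Real.sqrt_pos.2 (div_pos (by norm_num) (by nlinarith))

lemma qam_re (K : ℕ) (p : Fin K × Fin K) :
    (qam K p).re = √(3 / (2 * ((K : ℝ) ^ 2 - 1))) * (2 * (p.1 : ℝ) - (K - 1)) := by
  rw [qam, Complex.re_ofReal_mul]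

lemma qam_im (K : ℕ) (p : Fin K × Fin K) :
    (qam K p).im = √(3 / (2 * ((K : ℝ) ^ 2 - 1))) * (2 * (p.2 : ℝ) - (K - 1)) := by
  rw [qam, Complex.im_ofReal_mul]

lemma qam_injective {K : ℕ} (hK : 2 ≤ K) : Function.Injective (qam K) := by
  intro p q hpq
  have hs := (qam_scale_pos hK).ne'
  have hre := congrArg Complex.re hpq
  have him := congrArg Complex.im hpq
  rw [qam_re, qam_re, mul_right_inj' hs] at hre
  rw [qam_im, qam_im, mul_right_inj' hs] at him
  ext
  · exact_mod_cast (by linarith : (p.1 : ℝ) = q.1)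
  · exact_mod_cast (by linarith : (p.2 : ℝ) = q.2)

lemma lintegral_uniformOn_qam {K : ℕ} (hK : 2 ≤ K) (f : ℂ → ℝ≥0∞) :
    ∫⁻ z, f z ∂(uniformOn (range (qam K))) =
      ∑ m, ENNReal.ofReal (1 / ((K ^ 2 : ℕ) : ℝ)) * f (qam K m) := by
  have hr : range (qam K) = ((Finset.univ.map ⟨qam K, qam_injective hK⟩ : Finset ℂ) : Set ℂ) := by
    simp
  have hK0 : (0 : ℝ) < ((K ^ 2 : ℕ) : ℝ) := by positivity
  rw [hr, uniformOn, ProbabilityTheory.cond, lintegral_smul_measure, lintegral_finset,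
    Measure.count_apply_finset, Finset.card_map, Finset.sum_map, ← Finset.mul_sum, smul_eq_mul]
  simp only [Measure.count_singleton, mul_one, Function.Embedding.coeFn_mk]
  congr 1
  rw [one_div, ENNReal.ofReal_inv_of_pos hK0, ENNReal.ofReal_natCast]
  simp [sq]

/-! ### The power of the interference -/

/-- A measurable `-log` on `[0, 1]`, infinite at `0`. It rewrites a product over Poisson points as
`expNeg` of a sum, so the symbols can be averaged out without treating them as marks of the point
process. -/
lemma exists_measurable_expNeg_eq :
    ∃ g : ℝ≥0∞ → ℝ≥0∞, Measurable g ∧ ∀ u ≤ 1, expNeg (g u) = u := by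
  refine ⟨fun u => (-(ENNReal.log u)).toENNReal,
    measurable_ereal_toENNReal.comp (measurable_neg.comp ENNReal.measurable_log), fun u hu => ?_⟩
  have h : ENNReal.log u ≤ 0 := by simpa using ENNReal.log_monotone hu
  rw [expNeg, EReal.coe_toENNReal (by simpa using EReal.neg_le_neg_iff.2 h), neg_neg,
    ENNReal.exp_log]

/-- The alternating series hides the sign; the integral representation shows it, its integrand being
nonnegative. -/
lemma one_le_hyp1F1 {η : ℝ} (hη : 2 < η) {r₀ : ℝ} (hr₀ : 0 < r₀) {c : ℝ} (hc : 0 ≤ c) :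
    1 ≤ hyp1F1 (-2 / η) (1 - 2 / η) (-(c * r₀ ^ (-η))) := by
  have h := integral_Ioi_mul_one_sub_exp hη hr₀ c
  have h0 : 0 ≤ ∫ y in Ioi r₀, y * (1 - rexp (-(c * y ^ (-η)))) := by
    refine setIntegral_nonneg measurableSet_Ioi fun y hy => ?_
    have hy0 : 0 < y := hr₀.trans hy
    have : rexp (-(c * y ^ (-η))) ≤ 1 := exp_le_one_iff.2 (by
      have := mul_nonneg hc (rpow_nonneg hy0.le (-η))
      linarith)
    exact mul_nonneg hy0.le (by linarith)
  rw [h] at h0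
  have h2 : 0 < r₀ ^ 2 / 2 := by positivity
  have := nonneg_of_mul_nonneg_right h0 h2
  linarith

/-- The conditional variance `P ∑ₖ |s_k|² r_k^{-η}` of the interference. -/
def interferencePower {Ω : Type*} (P η : ℝ) (x : ℕ → Ω → EuclideanSpace ℝ (Fin 2))
    (s : ℕ → Ω → ℂ) (ω : Ω) : ℝ≥0∞ :=
  ∑' k, ENNReal.ofReal (P * ‖s (k + 1) ω‖ ^ 2 * ‖x k ω‖ ^ (-η))

/-- The Laplace exponent of the conditional variance of the interference. -/
def laplaceExponent (K : ℕ) (P η r₀ lam t : ℝ) : ℝ :=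
  π * lam * r₀ ^ 2 * (1 / ((K ^ 2 : ℕ) : ℝ) * ∑ m : Fin K × Fin K,
    hyp1F1 (-2 / η) (1 - 2 / η) (-(t * P * ‖qam K m‖ ^ 2 * r₀ ^ (-η))) - 1)

lemma one_sub_lintegral_expNeg_qam {K : ℕ} (hK : 2 ≤ K) {b : ℝ} (hb : 0 ≤ b) :
    1 - ∫⁻ z, expNeg (ENNReal.ofReal (b * ‖z‖ ^ 2)) ∂(uniformOn (range (qam K))) =
      ∑ m, ENNReal.ofReal (1 / ((K ^ 2 : ℕ) : ℝ)) *
        ENNReal.ofReal (1 - rexp (-(b * ‖qam K m‖ ^ 2))) := by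
  have hK0 : (0 : ℝ) < ((K ^ 2 : ℕ) : ℝ) := by positivity
  have hb' : ∀ m : Fin K × Fin K, 0 ≤ b * ‖qam K m‖ ^ 2 := fun m => by positivity
  rw [lintegral_uniformOn_qam hK]
  simp only [expNeg_ofReal (hb' _), ← ENNReal.ofReal_mul (one_div_pos.2 hK0).le]
  rw [← ENNReal.ofReal_sum_of_nonneg fun m _ => by positivity,
    ← ENNReal.ofReal_sum_of_nonneg fun m _ => ?_, ← ENNReal.ofReal_one, ← ENNReal.ofReal_sub]
  · congr 1
    simp only [mul_sub, Finset.sum_sub_distrib, mul_one, Finset.sum_const, Finset.card_univ,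
      Fintype.card_prod, Fintype.card_fin, nsmul_eq_mul]
    congr 1
    push_cast
    have : (K : ℝ) ≠ 0 := by positivity
    field_simp
  · positivity
  · have := exp_le_one_iff.2 (neg_nonpos.2 (hb' m))
    exact mul_nonneg (one_div_pos.2 hK0).le (by linarith)

/-- `ENNReal.ofReal lam` unfolds to the coercion of `lam.toNNReal`, so the scalar is finite. -/
instance sigmaFinite_interferers (lam r₀ : ℝ) : SigmaFinite (ENNReal.ofReal lam •
    (volume : Measure (EuclideanSpace ℝ (Fin 2))).restrict {p | r₀ < ‖p‖}) :=
  inferInstanceAs (SigmaFinite (lam.toNNReal •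
    (volume : Measure (EuclideanSpace ℝ (Fin 2))).restrict {p | r₀ < ‖p‖}))

/-- The exponent in the Laplace functional: `1 - φ` is the constellation average of `1 - e^{-t P
|s|² ‖p‖^{-η}}`, and each term is a known radial integral. -/
lemma lintegral_one_sub_expNeg_intensity {K : ℕ} (hK : 2 ≤ K) {P η r₀ lam t : ℝ} (hP : 0 < P)
    (hη : 2 < η) (hr₀ : 0 < r₀) (hlam : 0 < lam) (ht : 0 ≤ t) :
    ∫⁻ p, (1 - ∫⁻ z, expNeg (ENNReal.ofReal (t * P * ‖p‖ ^ (-η) * ‖z‖ ^ 2))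
        ∂(uniformOn (range (qam K)))) ∂(ENNReal.ofReal lam •
        (volume : Measure (EuclideanSpace ℝ (Fin 2))).restrict {p | r₀ < ‖p‖}) =
      ENNReal.ofReal (laplaceExponent K P η r₀ lam t) := by
  have hK0 : (0 : ℝ) < ((K ^ 2 : ℕ) : ℝ) := by positivity
  have h1 : ∀ p : EuclideanSpace ℝ (Fin 2),
      1 - ∫⁻ z, expNeg (ENNReal.ofReal (t * P * ‖p‖ ^ (-η) * ‖z‖ ^ 2)) ∂(uniformOn (range (qam K)))
      = ∑ m, ENNReal.ofReal (1 / ((K ^ 2 : ℕ) : ℝ)) *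
        ENNReal.ofReal (1 - rexp (-(t * P * ‖qam K m‖ ^ 2 * ‖p‖ ^ (-η)))) := fun p => by
    rw [one_sub_lintegral_expNeg_qam hK (by positivity)]
    refine Finset.sum_congr rfl fun m _ => ?_
    congr 5
    ring
  have hm : ∀ m : Fin K × Fin K, Measurable fun p : EuclideanSpace ℝ (Fin 2) =>
      ENNReal.ofReal (1 - rexp (-(t * P * ‖qam K m‖ ^ 2 * ‖p‖ ^ (-η)))) := fun m => by fun_prop
  have hnn : ∀ m : Fin K × Fin K, 0 ≤
      hyp1F1 (-2 / η) (1 - 2 / η) (-(t * P * ‖qam K m‖ ^ 2 * r₀ ^ (-η))) - 1 := fun m =>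
    sub_nonneg.2 (one_le_hyp1F1 hη hr₀ (by positivity))
  simp only [h1]
  rw [lintegral_smul_measure, lintegral_finsetSum _ fun m _ => (hm m).const_mul _]
  simp only [lintegral_const_mul _ (hm _)]
  have h2 : ∀ m : Fin K × Fin K, ∫⁻ p in {p : EuclideanSpace ℝ (Fin 2) | r₀ < ‖p‖},
      ENNReal.ofReal (1 - rexp (-(t * P * ‖qam K m‖ ^ 2 * ‖p‖ ^ (-η)))) = _ := fun m =>
    lintegral_one_sub_exp_norm_rpow hη hr₀ (by positivity)
  simp only [h2, ← ENNReal.ofReal_mul (one_div_pos.2 hK0).le]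
  rw [← ENNReal.ofReal_sum_of_nonneg fun m _ => ?_, smul_eq_mul, ← ENNReal.ofReal_mul hlam.le]
  · congr 1
    rw [laplaceExponent, ← Finset.mul_sum, ← Finset.mul_sum, Finset.sum_sub_distrib]
    simp only [Finset.sum_const, Finset.card_univ, Fintype.card_prod, Fintype.card_fin,
      nsmul_eq_mul]
    generalize Finset.sum Finset.univ (fun m : Fin K × Fin K =>
      hyp1F1 (-2 / η) (1 - 2 / η) (-(t * P * ‖qam K m‖ ^ 2 * r₀ ^ (-η)))) = S
    push_cast
    have : (K : ℝ) ≠ 0 := by positivity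
    field_simp
  · have := hnn m
    positivity

namespace IsDownlink

variable {Ω : Type*} [MeasurableSpace Ω] {μ : Measure Ω} {lam r₀ P η : ℝ}
  {N₀ : ℝ≥0} {K : ℕ} {x : ℕ → Ω → EuclideanSpace ℝ (Fin 2)} {s h : ℕ → Ω → ℂ} {n : Ω → ℂ}

lemma measurable_interferencePower (H : IsDownlink μ lam r₀ N₀ K x s h n) :
    Measurable (interferencePower P η x s) := by
  have := H.poisson.measurable
  have := H.measurable_s
  exact Measurable.tsum fun k => by fun_prop

lemma ae_symbol_mem (H : IsDownlink μ lam r₀ N₀ K x s h n) (k : ℕ) :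
    ∀ᵐ ω ∂μ, s k ω ∈ range (qam K) := by
  have hm : MeasurableSet (range (qam K)) := (finite_range _).measurableSet
  rw [(H.law_s k).ae_iff (p := fun z => z ∈ range (qam K)) hm.mem]
  exact ae_cond_mem hm

variable [IsProbabilityMeasure μ]

/-- For frozen coefficients, independence factorizes the finite products, and dominated convergence
with bound `1` passes to the infinite one. The function `g` puts the result back into exponential
form. -/
lemma lintegral_expNeg_tsum_symbols (H : IsDownlink μ lam r₀ N₀ K x s h n)
    {g : ℝ≥0∞ → ℝ≥0∞} (hg : ∀ u ≤ 1, expNeg (g u) = u) (hK : 2 ≤ K) (b : ℕ → ℝ) :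
    ∫⁻ ω, expNeg (∑' k, ENNReal.ofReal (b k * ‖s (k + 1) ω‖ ^ 2)) ∂μ =
      expNeg (∑' k, g (∫⁻ z, expNeg (ENNReal.ofReal (b k * ‖z‖ ^ 2))
        ∂(uniformOn (range (qam K))))) := by
  have := isProbabilityMeasure_uniformOn (finite_range (qam K))
    ⟨_, mem_range_self (⟨0, by omega⟩, ⟨0, by omega⟩)⟩
  have hmf : ∀ k, Measurable fun z : ℂ => expNeg (ENNReal.ofReal (b k * ‖z‖ ^ 2)) := fun k =>
    measurable_expNeg.comp (by fun_prop)
  have hms : ∀ k, Measurable fun ω => expNeg (ENNReal.ofReal (b k * ‖s (k + 1) ω‖ ^ 2)) :=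
    fun k => (hmf k).comp (H.measurable_s (k + 1))
  have hφ : ∀ k, ∫⁻ z, expNeg (ENNReal.ofReal (b k * ‖z‖ ^ 2)) ∂(uniformOn (range (qam K))) ≤ 1 :=
    fun k => (lintegral_mono fun z => expNeg_le_one _).trans (by simp)
  have hind : iIndepFun (fun k ω => expNeg (ENNReal.ofReal (b k * ‖s (k + 1) ω‖ ^ 2))) μ :=
    (H.iIndep_s.precomp (g := fun k => k + 1) (add_left_injective 1)).comp
      (fun k z => expNeg (ENNReal.ofReal (b k * ‖z‖ ^ 2))) hmf
  have hL : Tendsto (fun N => ∫⁻ ω, ∏ k ∈ Finset.range N,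
      expNeg (ENNReal.ofReal (b k * ‖s (k + 1) ω‖ ^ 2)) ∂μ) atTop
      (𝓝 (∫⁻ ω, expNeg (∑' k, ENNReal.ofReal (b k * ‖s (k + 1) ω‖ ^ 2)) ∂μ)) := by
    refine tendsto_lintegral_of_dominated_convergence (fun _ => 1)
      (fun N => Finset.measurable_fun_prod _ fun k _ => hms k)
      (fun N => ae_of_all _ fun ω => Finset.prod_le_one' fun k _ => expNeg_le_one _) (by simp)
      (ae_of_all _ fun ω => tendsto_expNeg_sum _)
  have hR := tendsto_expNeg_sum fun k => g (∫⁻ z, expNeg (ENNReal.ofReal (b k * ‖z‖ ^ 2))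
        ∂(uniformOn (range (qam K))))
  refine tendsto_nhds_unique hL (hR.congr fun N => ?_)
  rw [lintegral_prod_eq_prod_lintegral_of_indepFun _ _ hind hms]
  refine Finset.prod_congr rfl fun k _ => ?_
  rw [hg _ (hφ k), (H.law_s (k + 1)).lintegral_comp (hmf k).aemeasurable]

/-- The Laplace transform of the conditional variance of the interference. -/
theorem lintegral_expNeg_interferencePower (H : IsDownlink μ lam r₀ N₀ K x s h n) (hK : 2 ≤ K)
    (hP : 0 < P) (hη : 2 < η) (hr₀ : 0 < r₀) (hlam : 0 < lam) {t : ℝ} (ht : 0 ≤ t) :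
    ∫⁻ ω, expNeg (ENNReal.ofReal t * interferencePower P η x s ω) ∂μ =
      expNeg (ENNReal.ofReal (laplaceExponent K P η r₀ lam t)) := by
  obtain ⟨g, hgm, hg⟩ := exists_measurable_expNeg_eq
  have := isProbabilityMeasure_uniformOn (finite_range (qam K))
    ⟨_, mem_range_self (⟨0, by omega⟩, ⟨0, by omega⟩)⟩
  set F : (ℕ → EuclideanSpace ℝ (Fin 2)) × (ℕ → ℂ) → ℝ≥0∞ := fun p =>
    expNeg (∑' k, ENNReal.ofReal (t * P * ‖p.1 k‖ ^ (-η) * ‖p.2 (k + 1)‖ ^ 2)) with hF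
  have hFm : Measurable F := measurable_expNeg.comp (Measurable.tsum fun k => by fun_prop)
  have h1 : ∀ ω, expNeg (ENNReal.ofReal t * interferencePower P η x s ω) =
      F (fun k => x k ω, fun k => s k ω) := by
    intro ω
    rw [interferencePower, ← ENNReal.tsum_mul_left]
    simp only [← ENNReal.ofReal_mul ht, hF]
    congr 2
    ext k
    congr 1
    ring
  simp only [h1]
  rw [lintegral_prodMk_of_indepFun (measurable_pi_lambda _ H.poisson.measurable)
    (measurable_pi_lambda _ H.measurable_s) (H.indep_x.comp measurable_id measurable_fst) hFm]
  simp only [hF, H.lintegral_expNeg_tsum_symbols hg hK]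
  have hφm : Measurable fun p : EuclideanSpace ℝ (Fin 2) =>
      ∫⁻ z, expNeg (ENNReal.ofReal (t * P * ‖p‖ ^ (-η) * ‖z‖ ^ 2)) ∂(uniformOn (range (qam K))) :=
    Measurable.lintegral_prod_right' (f := fun q : EuclideanSpace ℝ (Fin 2) × ℂ =>
      expNeg (ENNReal.ofReal (t * P * ‖q.1‖ ^ (-η) * ‖q.2‖ ^ 2)))
      (measurable_expNeg.comp (by fun_prop))
  -- The averaged symbol is now a deterministic function of the location, so the Laplace functional
  -- applies; inside its exponent `expNeg (g φ)` collapses to `φ`.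
  rw [H.poisson.laplace (f := fun p => g (∫⁻ z, expNeg (ENNReal.ofReal
    (t * P * ‖p‖ ^ (-η) * ‖z‖ ^ 2)) ∂(uniformOn (range (qam K))))) (hgm.comp hφm)]
  have hφ : ∀ p : EuclideanSpace ℝ (Fin 2), ∫⁻ z, expNeg (ENNReal.ofReal
      (t * P * ‖p‖ ^ (-η) * ‖z‖ ^ 2)) ∂(uniformOn (range (qam K))) ≤ 1 :=
    fun p => (lintegral_mono fun z => expNeg_le_one _).trans (by simp)
  simp only [hg _ (hφ _)]
  rw [lintegral_one_sub_expNeg_intensity hK hP hη hr₀ hlam ht]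

/-- The conditional variance of the interference is almost surely finite. -/
theorem ae_interferencePower_lt_top (H : IsDownlink μ lam r₀ N₀ K x s h n) (hP : 0 < P)
    (hη : 2 < η) (hr₀ : 0 < r₀) : ∀ᵐ ω ∂μ, interferencePower P η x s ω < ∞ := by
  have hfin : ∫⁻ p, ENNReal.ofReal (‖p‖ ^ (-η)) ∂(ENNReal.ofReal lam •
      (volume : Measure (EuclideanSpace ℝ (Fin 2))).restrict {p | r₀ < ‖p‖}) ≠ ∞ := by
    rw [lintegral_smul_measure]
    exact ENNReal.mul_ne_top ENNReal.ofReal_ne_top (lintegral_norm_rpow_lt_top hη hr₀).ne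
  have hC : ∀ m, ‖qam K m‖ ^ 2 ≤ ∑ m, ‖qam K m‖ ^ 2 := fun m =>
    Finset.single_le_sum (f := fun m => ‖qam K m‖ ^ 2) (fun i _ => by positivity)
      (Finset.mem_univ m)
  filter_upwards [H.poisson.ae_tsum_lt_top (f := fun p => ENNReal.ofReal (‖p‖ ^ (-η)))
    (by fun_prop) hfin, ae_all_iff.2 H.ae_symbol_mem] with ω hω hs
  calc interferencePower P η x s ω
      ≤ ∑' k, ENNReal.ofReal (P * ∑ m, ‖qam K m‖ ^ 2) * ENNReal.ofReal (‖x k ω‖ ^ (-η)) := by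
        refine ENNReal.tsum_le_tsum fun k => ?_
        obtain ⟨m, hm⟩ := hs (k + 1)
        rw [← ENNReal.ofReal_mul (by positivity), ← hm]
        refine ENNReal.ofReal_le_ofReal ?_
        have := hC m
        gcongr
    _ < ∞ := by
        rw [ENNReal.tsum_mul_left]
        exact ENNReal.mul_lt_top ENNReal.ofReal_lt_top hω

end IsDownlink

/-! ### The law of the interference -/

lemma measurable_partialInterference {Ω : Type*} [MeasurableSpace Ω] (P η : ℝ)
    {x : ℕ → Ω → EuclideanSpace ℝ (Fin 2)} {s h : ℕ → Ω → ℂ} (hx : ∀ k, Measurable (x k))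
    (hs : ∀ k, Measurable (s k)) (hh : ∀ k, Measurable (h k)) (N : ℕ) :
    Measurable fun ω => partialInterference P η x s h N ω := by
  unfold partialInterference
  fun_prop

lemma measurable_interference {Ω : Type*} [MeasurableSpace Ω] (P η : ℝ)
    {x : ℕ → Ω → EuclideanSpace ℝ (Fin 2)} {s h : ℕ → Ω → ℂ} (hx : ∀ k, Measurable (x k))
    (hs : ∀ k, Measurable (s k)) (hh : ∀ k, Measurable (h k)) :
    Measurable (interference P η x s h) :=
  (StronglyMeasurable.limUnder fun N =>
    (measurable_partialInterference P η hx hs hh N).stronglyMeasurable).measurable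

lemma norm_interference_coeff_sq {P : ℝ} (hP : 0 ≤ P) (η : ℝ) (a : ℂ) {r : ℝ} (hr : 0 ≤ r) :
    ‖(√P : ℂ) * a * ((r ^ (-η / 2) : ℝ) : ℂ)‖ ^ 2 = P * ‖a‖ ^ 2 * r ^ (-η) := by
  rw [norm_mul, norm_mul, Complex.norm_real, Complex.norm_real, mul_pow, mul_pow,
    Real.norm_of_nonneg (Real.sqrt_nonneg P), Real.sq_sqrt hP,
    Real.norm_of_nonneg (rpow_nonneg hr _), ← rpow_natCast (r ^ (-η / 2)), ← rpow_mul hr]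
  congr 2
  push_cast
  ring

lemma partialInterference_eq_sum {Ω : Type*} (P η : ℝ) (x : ℕ → Ω → EuclideanSpace ℝ (Fin 2))
    (s h : ℕ → Ω → ℂ) (N : ℕ) (ω : Ω) :
    partialInterference P η x s h N ω = ∑ k ∈ Finset.range N,
      (√P : ℂ) * s (k + 1) ω * ((‖x k ω‖ ^ (-η / 2) : ℝ) : ℂ) * h (k + 1) ω :=
  Finset.sum_congr rfl fun k _ => by ring

lemma hasSum_interferencePower {Ω : Type*} {P η : ℝ} {x : ℕ → Ω → EuclideanSpace ℝ (Fin 2)}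
    {s : ℕ → Ω → ℂ} {ω : Ω} (hP : 0 ≤ P) (hV : interferencePower P η x s ω < ∞) :
    HasSum (fun k => P * ‖s (k + 1) ω‖ ^ 2 * ‖x k ω‖ ^ (-η))
      (interferencePower P η x s ω).toReal := by
  have h := ENNReal.hasSum_toReal hV.ne
  simp only [ENNReal.toReal_ofReal (show 0 ≤ P * ‖s (_ + 1) ω‖ ^ 2 * ‖x _ ω‖ ^ (-η) by
    positivity)] at h
  rw [interferencePower, ENNReal.tsum_toReal_eq fun k => ENNReal.ofReal_ne_top]
  simpa only [ENNReal.toReal_ofReal (show 0 ≤ P * ‖s (_ + 1) ω‖ ^ 2 * ‖x _ ω‖ ^ (-η) by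
    positivity)] using h

lemma laplaceExponent_nonneg {K : ℕ} (hK : 2 ≤ K) {P η r₀ lam t : ℝ} (hP : 0 < P)
    (hη : 2 < η) (hr₀ : 0 < r₀) (hlam : 0 < lam) (ht : 0 ≤ t) :
    0 ≤ laplaceExponent K P η r₀ lam t := by
  have hK0 : (0 : ℝ) < ((K ^ 2 : ℕ) : ℝ) := by positivity
  have h1 : ((K ^ 2 : ℕ) : ℝ) ≤ ∑ m : Fin K × Fin K,
      hyp1F1 (-2 / η) (1 - 2 / η) (-(t * P * ‖qam K m‖ ^ 2 * r₀ ^ (-η))) := by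
    have := Finset.card_nsmul_le_sum Finset.univ (fun m : Fin K × Fin K =>
      hyp1F1 (-2 / η) (1 - 2 / η) (-(t * P * ‖qam K m‖ ^ 2 * r₀ ^ (-η)))) 1
      fun m _ => one_le_hyp1F1 hη hr₀ (by positivity)
    simpa [sq] using this
  have h2 : 0 ≤ 1 / ((K ^ 2 : ℕ) : ℝ) * ∑ m : Fin K × Fin K,
      hyp1F1 (-2 / η) (1 - 2 / η) (-(t * P * ‖qam K m‖ ^ 2 * r₀ ^ (-η))) - 1 := by
    rw [sub_nonneg, one_div, inv_mul_eq_div, one_le_div hK0]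
    exact h1
  unfold laplaceExponent
  positivity

lemma charFun_map_sum_mul_complexGaussian {Ω : Type*} [MeasurableSpace Ω] {μ : Measure Ω}
    {h : ℕ → Ω → ℂ} (hm : ∀ k, Measurable (h k)) (hind : iIndepFun h μ)
    (hlaw : ∀ k, μ.map (h k) = complexGaussian 1) (a : ℕ → ℂ) (N : ℕ) (ξ : ℂ) :
    ∫ ω, Complex.exp ((inner ℝ (∑ k ∈ Finset.range N, a k * h k ω) ξ : ℝ) * Complex.I) ∂μ =
      (rexp (-((∑ k ∈ Finset.range N, ‖a k‖ ^ 2) * ‖ξ‖ ^ 2 / 4)) : ℂ) := by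
  have hmk : ∀ k, Measurable fun ω => a k * h k ω := fun k => (hm k).const_mul _
  have hindk : iIndepFun (fun k ω => a k * h k ω) μ :=
    hind.comp (fun k z => a k * z) fun k => measurable_const_mul _
  have h1 := (hindk.restrict (Finset.range N)).charFun_map_fun_finsetSum_eq_prod
    fun k _ => (hmk k).aemeasurable
  have h2 := congrFun h1 ξ
  rw [charFun_apply, integral_map
    (Finset.measurable_fun_sum _ fun k _ => hmk k).aemeasurable
    (Continuous.aestronglyMeasurable (by fun_prop))] at h2
  refine h2.trans ?_
  rw [Finset.prod_apply]
  have h3 : ∀ k, charFun (μ.map fun ω => a k * h k ω) ξ =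
      Complex.exp ((-(‖a k‖ ^ 2 * ‖ξ‖ ^ 2 / 4) : ℝ) : ℂ) := by
    intro k
    rw [map_mul_of_map_eq_complexGaussian (hm k) (hlaw k), charFun_complexGaussian, Complex.ofReal_exp]
    simp
  simp only [h3]
  rw [← Complex.exp_sum, Complex.ofReal_exp, ← Complex.ofReal_sum]
  congr 2
  rw [Finset.sum_neg_distrib, Finset.sum_mul, Finset.sum_div]

namespace IsDownlink

variable {Ω : Type*} [MeasurableSpace Ω] {μ : Measure Ω} {lam r₀ P η : ℝ}
  {N₀ : ℝ≥0} {K : ℕ} {x : ℕ → Ω → EuclideanSpace ℝ (Fin 2)} {s h : ℕ → Ω → ℂ} {n : Ω → ℂ}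

lemma measurable_interference (H : IsDownlink μ lam r₀ N₀ K x s h n) :
    Measurable (interference P η x s h) :=
  CellularASEP.measurable_interference P η H.poisson.measurable H.measurable_s H.measurable_h

lemma measurable_partialInterference (H : IsDownlink μ lam r₀ N₀ K x s h n) (N : ℕ) :
    Measurable fun ω => partialInterference P η x s h N ω :=
  CellularASEP.measurable_partialInterference P η H.poisson.measurable H.measurable_s
    H.measurable_h N

lemma measurable_xs (H : IsDownlink μ lam r₀ N₀ K x s h n) :
    Measurable fun ω => ((fun k => x k ω), (fun k => s k ω)) :=
  (measurable_pi_lambda _ H.poisson.measurable).prodMk (measurable_pi_lambda _ H.measurable_s)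

variable [IsProbabilityMeasure μ]

/-- The interference converges almost surely. -/
theorem ae_exists_tendsto_partialInterference (H : IsDownlink μ lam r₀ N₀ K x s h n) (hP : 0 < P)
    (hη : 2 < η) (hr₀ : 0 < r₀) :
    ∀ᵐ ω ∂μ, ∃ i : ℂ,
      Tendsto (fun N => partialInterference P η x s h N ω) atTop (𝓝 i) := by
  -- Convergence is an event in the sequence space of locations, symbols and channels, described by
  -- `partialInterference` of the coordinate maps. It is enough to have it for almost every channel
  -- sequence once locations and symbols of finite power are frozen.
  refine ae_prodMk_of_indepFun (A := fun ω => ((fun k => x k ω), (fun k => s k ω)))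
    (B := fun ω k => h k ω) H.measurable_xs (measurable_pi_lambda _ H.measurable_h)
    H.indep_h_xs.symm (S := {q | ∃ i : ℂ, Tendsto (fun N => partialInterference P η
      (fun k (q : ((ℕ → EuclideanSpace ℝ (Fin 2)) × (ℕ → ℂ)) × (ℕ → ℂ)) => q.1.1 k)
      (fun k q => q.1.2 k) (fun k q => q.2 k) N q) atTop (𝓝 i)}) ?_ ?_
  · exact measurableSet_exists_tendsto fun N => CellularASEP.measurable_partialInterference P η
      (fun k => by fun_prop) (fun k => by fun_prop) (fun k => by fun_prop) N
  · filter_upwards [H.ae_interferencePower_lt_top hP hη hr₀] with ω hω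
    have ha : Summable fun k =>
        ‖(√P : ℂ) * s (k + 1) ω * ((‖x k ω‖ ^ (-η / 2) : ℝ) : ℂ)‖ ^ 2 := by
      simp only [norm_interference_coeff_sq hP.le η _ (norm_nonneg _)]
      exact (hasSum_interferencePower hP.le hω).summable
    filter_upwards [ae_exists_tendsto_sum_complexGaussian (fun k => H.measurable_h (k + 1))
      (H.iIndep_h.precomp (g := fun k => k + 1) (add_left_injective 1))
      (fun k => (H.law_h (k + 1)).map_eq) ha] with ω' ⟨c, hc⟩
    simp only [partialInterference_eq_sum]
    exact ⟨c, hc⟩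

lemma ae_tendsto_interference (H : IsDownlink μ lam r₀ N₀ K x s h n) (hP : 0 < P)
    (hη : 2 < η) (hr₀ : 0 < r₀) :
    ∀ᵐ ω ∂μ, Tendsto (fun N => partialInterference P η x s h N ω) atTop
      (𝓝 (interference P η x s h ω)) := by
  filter_upwards [H.ae_exists_tendsto_partialInterference hP hη hr₀] with ω hω
  exact tendsto_nhds_limUnder hω

/-- With finitely many interferers the conditional variances simply add. The limit `N → ∞` is taken
afterwards under the integral, all integrands being bounded by `1`. -/
lemma integral_exp_partialInterference (H : IsDownlink μ lam r₀ N₀ K x s h n) (hP : 0 < P)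
    (ξ : ℂ) (N : ℕ) :
    ∫ ω, Complex.exp ((inner ℝ (partialInterference P η x s h N ω) ξ : ℝ) * Complex.I) ∂μ =
      ∫ ω, ((rexp (-((∑ k ∈ Finset.range N, P * ‖s (k + 1) ω‖ ^ 2 * ‖x k ω‖ ^ (-η)) *
        ‖ξ‖ ^ 2 / 4)) : ℝ) : ℂ) ∂μ := by
  set F : ((ℕ → EuclideanSpace ℝ (Fin 2)) × (ℕ → ℂ)) × (ℕ → ℂ) → ℂ := fun q =>
    Complex.exp ((inner ℝ (partialInterference P η
      (fun k (q : ((ℕ → EuclideanSpace ℝ (Fin 2)) × (ℕ → ℂ)) × (ℕ → ℂ)) => q.1.1 k)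
      (fun k q => q.1.2 k) (fun k q => q.2 k) N q) ξ : ℝ) * Complex.I) with hF
  have hFm : Measurable F := by
    have hc : Continuous fun z : ℂ => Complex.exp ((inner ℝ z ξ : ℝ) * Complex.I) := by fun_prop
    exact hc.measurable.comp (CellularASEP.measurable_partialInterference P η
      (fun k => by fun_prop) (fun k => by fun_prop) (fun k => by fun_prop) N)
  have h1 := integral_prodMk_of_indepFun H.measurable_xs (measurable_pi_lambda _ H.measurable_h)
    H.indep_h_xs.symm hFm.stronglyMeasurable (C := 1)
    (fun q => (Complex.norm_exp_ofReal_mul_I _).le)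
  refine h1.trans (integral_congr_ae (ae_of_all _ fun ω => ?_))
  simp only [hF, partialInterference_eq_sum]
  rw [charFun_map_sum_mul_complexGaussian (fun k => H.measurable_h (k + 1))
    (H.iIndep_h.precomp (g := fun k => k + 1) (add_left_injective 1))
    (fun k => (H.law_h (k + 1)).map_eq)
    (fun k => (√P : ℂ) * s (k + 1) ω * ((‖x k ω‖ ^ (-η / 2) : ℝ) : ℂ))]
  simp only [norm_interference_coeff_sq hP.le η _ (norm_nonneg _)]

/-- Conditionally on the locations and symbols, the interference is complex Gaussian with variance
`interferencePower`. -/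
lemma charFun_interference_eq_integral (H : IsDownlink μ lam r₀ N₀ K x s h n) (hP : 0 < P)
    (hη : 2 < η) (hr₀ : 0 < r₀) (ξ : ℂ) :
    charFun (μ.map (interference P η x s h)) ξ =
      ((∫ ω, rexp (-((interferencePower P η x s ω).toReal * ‖ξ‖ ^ 2 / 4)) ∂μ : ℝ) : ℂ) := by
  have hc : Continuous fun z : ℂ => Complex.exp ((inner ℝ z ξ : ℝ) * Complex.I) := by fun_prop
  rw [charFun_apply, integral_map H.measurable_interference.aemeasurable hc.aestronglyMeasurable,
    ← integral_complex_ofReal]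
  have hx := H.poisson.measurable
  have hs := H.measurable_s
  have hL := tendsto_integral_of_dominated_convergence (μ := μ) (fun _ => (1 : ℝ))
    (F := fun N ω => Complex.exp
      ((inner ℝ (partialInterference P η x s h N ω) ξ : ℝ) * Complex.I))
    (fun N => (hc.measurable.comp (H.measurable_partialInterference N)).aestronglyMeasurable)
    (integrable_const _)
    (fun N => ae_of_all _ fun ω => (Complex.norm_exp_ofReal_mul_I _).le)
    ((H.ae_tendsto_interference hP hη hr₀).mono fun ω hω => (hc.tendsto _).comp hω)
  have hR := tendsto_integral_of_dominated_convergence (μ := μ) (fun _ => (1 : ℝ))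
    (F := fun N ω => ((rexp (-((∑ k ∈ Finset.range N, P * ‖s (k + 1) ω‖ ^ 2 * ‖x k ω‖ ^ (-η)) *
        ‖ξ‖ ^ 2 / 4)) : ℝ) : ℂ))
    (f := fun ω => ((rexp (-((interferencePower P η x s ω).toReal * ‖ξ‖ ^ 2 / 4)) : ℝ) : ℂ))
    (fun N => Measurable.aestronglyMeasurable (by fun_prop)) (integrable_const _)
    (fun N => ae_of_all _ fun ω => by
      rw [Complex.norm_real, Real.norm_of_nonneg (exp_pos _).le, exp_le_one_iff, neg_nonpos]
      have : 0 ≤ ∑ k ∈ Finset.range N, P * ‖s (k + 1) ω‖ ^ 2 * ‖x k ω‖ ^ (-η) :=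
        Finset.sum_nonneg fun k _ => by positivity
      positivity)
    ((H.ae_interferencePower_lt_top hP hη hr₀).mono fun ω hω => by
      have hcont : Continuous fun v : ℝ => ((rexp (-(v * ‖ξ‖ ^ 2 / 4)) : ℝ) : ℂ) := by fun_prop
      exact (hcont.tendsto _).comp (hasSum_interferencePower hP.le hω).tendsto_sum_nat)
  simp only [H.integral_exp_partialInterference hP] at hL
  exact tendsto_nhds_unique hL hR

lemma integral_exp_interferencePower (H : IsDownlink μ lam r₀ N₀ K x s h n) (hK : 2 ≤ K)
    (hP : 0 < P) (hη : 2 < η) (hr₀ : 0 < r₀) (hlam : 0 < lam) {t : ℝ} (ht : 0 ≤ t) :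
    ∫ ω, rexp (-(t * (interferencePower P η x s ω).toReal)) ∂μ =
      rexp (-laplaceExponent K P η r₀ lam t) := by
  have h1 := H.lintegral_expNeg_interferencePower (P := P) (η := η) hK hP hη hr₀ hlam ht
  rw [expNeg_ofReal (laplaceExponent_nonneg hK hP hη hr₀ hlam ht)] at h1
  have h2 : ∫⁻ ω, expNeg (ENNReal.ofReal t * interferencePower P η x s ω) ∂μ =
      ∫⁻ ω, ENNReal.ofReal (rexp (-(t * (interferencePower P η x s ω).toReal))) ∂μ := by
    refine lintegral_congr_ae ((H.ae_interferencePower_lt_top hP hη hr₀).mono fun ω hω => ?_)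
    simp only []
    rw [← expNeg_ofReal (by positivity), ENNReal.ofReal_mul ht, ENNReal.ofReal_toReal hω.ne]
  have hV : Measurable (interferencePower P η x s) := H.measurable_interferencePower
  rw [integral_eq_lintegral_of_nonneg_ae (ae_of_all _ fun ω => (exp_pos _).le)
    (Measurable.aestronglyMeasurable (by fun_prop)), ← h2, h1,
    ENNReal.toReal_ofReal (exp_pos _).le]

/-- The characteristic function of the interference. -/
theorem charFun_interference (H : IsDownlink μ lam r₀ N₀ K x s h n) (hK : 2 ≤ K)
    (hP : 0 < P) (hη : 2 < η) (hr₀ : 0 < r₀) (hlam : 0 < lam) (ξ : ℂ) :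
    charFun (μ.map (interference P η x s h)) ξ =
      (rexp (-laplaceExponent K P η r₀ lam (‖ξ‖ ^ 2 / 4)) : ℂ) := by
  rw [H.charFun_interference_eq_integral hP hη hr₀,
    ← H.integral_exp_interferencePower hK hP hη hr₀ hlam (by positivity)]
  simp only [mul_div_assoc, mul_comm (‖ξ‖ ^ 2 / 4)]

/-- The interference has a conditionally Gaussian representation. -/
theorem exists_isEiDRepresentation (H : IsDownlink μ lam r₀ N₀ K x s h n) (hP : 0 < P)
    (hη : 2 < η) (hr₀ : 0 < r₀) :
    ∃ ν : Measure ℝ≥0, IsProbabilityMeasure ν ∧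
      IsEiDRepresentation μ (interference P η x s h) ν := by
  have hV : Measurable (interferencePower P η x s) := H.measurable_interferencePower
  have hm : Measurable fun ω => (interferencePower P η x s ω).toNNReal := hV.ennreal_toNNReal
  have hν := Measure.isProbabilityMeasure_map (μ := μ) hm.aemeasurable
  have hw : Measurable fun v : ℝ≥0 => ((√(v : ℝ) : ℝ) : ℂ) := by fun_prop
  have hp : Measurable fun p : ℝ≥0 × ℂ => ((√(p.1 : ℝ) : ℝ) : ℂ) * p.2 := by fun_prop
  -- The witness is the law of the conditional variance; `toNNReal` changes it only on the null
  -- event where it is infinite.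
  refine ⟨μ.map fun ω => (interferencePower P η x s ω).toNNReal, hν,
    H.measurable_interference.aemeasurable, ?_⟩
  have := Measure.isProbabilityMeasure_map (μ := μ)
    (H.measurable_interference (P := P) (η := η)).aemeasurable
  have := Measure.isProbabilityMeasure_map (μ := (μ.map fun ω =>
    (interferencePower P η x s ω).toNNReal).prod (complexGaussian 1)) hp.aemeasurable
  refine Measure.ext_of_charFun (funext fun ξ => ?_)
  rw [charFun_map_mul_complexGaussian_one _ hw, H.charFun_interference_eq_integral hP hη hr₀,
    integral_map hm.aemeasurable (Measurable.aestronglyMeasurable (by fun_prop))]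
  simp only [Complex.norm_real, Real.norm_of_nonneg (Real.sqrt_nonneg _),
    Real.sq_sqrt (NNReal.coe_nonneg _)]
  rfl

/-- The Laplace transform of the variance in a conditionally Gaussian representation of the
interference. -/
theorem integral_exp_of_isEiDRepresentation (H : IsDownlink μ lam r₀ N₀ K x s h n) (hK : 2 ≤ K)
    (hP : 0 < P) (hη : 2 < η) (hr₀ : 0 < r₀) (hlam : 0 < lam) {ν : Measure ℝ≥0}
    [IsProbabilityMeasure ν] (hν : IsEiDRepresentation μ (interference P η x s h) ν) {t : ℝ}
    (ht : 0 ≤ t) :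
    ∫ v : ℝ≥0, rexp (-(v * t)) ∂ν = rexp (-laplaceExponent K P η r₀ lam t) := by
  have hw : Measurable fun v : ℝ≥0 => ((√(v : ℝ) : ℝ) : ℂ) := by fun_prop
  -- With `‖ξ‖ = 2√t` the exponent `‖ξ‖² / 4` is `t`, so the law of the interference determines the
  -- Laplace transform of any representing variance at `t`.
  have h1 := H.charFun_interference hK hP hη hr₀ hlam ((2 * √t : ℝ) : ℂ)
  rw [hν.map_eq, charFun_map_mul_complexGaussian_one _ hw] at h1
  have h2 : ‖2 * √t‖ ^ 2 = 4 * t := by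
    rw [Real.norm_of_nonneg (by positivity), mul_pow, Real.sq_sqrt ht]
    norm_num
  have h3 : ∀ v : ℝ≥0, (v : ℝ) * (4 * t) / 4 = v * t := fun v => by ring
  have h4 : 4 * t / 4 = t := by ring
  simp only [h2, Complex.norm_real, Real.norm_of_nonneg (Real.sqrt_nonneg _),
    Real.sq_sqrt (NNReal.coe_nonneg _), h3, h4] at h1
  exact_mod_cast h1

end IsDownlink

/-! ### The complementary error function -/

lemma integrable_exp_neg_sq : Integrable fun t : ℝ => rexp (-t ^ 2) := by
  simpa using integrable_exp_neg_mul_sq (b := 1) one_pos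

lemma integral_Ioi_exp_neg_sq : ∫ t in Ioi (0 : ℝ), rexp (-t ^ 2) = √π / 2 := by
  simpa using integral_gaussian_Ioi 1

lemma erfc_eq_one_sub (y : ℝ) : erfc y = 1 - 2 / √π * ∫ t in (0 : ℝ)..y, rexp (-t ^ 2) := by
  have h := intervalIntegral.integral_interval_add_Ioi (a := 0) (b := y)
    integrable_exp_neg_sq.integrableOn integrable_exp_neg_sq.integrableOn
  rw [integral_Ioi_exp_neg_sq] at h
  have hπ : √π ≠ 0 := by positivity
  rw [erfc, ← sub_eq_of_eq_add' h.symm]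
  field_simp

lemma erfc_zero : erfc 0 = 1 := by simp [erfc_eq_one_sub]

lemma hasDerivAt_erfc (y : ℝ) : HasDerivAt erfc (-(2 / √π * rexp (-y ^ 2))) y := by
  have hc : Continuous fun t : ℝ => rexp (-t ^ 2) := by fun_prop
  have h := ((intervalIntegral.integral_hasDerivAt_right (hc.intervalIntegrable 0 y)
    (hc.stronglyMeasurableAtFilter _ _) hc.continuousAt).const_mul (2 / √π)).const_sub 1
  exact h.congr_of_eventuallyEq (Eventually.of_forall erfc_eq_one_sub)

lemma continuous_erfc : Continuous erfc :=
  continuous_iff_continuousAt.2 fun y => (hasDerivAt_erfc y).continuousAt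

lemma erfc_nonneg (y : ℝ) : 0 ≤ erfc y :=
  mul_nonneg (by positivity) (integral_nonneg fun t => (exp_pos _).le)

lemma erfc_le_one {y : ℝ} (hy : 0 ≤ y) : erfc y ≤ 1 := by
  rw [erfc_eq_one_sub]
  have : 0 ≤ ∫ t in (0 : ℝ)..y, rexp (-t ^ 2) :=
    intervalIntegral.integral_nonneg hy fun t _ => (exp_pos _).le
  have : 0 ≤ 2 / √π * ∫ t in (0 : ℝ)..y, rexp (-t ^ 2) := by positivity
  linarith

/-- Up to a constant, the derivative of `erfc (√z) ^ c` for `c = 1, 2`. -/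
def erfcKernel (c : ℕ) (z : ℝ) : ℝ := erfc (if c = 2 then √z else 0) / √z * rexp (-z)

lemma measurable_erfcKernel (c : ℕ) : Measurable (erfcKernel c) := by
  have h : Measurable fun z : ℝ => erfc (if c = 2 then √z else 0) := by
    split_ifs
    · exact (continuous_erfc.comp Real.continuous_sqrt).measurable
    · exact measurable_const
  exact (h.div (by fun_prop)).mul (by fun_prop)

lemma erfcKernel_nonneg (c : ℕ) (z : ℝ) : 0 ≤ erfcKernel c z :=
  mul_nonneg (div_nonneg (erfc_nonneg _) (Real.sqrt_nonneg _)) (exp_pos _).le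

/-- As `erfc ≤ 1` on `[0, ∞)`, the kernel is dominated by `z^{-1/2} e^{-z}`, the integrand of
`Γ(1/2)`. -/
lemma integrableOn_erfcKernel (c : ℕ) : IntegrableOn (erfcKernel c) (Ioi 0) := by
  refine Integrable.mono' (Real.GammaIntegral_convergent (s := 1 / 2) (by norm_num))
    (measurable_erfcKernel c).aestronglyMeasurable
    ((ae_restrict_iff' measurableSet_Ioi).2 (ae_of_all _ fun z hz => ?_))
  have hz0 : (0 : ℝ) < z := hz
  have h1 : erfc (if c = 2 then √z else 0) ≤ 1 := erfc_le_one (by split_ifs <;> positivity)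
  have h2 : z ^ ((1 : ℝ) / 2 - 1) = (√z)⁻¹ := by
    rw [Real.sqrt_eq_rpow, ← rpow_neg hz0.le]; norm_num
  rw [Real.norm_of_nonneg (erfcKernel_nonneg c z), erfcKernel, h2, mul_comm, div_eq_mul_inv]
  exact mul_le_mul_of_nonneg_left (mul_le_of_le_one_left (by positivity) h1) (exp_pos _).le

/-- The chain rule leaves `erfc(√z)^{c-1}`, which is `1 = erfc 0` for `c = 1` and `erfc √z` for `c =
2`. This is the origin of the argument `√z 1_{c=2}` in the closed form. -/
lemma hasDerivAt_erfc_sqrt_pow {c : ℕ} (hc : c ∈ Finset.Icc 1 2) {z : ℝ} (hz : 0 < z) :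
    HasDerivAt (fun z => erfc √z ^ c) (-(c / √π * erfcKernel c z)) z := by
  have h := ((hasDerivAt_erfc √z).comp z (Real.hasDerivAt_sqrt hz.ne')).pow c
  refine h.congr_deriv ?_
  have hsz : √z ≠ 0 := (Real.sqrt_pos.2 hz).ne'
  have hπ : √π ≠ 0 := by positivity
  have hpow : erfc √z ^ (c - 1) = erfc (if c = 2 then √z else 0) := by
    rw [Finset.mem_Icc] at hc
    obtain rfl | rfl : c = 1 ∨ c = 2 := by omega
    · simp [erfc_zero]
    · simp
  simp only [Function.comp_apply]
  rw [erfcKernel, ← hpow, Real.sq_sqrt hz.le]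
  field_simp

/-- The fundamental theorem of calculus from `0`, where `erfc` is `1`. The upper limit is written as
an indicator so that Fubini can turn it into a tail event. -/
lemma erfc_sqrt_pow {c : ℕ} (hc : c ∈ Finset.Icc 1 2) {u : ℝ} (hu : 0 ≤ u) :
    erfc √u ^ c = 1 - c / √π * ∫ z in Ioi (0 : ℝ), (Iic u).indicator (erfcKernel c) z := by
  have hint : IntervalIntegrable (fun z => -(c / √π * erfcKernel c z)) volume 0 u := by
    rw [intervalIntegrable_iff_integrableOn_Ioc_of_le hu]
    exact (((integrableOn_erfcKernel c).mono_set Ioc_subset_Ioi_self).const_mul _).neg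
  have h := intervalIntegral.integral_eq_sub_of_hasDerivAt_of_le hu
    (f := fun z => erfc √z ^ c)
    ((continuous_erfc.comp Real.continuous_sqrt).pow c).continuousOn
    (fun z hz => hasDerivAt_erfc_sqrt_pow hc hz.1) hint
  rw [setIntegral_indicator measurableSet_Iic, Ioi_inter_Iic, ← intervalIntegral.integral_of_le hu,
    ← intervalIntegral.integral_const_mul]
  rw [intervalIntegral.integral_neg, Real.sqrt_zero, erfc_zero, one_pow] at h
  linarith

/-- The average of `erfc ^ c` of the square root of a nonnegative random variable in terms of its
tail. -/
lemma integral_erfc_sqrt_pow {α : Type*} [MeasurableSpace α] (ρ : Measure α)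
    [IsProbabilityMeasure ρ] {c : ℕ} (hc : c ∈ Finset.Icc 1 2) {u : α → ℝ} (hu : Measurable u)
    (hu0 : ∀ q, 0 ≤ u q) :
    ∫ q, erfc √(u q) ^ c ∂ρ =
      1 - c / √π * ∫ z in Ioi (0 : ℝ), erfcKernel c z * ρ.real {q | z ≤ u q} := by
  set F : α × ℝ → ℝ := fun p => {p : α × ℝ | p.2 ≤ u p.1}.indicator (fun p => erfcKernel c p.2) p
    with hF
  have hset : MeasurableSet {p : α × ℝ | p.2 ≤ u p.1} :=
    measurableSet_le measurable_snd (hu.comp measurable_fst)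
  have hFm : Measurable F := ((measurable_erfcKernel c).comp measurable_snd).indicator hset
  have hFi : Integrable F (ρ.prod (volume.restrict (Ioi 0))) := by
    have hdom : Integrable (fun p : α × ℝ => erfcKernel c p.2)
        (ρ.prod (volume.restrict (Ioi 0))) := (integrableOn_erfcKernel c).comp_snd ρ
    exact hdom.indicator hset
  simp only [fun q => erfc_sqrt_pow hc (hu0 q)]
  have h1 : ∀ q, ∫ z in Ioi (0 : ℝ), (Iic (u q)).indicator (erfcKernel c) z =
      ∫ z in Ioi (0 : ℝ), F (q, z) := fun q => rfl
  simp only [h1]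
  rw [integral_sub (integrable_const _) (hFi.integral_prod_left.const_mul _), integral_const_mul,
    integral_integral_swap hFi]
  simp only [integral_const, probReal_univ, one_smul]
  congr 3
  refine funext fun z => ?_
  have hz : MeasurableSet {q | z ≤ u q} := measurableSet_le measurable_const hu
  have h2 : ∀ q, F (q, z) = {q | z ≤ u q}.indicator (fun _ => erfcKernel c z) q := fun q => rfl
  simp only [h2]
  rw [integral_indicator_const _ hz, smul_eq_mul, mul_comm]

/-! ### The averaged symbol error probability -/

lemma qamBeta_pos {K : ℕ} (hK : 2 ≤ K) : 0 < qamBeta (K ^ 2) := by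
  have : (2 : ℝ) ≤ K := by exact_mod_cast hK
  unfold qamBeta
  push_cast
  exact div_pos (by norm_num) (by nlinarith)

lemma condSINR_nonneg {P : ℝ} (hP : 0 ≤ P) (η : ℝ) {r₀ : ℝ} (hr₀ : 0 ≤ r₀) (N₀ : ℝ≥0) (g : ℂ)
    (v : ℝ≥0) : 0 ≤ condSINR P η r₀ N₀ g v := by
  unfold condSINR
  positivity

lemma measurable_condSINR (P η r₀ : ℝ) (N₀ : ℝ≥0) :
    Measurable fun q : ℝ≥0 × ℂ => condSINR P η r₀ N₀ q.2 q.1 := by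
  unfold condSINR
  fun_prop

/-- The tail of the signal to interference and noise ratio. -/
lemma measureReal_le_condSINR {P η r₀ β : ℝ} (hP : 0 < P) (hr₀ : 0 < r₀) (hβ : 0 < β) {N₀ : ℝ≥0}
    (hN₀ : 0 < N₀) (ν : Measure ℝ≥0) [IsProbabilityMeasure ν] {z : ℝ} (hz : 0 ≤ z) :
    (ν.prod (complexGaussian 1)).real {q | z ≤ β * condSINR P η r₀ N₀ q.2 q.1} =
      rexp (-z * (N₀ * r₀ ^ η / (P * β))) *
        ∫ v : ℝ≥0, rexp (-(v * (z * r₀ ^ η / (P * β)))) ∂ν := by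
  have hm : MeasurableSet {q : ℝ≥0 × ℂ | z ≤ β * condSINR P η r₀ N₀ q.2 q.1} :=
    measurableSet_le measurable_const ((measurable_condSINR P η r₀ N₀).const_mul β)
  rw [← integral_indicator_one hm, integral_prod _ ((integrable_const 1).indicator hm),
    ← integral_const_mul]
  refine integral_congr_ae (ae_of_all _ fun v => ?_)
  have hN : (0 : ℝ) < N₀ := hN₀
  have hr : 0 < r₀ ^ η := rpow_pos_of_pos hr₀ η
  have hNv : (0 : ℝ) < N₀ + v := by positivity
  -- For fixed `v` the SINR event is a lower bound on `‖g‖²`, whose law is standard exponential; the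
  -- threshold is linear in `v`, so its tail integrates to a Laplace transform.
  have hset : ∀ g : ℂ, z ≤ β * condSINR P η r₀ N₀ g v ↔
      z * (N₀ + v) * r₀ ^ η / (P * β) ≤ ‖g‖ ^ 2 := by
    intro g
    rw [condSINR, rpow_neg hr₀.le, div_le_iff₀ (by positivity), ← div_eq_mul_inv, div_div,
      ← mul_div_assoc, le_div_iff₀ (by positivity)]
    constructor <;> intro h <;> linarith
  have hind : ∀ g : ℂ, {q : ℝ≥0 × ℂ | z ≤ β * condSINR P η r₀ N₀ q.2 q.1}.indicator
      (1 : ℝ≥0 × ℂ → ℝ) (v, g) =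
      {g : ℂ | z * (N₀ + v) * r₀ ^ η / (P * β) ≤ ‖g‖ ^ 2}.indicator 1 g := by
    intro g
    simp only [indicator, mem_ofPred_eq, hset, Pi.one_apply]
  simp only [hind]
  rw [integral_indicator_one (measurableSet_le measurable_const (by fun_prop)),
    complexGaussian_one_le_norm_sq (by positivity), ← Real.exp_add]
  congr 1
  field_simp
  ring

/-- The integrand of the closed form in terms of the tail of the signal to interference and noise
ratio. -/
lemma asepIntegrand_eq {K : ℕ} (hK : 2 ≤ K) {P η r₀ lam : ℝ} (hP : 0 < P)
    (hr₀ : 0 < r₀) {N₀ : ℝ≥0} (hN₀ : 0 < N₀) {ν : Measure ℝ≥0} [IsProbabilityMeasure ν]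
    (hν : ∀ t : ℝ, 0 ≤ t →
      ∫ v : ℝ≥0, rexp (-(v * t)) ∂ν = rexp (-laplaceExponent K P η r₀ lam t))
    (c : ℕ) {z : ℝ} (hz : 0 ≤ z) :
    asepIntegrand K P η r₀ lam N₀ c z = erfcKernel c z *
      (ν.prod (complexGaussian 1)).real {q | z ≤ qamBeta (K ^ 2) * condSINR P η r₀ N₀ q.2 q.1} := by
  have hβ := qamBeta_pos hK
  have hr : 0 < r₀ ^ η := rpow_pos_of_pos hr₀ η
  rw [measureReal_le_condSINR hP hr₀ hβ hN₀ ν hz, hν _ (by positivity), asepIntegrand, erfcKernel,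
    ← Real.exp_add, mul_assoc (erfc _ / _), ← Real.exp_add, laplaceExponent]
  -- At `t = z r₀^η / (P β)` the factors `P` and `r₀^{±η}` cancel in the Kummer argument.
  have harg : ∀ m : Fin K × Fin K,
      z * r₀ ^ η / (P * qamBeta (K ^ 2)) * P * ‖qam K m‖ ^ 2 * r₀ ^ (-η) =
        z * ‖qam K m‖ ^ 2 / qamBeta (K ^ 2) := fun m => by
    rw [rpow_neg hr₀.le]
    field_simp
  simp only [harg]
  congr 2
  ring

section

variable {K : ℕ} {P η r₀ lam : ℝ} {N₀ : ℝ≥0} {ν : Measure ℝ≥0} [IsProbabilityMeasure ν]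

/-- The integrand is the integrable kernel times a tail probability, which is at most `1` and is
measurable because it is monotone in `z`. -/
lemma integrableOn_asepIntegrand (hK : 2 ≤ K) (hP : 0 < P)
    (hr₀ : 0 < r₀) (hN₀ : 0 < N₀)
    (hν : ∀ t : ℝ, 0 ≤ t →
      ∫ v : ℝ≥0, rexp (-(v * t)) ∂ν = rexp (-laplaceExponent K P η r₀ lam t)) (c : ℕ) :
    IntegrableOn (asepIntegrand K P η r₀ lam N₀ c) (Ioi 0) := by
  set m : ℝ → ℝ := fun z => (ν.prod (complexGaussian 1)).real
    {q | z ≤ qamBeta (K ^ 2) * condSINR P η r₀ N₀ q.2 q.1} with hm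
  have hanti : Antitone m := fun z z' hzz => measureReal_mono fun q hq => hzz.trans hq
  have hI : IntegrableOn (fun z => erfcKernel c z * m z) (Ioi 0) := by
    refine Integrable.mul_bdd (c := 1) (integrableOn_erfcKernel c)
      hanti.measurable.aestronglyMeasurable (ae_of_all _ fun z => ?_)
    rw [Real.norm_of_nonneg measureReal_nonneg]
    exact measureReal_le_one
  exact hI.congr_fun (fun z hz => (asepIntegrand_eq hK hP hr₀ hN₀ hν c (le_of_lt hz)).symm)
    measurableSet_Ioi

lemma averageSEP_eq_asepFormula (hK : 2 ≤ K) (hP : 0 < P)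
    (hr₀ : 0 < r₀) (hN₀ : 0 < N₀)
    (hν : ∀ t : ℝ, 0 ≤ t →
      ∫ v : ℝ≥0, rexp (-(v * t)) ∂ν = rexp (-laplaceExponent K P η r₀ lam t)) :
    averageSEP (K ^ 2) P η r₀ N₀ ν = asepFormula K P η r₀ lam N₀ := by
  set u : ℝ≥0 × ℂ → ℝ := fun q => qamBeta (K ^ 2) * condSINR P η r₀ N₀ q.2 q.1 with hu
  have hum : Measurable u := (measurable_condSINR P η r₀ N₀).const_mul _
  have hu0 : ∀ q, 0 ≤ u q := fun q =>
    mul_nonneg (qamBeta_pos hK).le (condSINR_nonneg hP.le η hr₀.le N₀ q.2 q.1)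
  have hi : ∀ c : ℕ, Integrable (fun q => erfc √(u q) ^ c) (ν.prod (complexGaussian 1)) := by
    intro c
    refine Integrable.mono' (integrable_const (1 : ℝ))
      ((continuous_erfc.measurable.comp hum.sqrt).pow_const c).aestronglyMeasurable
      (ae_of_all _ fun q => ?_)
    rw [norm_pow, Real.norm_of_nonneg (erfc_nonneg _)]
    exact pow_le_one₀ (erfc_nonneg _) (erfc_le_one (Real.sqrt_nonneg _))
  have havg : ∀ c ∈ Finset.Icc 1 2, ∫ q, erfc √(u q) ^ c ∂(ν.prod (complexGaussian 1)) =
      1 - c / √π * ∫ z in Ioi (0 : ℝ), asepIntegrand K P η r₀ lam N₀ c z := by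
    intro c hc
    rw [integral_erfc_sqrt_pow _ hc hum hu0]
    congr 2
    exact setIntegral_congr_fun measurableSet_Ioi fun z hz =>
      (asepIntegrand_eq hK hP hr₀ hN₀ hν c (le_of_lt hz)).symm
  have hsum : asepFormula K P η r₀ lam N₀ = ∑ c ∈ Finset.Icc 1 2,
      qamWeight (K ^ 2) c * ∫ q, erfc √(u q) ^ c ∂(ν.prod (complexGaussian 1)) :=
    Finset.sum_congr rfl fun c hc => by rw [havg c hc]
  have hIcc : Finset.Icc 1 2 = ({1, 2} : Finset ℕ) := rfl
  rw [hsum, hIcc, Finset.sum_pair (by norm_num), ← integral_const_mul, ← integral_const_mul,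
    ← integral_add ((hi 1).const_mul _) ((hi 2).const_mul _), averageSEP]
  simp only [qamSEP, hu, pow_one]

end

/-! ### The decision cells of square QAM -/

/-- The deviations of a coordinate that do not lead to a wrong decision for the `i`-th of `K`
equally spaced points at mutual distance `2d`. -/
def openSlab (K : ℕ) (d : ℝ) (i : Fin K) : Set ℝ :=
  {t | ((i : ℕ) + 1 < K → t < d) ∧ (0 < (i : ℕ) → -d < t)}

/-- The deviations of a coordinate that may lead to a correct decision for the `i`-th of `K`
equally spaced points at mutual distance `2d`. -/
def closedSlab (K : ℕ) (d : ℝ) (i : Fin K) : Set ℝ :=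
  {t | ((i : ℕ) + 1 < K → t ≤ d) ∧ (0 < (i : ℕ) → -d ≤ t)}

lemma openSlab_eq (K : ℕ) (d : ℝ) (i : Fin K) : openSlab K d i =
    ((if (i : ℕ) + 1 < K then Ici d else ∅) ∪ (if 0 < (i : ℕ) then Iic (-d) else ∅))ᶜ := by
  ext t
  by_cases h1 : (i : ℕ) + 1 < K <;> by_cases h2 : 0 < (i : ℕ) <;>
    simp [openSlab, h1, h2]

lemma measurableSet_openSlab (K : ℕ) (d : ℝ) (i : Fin K) : MeasurableSet (openSlab K d i) := by
  rw [openSlab_eq]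
  refine (MeasurableSet.union ?_ ?_).compl <;> split_ifs <;> measurability

lemma measurableSet_closedSlab (K : ℕ) (d : ℝ) (i : Fin K) : MeasurableSet (closedSlab K d i) := by
  have h : closedSlab K d i =
      ((if (i : ℕ) + 1 < K then Ioi d else ∅) ∪ (if 0 < (i : ℕ) then Iio (-d) else ∅))ᶜ := by
    ext t
    by_cases h1 : (i : ℕ) + 1 < K <;> by_cases h2 : 0 < (i : ℕ) <;>
      simp [closedSlab, h1, h2]
  rw [h]
  refine (MeasurableSet.union ?_ ?_).compl <;> split_ifs <;> measurability

/-- The slabs differ at most in the points `±d`; this is why the treatment of ties is irrelevant. -/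
lemma gaussianReal_closedSlab {w : ℝ≥0} (hw : w ≠ 0) (K : ℕ) (d : ℝ) (i : Fin K) :
    gaussianReal 0 w (closedSlab K d i) = gaussianReal 0 w (openSlab K d i) := by
  have := nullSingletonClass_gaussianReal (μ := 0) hw
  refine measure_congr (ae_eq_set.2 ⟨?_, ?_⟩)
  · refine measure_mono_null (t := {d, -d}) (fun t ht => ?_) ((toFinite _).measure_zero _)
    by_contra hne
    simp only [mem_insert_iff, mem_singleton_iff, not_or] at hne
    exact ht.2 ⟨fun h => lt_of_le_of_ne (ht.1.1 h) hne.1,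
      fun h => lt_of_le_of_ne (ht.1.2 h) (Ne.symm hne.2)⟩
  · have : openSlab K d i \ closedSlab K d i = ∅ :=
      sdiff_eq_empty.2 fun t ht => ⟨fun h => (ht.1 h).le, fun h => (ht.2 h).le⟩
    rw [this, measure_empty]

lemma gaussianReal_real_Ici {w : ℝ≥0} (hw : w ≠ 0) (d : ℝ) :
    (gaussianReal 0 w).real (Ici d) = erfc (d / √(2 * w)) / 2 := by
  have hw0 : (0 : ℝ) < w := by positivity
  have hs : 0 < √(2 * (w : ℝ)) := by positivity
  rw [measureReal_def, gaussianReal_apply_eq_integral _ hw,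
    ENNReal.toReal_ofReal (integral_nonneg fun t => gaussianPDFReal_nonneg _ _ _),
    integral_Ici_eq_integral_Ioi]
  have h1 : ∀ t : ℝ, gaussianPDFReal 0 w t =
      (√(2 * π * w))⁻¹ * rexp (-((√(2 * (w : ℝ)))⁻¹ * t) ^ 2) := by
    intro t
    rw [gaussianPDFReal, mul_pow, inv_pow, Real.sq_sqrt (by positivity)]
    congr 2
    rw [sub_zero]
    field_simp
  simp only [h1]
  rw [integral_const_mul, integral_comp_mul_left_Ioi (fun t => rexp (-t ^ 2)) d (inv_pos.2 hs),
    inv_inv, erfc, smul_eq_mul, inv_mul_eq_div]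
  have h2 : √(2 * π * w) = √π * √(2 * (w : ℝ)) := by
    rw [← Real.sqrt_mul pi_pos.le]; congr 1; ring
  have hπ : √π ≠ 0 := by positivity
  rw [h2]
  field_simp

lemma gaussianReal_real_Iic_neg (w : ℝ≥0) (d : ℝ) :
    (gaussianReal 0 w).real (Iic (-d)) = (gaussianReal 0 w).real (Ici d) := by
  have h := gaussianReal_map_neg (μ := 0) (v := w)
  rw [neg_zero] at h
  rw [← h, map_measureReal_apply measurable_neg measurableSet_Iic, h]
  congr 1
  ext t
  simp

lemma gaussianReal_real_openSlab {w : ℝ≥0} (hw : w ≠ 0) {K : ℕ} {d : ℝ} (hd : 0 < d) (i : Fin K) :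
    (gaussianReal 0 w).real (openSlab K d i) =
      1 - (if (i : ℕ) + 1 < K then 1 else 0) * (erfc (d / √(2 * w)) / 2)
        - (if 0 < (i : ℕ) then 1 else 0) * (erfc (d / √(2 * w)) / 2) := by
  have hdisj : Disjoint (if (i : ℕ) + 1 < K then Ici d else ∅)
      (if 0 < (i : ℕ) then Iic (-d) else ∅) := by
    split_ifs
    · exact (Iic_disjoint_Ici.2 (by linarith)).symm
    · simp
    · simp
    · simp
  have hm1 : MeasurableSet (if (i : ℕ) + 1 < K then Ici d else ∅) := by
    split_ifs <;> measurability
  have hm2 : MeasurableSet (if 0 < (i : ℕ) then Iic (-d) else ∅) := by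
    split_ifs <;> measurability
  rw [openSlab_eq, probReal_compl_eq_one_sub (hm1.union hm2), measureReal_union hdisj hm2,
    ← sub_sub]
  congr 2
  · split_ifs
    · rw [gaussianReal_real_Ici hw, one_mul]
    · simp
  · split_ifs
    · rw [gaussianReal_real_Iic_neg, gaussianReal_real_Ici hw, one_mul]
    · simp

/-- Each side with a neighbour costs one tail of mass `erfc / 2`. Among `K` points, `K - 1` have a
right neighbour and `K - 1` a left one. -/
lemma sum_gaussianReal_real_openSlab {w : ℝ≥0} (hw : w ≠ 0) {K : ℕ} (hK : 1 ≤ K) {d : ℝ}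
    (hd : 0 < d) :
    ∑ i, (gaussianReal 0 w).real (openSlab K d i) = K - (K - 1) * erfc (d / √(2 * w)) := by
  simp only [gaussianReal_real_openSlab hw hd, Finset.sum_sub_distrib, ← Finset.sum_mul]
  have h1 : ∑ i : Fin K, (if (i : ℕ) + 1 < K then (1 : ℝ) else 0) = K - 1 := by
    obtain ⟨k, rfl⟩ := Nat.exists_eq_succ_of_ne_zero (by omega : K ≠ 0)
    rw [Fin.sum_univ_castSucc]
    simp
  have h2 : ∑ i : Fin K, (if 0 < (i : ℕ) then (1 : ℝ) else 0) = K - 1 := by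
    obtain ⟨k, rfl⟩ := Nat.exists_eq_succ_of_ne_zero (by omega : K ≠ 0)
    rw [Fin.sum_univ_succ]
    simp
  rw [h1, h2]
  simp
  ring

/-- For a nonzero integer `m = j - i`, `m t < |m| d ≤ d m²`: beating the adjacent points beats all
the others. -/
lemma mul_lt_of_mem_openSlab {K : ℕ} {d : ℝ} (hd : 0 < d) {i j : Fin K} (hij : i ≠ j) {t : ℝ}
    (ht : t ∈ openSlab K d i) : ((j : ℝ) - i) * t < d * ((j : ℝ) - i) ^ 2 := by
  rcases lt_or_gt_of_ne hij with h | h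
  · have h1 : (i : ℕ) + 1 ≤ j := h
    have h2 : (i : ℝ) + 1 ≤ j := by exact_mod_cast h1
    have h3 := ht.1 (by omega)
    nlinarith [mul_pos hd (by linarith : (0 : ℝ) < (j : ℝ) - i),
      mul_nonneg (mul_nonneg hd.le (by linarith : (0 : ℝ) ≤ (j : ℝ) - i))
        (by linarith : (0 : ℝ) ≤ (j : ℝ) - i - 1)]
  · have h1 : (j : ℕ) + 1 ≤ i := h
    have h2 : (j : ℝ) + 1 ≤ i := by exact_mod_cast h1
    have h3 := ht.2 (by omega)
    nlinarith [mul_pos hd (by linarith : (0 : ℝ) < (i : ℝ) - j),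
      mul_nonneg (mul_nonneg hd.le (by linarith : (0 : ℝ) ≤ (i : ℝ) - j))
        (by linarith : (0 : ℝ) ≤ (i : ℝ) - j - 1)]

lemma qamBeta_eq (K : ℕ) : qamBeta (K ^ 2) = 3 / (2 * ((K : ℝ) ^ 2 - 1)) := by
  rw [qamBeta]; push_cast; rfl

/-- The grid scale equals `√β`, so neighbours are `2√β` apart, and the squared distance separates
into one correction per coordinate. -/
lemma normSq_sub_qam_sub (K : ℕ) (p q : Fin K × Fin K) (u : ℂ) :
    ‖u - (qam K q - qam K p)‖ ^ 2 = ‖u‖ ^ 2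
      + 4 * √(qamBeta (K ^ 2)) * (√(qamBeta (K ^ 2)) * ((q.1 : ℝ) - p.1) ^ 2
        - ((q.1 : ℝ) - p.1) * u.re)
      + 4 * √(qamBeta (K ^ 2)) * (√(qamBeta (K ^ 2)) * ((q.2 : ℝ) - p.2) ^ 2
        - ((q.2 : ℝ) - p.2) * u.im) := by
  simp only [← Complex.normSq_eq_norm_sq, Complex.normSq_apply, Complex.sub_re, Complex.sub_im,
    qam_re, qam_im, qamBeta_eq]
  ring

lemma norm_lt_norm_sub_qam_sub {K : ℕ} (hK : 2 ≤ K) {p q : Fin K × Fin K} (hpq : p ≠ q) {u : ℂ}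
    (h1 : u.re ∈ openSlab K √(qamBeta (K ^ 2)) p.1)
    (h2 : u.im ∈ openSlab K √(qamBeta (K ^ 2)) p.2) :
    ‖u‖ < ‖u - (qam K q - qam K p)‖ := by
  have hd : 0 < √(qamBeta (K ^ 2)) := Real.sqrt_pos.2 (qamBeta_pos hK)
  refine lt_of_pow_lt_pow_left₀ 2 (norm_nonneg _) ?_
  rw [normSq_sub_qam_sub]
  by_cases e1 : p.1 = q.1
  · have e2 : p.2 ≠ q.2 := fun e2 => hpq (Prod.ext e1 e2)
    have := mul_pos hd (sub_pos.2 (mul_lt_of_mem_openSlab hd e2 h2))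
    rw [e1]
    nlinarith
  · have l1 := mul_pos hd (sub_pos.2 (mul_lt_of_mem_openSlab hd e1 h1))
    by_cases e2 : p.2 = q.2
    · rw [e2]
      nlinarith
    · have l2 := mul_pos hd (sub_pos.2 (mul_lt_of_mem_openSlab hd e2 h2))
      nlinarith

/-- Comparison with the at most four adjacent points is enough. -/
lemma mem_closedSlab_of_norm_le {K : ℕ} (hK : 2 ≤ K) {p : Fin K × Fin K} {u : ℂ}
    (h : ∀ q, ‖u‖ ≤ ‖u - (qam K q - qam K p)‖) :
    u.re ∈ closedSlab K √(qamBeta (K ^ 2)) p.1 ∧ u.im ∈ closedSlab K √(qamBeta (K ^ 2)) p.2 := by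
  have hd : 0 < √(qamBeta (K ^ 2)) := Real.sqrt_pos.2 (qamBeta_pos hK)
  have h' : ∀ q, ‖u‖ ^ 2 ≤ ‖u - (qam K q - qam K p)‖ ^ 2 := fun q =>
    pow_le_pow_left₀ (norm_nonneg _) (h q) 2
  simp only [normSq_sub_qam_sub] at h'
  refine ⟨⟨fun hi => ?_, fun hi => ?_⟩, fun hi => ?_, fun hi => ?_⟩
  · have := h' (⟨p.1 + 1, hi⟩, p.2)
    push_cast at this
    ring_nf at this
    nlinarith
  · have := h' (⟨p.1 - 1, by omega⟩, p.2)
    push_cast [Nat.cast_sub (Nat.succ_le_of_lt hi)] at this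
    ring_nf at this
    nlinarith
  · have := h' (p.1, ⟨p.2 + 1, hi⟩)
    push_cast at this
    ring_nf at this
    nlinarith
  · have := h' (p.1, ⟨p.2 - 1, by omega⟩)
    push_cast [Nat.cast_sub (Nat.succ_le_of_lt hi)] at this
    ring_nf at this
    nlinarith

/-- The assumed variance drops out, which is why it may depend on the realization. -/
lemma likelihood_le_likelihood_iff {v : ℝ} (hv : 0 < v) (c y a b : ℂ) :
    likelihood v c y a ≤ likelihood v c y b ↔ ‖y - c * b‖ ≤ ‖y - c * a‖ := by
  have h0 : 0 < 1 / (π * v) := by positivity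
  rw [likelihood, likelihood, mul_le_mul_iff_right₀ h0, exp_le_exp, div_le_div_iff_of_pos_right hv,
    neg_le_neg_iff, pow_le_pow_iff_left₀ (norm_nonneg _) (norm_nonneg _) two_ne_zero]

lemma norm_received_sub {c : ℂ} (hc : c ≠ 0) (a b z : ℂ) :
    ‖c * a + z - c * b‖ = ‖c‖ * ‖z / c - (b - a)‖ := by
  rw [← norm_mul]
  congr 1
  field_simp
  ring

/-- If the normalized disturbance lies in the open decision cell of the transmitted symbol, the
decision is correct. -/
lemma IsMLDecision.eq_of_mem_openSlab {K : ℕ} (hK : 2 ≤ K) {v : ℝ} (hv : 0 < v) {c : ℂ}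
    (hc : c ≠ 0) {p : Fin K × Fin K} {z shat : ℂ}
    (h : IsMLDecision (range (qam K)) v c (c * qam K p + z) shat)
    (h1 : (z / c).re ∈ openSlab K √(qamBeta (K ^ 2)) p.1)
    (h2 : (z / c).im ∈ openSlab K √(qamBeta (K ^ 2)) p.2) : shat = qam K p := by
  obtain ⟨⟨q, rfl⟩, hmax⟩ := h
  by_contra hne
  have hpq : p ≠ q := fun h => hne (by rw [h])
  have hle := (likelihood_le_likelihood_iff hv _ _ _ _).1 (hmax _ (mem_range_self p))
  rw [norm_received_sub hc, norm_received_sub hc, sub_self, sub_zero] at hle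
  exact absurd (le_of_mul_le_mul_left hle (norm_pos_iff.2 hc))
    (not_le.2 (norm_lt_norm_sub_qam_sub hK hpq h1 h2))

/-- If the decision is correct, the normalized disturbance lies in the closed decision cell of the
transmitted symbol. -/
lemma IsMLDecision.mem_closedSlab {K : ℕ} (hK : 2 ≤ K) {v : ℝ} (hv : 0 < v) {c : ℂ}
    (hc : c ≠ 0) {p : Fin K × Fin K} {z : ℂ}
    (h : IsMLDecision (range (qam K)) v c (c * qam K p + z) (qam K p)) :
    (z / c).re ∈ closedSlab K √(qamBeta (K ^ 2)) p.1 ∧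
      (z / c).im ∈ closedSlab K √(qamBeta (K ^ 2)) p.2 := by
  refine mem_closedSlab_of_norm_le hK fun q => ?_
  have hle := (likelihood_le_likelihood_iff hv _ _ _ _).1 (h.2 _ (mem_range_self q))
  rw [norm_received_sub hc, norm_received_sub hc, sub_self, sub_zero] at hle
  exact le_of_mul_le_mul_left hle (norm_pos_iff.2 hc)

/-! ### The probability of a correct decision -/

/-- The probability of a correct decision at a given conditional signal to interference and noise
ratio. -/
lemma sum_complexGaussian_cells {K : ℕ} (hK : 2 ≤ K) {A : Fin K → Set ℝ}
    (hA : ∀ i, MeasurableSet (A i))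
    (hAo : ∀ w : ℝ≥0, w ≠ 0 → ∀ i,
      gaussianReal 0 w (A i) = gaussianReal 0 w (openSlab K √(qamBeta (K ^ 2)) i))
    {σ : ℝ≥0} (hσ : σ ≠ 0) {snr : ℝ} (hsnr : (σ : ℝ) = snr⁻¹) :
    ∑ p : Fin K × Fin K, ENNReal.ofReal (1 / ((K ^ 2 : ℕ) : ℝ)) *
      complexGaussian σ {u | u.re ∈ A p.1 ∧ u.im ∈ A p.2} =
        ENNReal.ofReal (1 - qamSEP (K ^ 2) snr) := by
  have hd : 0 < √(qamBeta (K ^ 2)) := Real.sqrt_pos.2 (qamBeta_pos hK)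
  have hσ2 : σ / 2 ≠ 0 := by simpa using hσ
  have hK0 : (0 : ℝ) < K := by positivity
  have hsnr0 : 0 < snr := by
    have : (0 : ℝ) < σ := by positivity
    rw [hsnr] at this
    exact inv_pos.1 this
  have h1 : ∀ p : Fin K × Fin K, ENNReal.ofReal (1 / ((K ^ 2 : ℕ) : ℝ)) *
      complexGaussian σ {u | u.re ∈ A p.1 ∧ u.im ∈ A p.2} =
      ENNReal.ofReal (1 / ((K ^ 2 : ℕ) : ℝ) *
        ((gaussianReal 0 (σ / 2)).real (openSlab K √(qamBeta (K ^ 2)) p.1) *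
          (gaussianReal 0 (σ / 2)).real (openSlab K √(qamBeta (K ^ 2)) p.2))) := by
    intro p
    rw [complexGaussian_reProdIm _ (hA _) (hA _), hAo _ hσ2, hAo _ hσ2,
      ENNReal.ofReal_mul (by positivity), ENNReal.ofReal_mul measureReal_nonneg,
      ofReal_measureReal, ofReal_measureReal]
  simp only [h1]
  rw [← ENNReal.ofReal_sum_of_nonneg fun p _ =>
    mul_nonneg (by positivity) (mul_nonneg measureReal_nonneg measureReal_nonneg)]
  congr 1
  rw [← Finset.mul_sum, Fintype.sum_prod_type]
  simp only [← Finset.mul_sum]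
  rw [← Finset.sum_mul, sum_gaussianReal_real_openSlab hσ2 (by omega) hd]
  have h2 : √(qamBeta (K ^ 2)) / √(2 * ((σ / 2 : ℝ≥0) : ℝ)) = √(qamBeta (K ^ 2) * snr) := by
    rw [← Real.sqrt_div (qamBeta_pos hK).le]
    congr 1
    push_cast
    rw [hsnr]
    field_simp
  have h3 : √(((K ^ 2 : ℕ) : ℝ)) = K := by push_cast; exact Real.sqrt_sq hK0.le
  -- With `e = erfc √(β · snr)` and `√M = K`, the average over cells is `((K - (K-1) e) / K)²`,
  -- which expands to `1 - w₁ e - w₂ e²`.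
  rw [h2, qamSEP, qamWeight, qamWeight, if_pos rfl, if_neg (by norm_num), h3]
  push_cast
  field_simp
  ring

lemma measurable_erfc : Measurable erfc := continuous_erfc.measurable

lemma measurable_qamSEP (M : ℕ) : Measurable (qamSEP M) := by
  have h : Measurable fun snr : ℝ => erfc √(qamBeta M * snr) :=
    measurable_erfc.comp (by fun_prop)
  exact (h.const_mul _).add ((h.pow_const 2).const_mul _)

lemma abs_qamSEP_le (M : ℕ) (snr : ℝ) : |qamSEP M snr| ≤ |qamWeight M 1| + |qamWeight M 2| := by
  have h1 : |erfc √(qamBeta M * snr)| ≤ 1 := by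
    rw [abs_of_nonneg (erfc_nonneg _)]; exact erfc_le_one (Real.sqrt_nonneg _)
  have h2 : |erfc √(qamBeta M * snr) ^ 2| ≤ 1 := by
    rw [abs_pow]; exact pow_le_one₀ (abs_nonneg _) h1
  unfold qamSEP
  refine (abs_add_le _ _).trans (add_le_add ?_ ?_)
  · rw [abs_mul]; exact mul_le_of_le_one_right (abs_nonneg _) h1
  · rw [abs_mul]; exact mul_le_of_le_one_right (abs_nonneg _) h2

/-- The complementary probability is a square. Its nonnegativity keeps `ENNReal.ofReal (1 - qamSEP
…)` from truncating. -/
lemma qamSEP_le_one {K : ℕ} (hK : 2 ≤ K) (snr : ℝ) : qamSEP (K ^ 2) snr ≤ 1 := by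
  have h3 : √(((K ^ 2 : ℕ) : ℝ)) = K := by push_cast; exact Real.sqrt_sq (by positivity)
  have : qamSEP (K ^ 2) snr =
      1 - (1 - (K - 1) / K * erfc √(qamBeta (K ^ 2) * snr)) ^ 2 := by
    rw [qamSEP, qamWeight, qamWeight, if_pos rfl, if_neg (by norm_num), h3]
    ring
  rw [this]
  linarith [sq_nonneg (1 - (K - 1) / K * erfc √(qamBeta (K ^ 2) * snr))]

lemma lintegral_lintegral_sum_const_mul {ι α β : Type*} [Fintype ι] [MeasurableSpace α]
    [MeasurableSpace β] {ρ : Measure α} {ν : Measure β} [SFinite ν] {f : ι → α → β → ℝ≥0∞}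
    (hf : ∀ i, Measurable fun q : α × β => f i q.1 q.2) (a : ℝ≥0∞) :
    ∫⁻ x, ∫⁻ y, ∑ i, a * f i x y ∂ν ∂ρ = ∑ i, a * ∫⁻ x, ∫⁻ y, f i x y ∂ν ∂ρ := by
  have h1 : ∀ i x, Measurable fun y => f i x y := fun i x =>
    (hf i).comp (measurable_prodMk_left (x := x))
  have h2 : ∀ i, Measurable fun x => ∫⁻ y, f i x y ∂ν := fun i => (hf i).lintegral_prod_right'
  have h3 : ∀ x, ∫⁻ y, ∑ i, a * f i x y ∂ν = ∑ i, a * ∫⁻ y, f i x y ∂ν := fun x => by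
    rw [lintegral_finsetSum _ fun i _ => (h1 i x).const_mul _]
    exact Finset.sum_congr rfl fun i _ => lintegral_const_mul _ (h1 i x)
  simp only [h3]
  rw [lintegral_finsetSum _ fun i _ => (h2 i).const_mul _]
  exact Finset.sum_congr rfl fun i _ => lintegral_const_mul _ (h2 i)

namespace IsDownlink

variable {Ω : Type*} [MeasurableSpace Ω] {μ : Measure Ω} {lam r₀ P η : ℝ}
  {N₀ : ℝ≥0} {K : ℕ} {x : ℕ → Ω → EuclideanSpace ℝ (Fin 2)} {s h : ℕ → Ω → ℂ} {n : Ω → ℂ}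

lemma ae_gain_ne_zero (H : IsDownlink μ lam r₀ N₀ K x s h n) (hP : 0 < P) (hr₀ : 0 < r₀) :
    ∀ᵐ ω ∂μ, gain P η r₀ h ω ≠ 0 := by
  have h0 : ∀ᵐ g ∂(complexGaussian 1), g ≠ 0 := by
    rw [ae_iff]
    simpa using complexGaussian_singleton_zero one_ne_zero
  have hm : MeasurableSet {g : ℂ | g ≠ 0} := (measurableSet_singleton 0).compl
  have h1 := ((H.law_h 0).ae_iff (p := fun g => g ≠ 0) hm.mem).2 h0
  filter_upwards [h1] with ω hω
  have hr : ((r₀ ^ (-η / 2) : ℝ) : ℂ) ≠ 0 := by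
    exact_mod_cast (rpow_pos_of_pos hr₀ _).ne'
  have hP' : (√P : ℂ) ≠ 0 := by exact_mod_cast (Real.sqrt_pos.2 hP).ne'
  exact mul_ne_zero (mul_ne_zero hP' hω) hr

variable [IsProbabilityMeasure μ]

lemma indep_n_interference (H : IsDownlink μ lam r₀ N₀ K x s h n) :
    IndepFun n (interference P η x s h) μ :=
  H.indep_n_xsh.comp measurable_id (CellularASEP.measurable_interference P η
    (x := fun k (q : (ℕ → EuclideanSpace ℝ (Fin 2)) × (ℕ → ℂ) × (ℕ → ℂ)) => q.1 k)
    (s := fun k q => q.2.1 k) (h := fun k q => q.2.2 k)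
    (fun k => by fun_prop) (fun k => by fun_prop) (fun k => by fun_prop))

/-- Interference reads symbols and channels only at indices `k + 1`. The sequences here are already
shifted by one, so the index `k - 1` undoes the shift, and the truncated value at `k = 0` is never
read. This exhibits the disturbance as a function of variables that exclude `s 0` and `h 0`. -/
lemma measurable_shifted_disturbance (P η : ℝ) :
    Measurable fun q : (ℕ → EuclideanSpace ℝ (Fin 2)) × (ℕ → ℂ) × (ℕ → ℂ) × ℂ =>
      interference P η (fun k (q : (ℕ → EuclideanSpace ℝ (Fin 2)) × (ℕ → ℂ) × (ℕ → ℂ) × ℂ) => q.1 k)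
        (fun k q => q.2.1 (k - 1)) (fun k q => q.2.2.1 (k - 1)) q + q.2.2.2 :=
  (CellularASEP.measurable_interference P η (fun k => by fun_prop) (fun k => by fun_prop)
    (fun k => by fun_prop)).add (by fun_prop)

lemma indep_h_zero_disturbance (H : IsDownlink μ lam r₀ N₀ K x s h n) :
    IndepFun (h 0) (fun ω => interference P η x s h ω + n ω) μ :=
  H.indep_h_zero.comp measurable_id (measurable_shifted_disturbance P η)

lemma indep_s_zero_disturbance (H : IsDownlink μ lam r₀ N₀ K x s h n) :
    IndepFun (s 0) (fun ω => (h 0 ω, interference P η x s h ω + n ω)) μ :=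
  H.indep_s_zero.comp measurable_id
    (measurable_fst.prodMk ((measurable_shifted_disturbance P η).comp measurable_snd))

/-- The law of interference plus noise. -/
lemma map_disturbance (H : IsDownlink μ lam r₀ N₀ K x s h n) {ν : Measure ℝ≥0}
    [IsProbabilityMeasure ν] (hν : IsEiDRepresentation μ (interference P η x s h) ν) :
    μ.map (fun ω => interference P η x s h ω + n ω) =
      (ν.prod (complexGaussian 1)).map
        (fun p => ((√((p.1 : ℝ) + N₀) : ℝ) : ℂ) * p.2) := by
  have hw : Measurable fun v : ℝ≥0 => ((√(v : ℝ) : ℝ) : ℂ) := by fun_prop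
  have hw' : Measurable fun v : ℝ≥0 => ((√((v : ℝ) + N₀) : ℝ) : ℂ) := by fun_prop
  have hI : Measurable (interference P η x s h) := H.measurable_interference
  have hp : Measurable fun p : ℝ≥0 × ℂ => ((√((p.1 : ℝ) + N₀) : ℝ) : ℂ) * p.2 := by fun_prop
  have := Measure.isProbabilityMeasure_map (μ := μ) (hI.add H.measurable_n).aemeasurable
  have := Measure.isProbabilityMeasure_map (μ := ν.prod (complexGaussian 1)) hp.aemeasurable
  refine Measure.ext_of_charFun (funext fun ξ => ?_)
  rw [H.indep_n_interference.symm.charFun_map_fun_add_eq_mul hI.aemeasurable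
    H.measurable_n.aemeasurable, Pi.mul_apply, hν.map_eq, H.law_n.map_eq,
    charFun_map_mul_complexGaussian_one _ hw, charFun_map_mul_complexGaussian_one _ hw',
    charFun_complexGaussian, ← Complex.ofReal_mul, ← integral_mul_const]
  congr 1
  refine integral_congr_ae (ae_of_all _ fun v => ?_)
  simp only [Complex.norm_real, Real.norm_of_nonneg (Real.sqrt_nonneg _),
    Real.sq_sqrt (NNReal.coe_nonneg _),
    Real.sq_sqrt (add_nonneg (NNReal.coe_nonneg v) (NNReal.coe_nonneg N₀))]
  rw [← Real.exp_add]
  congr 1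
  ring

/-- The probability that the normalized disturbance lies in the cell of the transmitted symbol, as an
integral. -/
lemma measure_cells (H : IsDownlink μ lam r₀ N₀ K x s h n) (hK : 2 ≤ K) (hP : 0 < P)
    (hr₀ : 0 < r₀) (hN₀ : 0 < N₀) {ν : Measure ℝ≥0}
    [IsProbabilityMeasure ν] (hν : IsEiDRepresentation μ (interference P η x s h) ν)
    {A : Fin K → Set ℝ} (hA : ∀ i, MeasurableSet (A i))
    (hAo : ∀ w : ℝ≥0, w ≠ 0 → ∀ i,
      gaussianReal 0 w (A i) = gaussianReal 0 w (openSlab K √(qamBeta (K ^ 2)) i)) :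
    MeasurableSet {ω | ∃ p, s 0 ω = qam K p ∧
      ((interference P η x s h ω + n ω) / gain P η r₀ h ω).re ∈ A p.1 ∧
      ((interference P η x s h ω + n ω) / gain P η r₀ h ω).im ∈ A p.2} ∧
    μ {ω | ∃ p, s 0 ω = qam K p ∧
      ((interference P η x s h ω + n ω) / gain P η r₀ h ω).re ∈ A p.1 ∧
      ((interference P η x s h ω + n ω) / gain P η r₀ h ω).im ∈ A p.2} =
      ∫⁻ q, ENNReal.ofReal (1 - qamSEP (K ^ 2) (condSINR P η r₀ N₀ q.2 q.1))
        ∂(ν.prod (complexGaussian 1)) := by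
  set c : ℂ → ℂ := fun g => (√P : ℂ) * g * ((r₀ ^ (-η / 2) : ℝ) : ℂ) with hc
  set Z : Ω → ℂ := fun ω => interference P η x s h ω + n ω with hZ
  set D : Fin K × Fin K → Set ℂ := fun p => {u | u.re ∈ A p.1 ∧ u.im ∈ A p.2} with hD
  have hcm : Measurable c := by fun_prop
  have hZm : Measurable Z := H.measurable_interference.add H.measurable_n
  have hDm : ∀ p, MeasurableSet (D p) := fun p =>
    (Complex.measurable_re (hA p.1)).inter (Complex.measurable_im (hA p.2))
  set S : Set ((ℂ × ℂ) × ℂ) := {q | ∃ p, q.2 = qam K p ∧ q.1.2 / c q.1.1 ∈ D p} with hS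
  have hSm : MeasurableSet S := by
    have : S = ⋃ p, {q | q.2 = qam K p} ∩ {q | q.1.2 / c q.1.1 ∈ D p} := by
      ext q; simp [hS]
    rw [this]
    refine MeasurableSet.iUnion fun p => MeasurableSet.inter ?_ ?_
    · exact measurableSet_eq_fun measurable_snd measurable_const
    · exact (show Measurable fun q : (ℂ × ℂ) × ℂ => q.1.2 / c q.1.1 by fun_prop) (hDm p)
  have hm0 := H.measurable_h 0
  have hE : MeasurableSet {ω | ((h 0 ω, Z ω), s 0 ω) ∈ S} :=
    ((hm0.prodMk hZm).prodMk (H.measurable_s 0)) hSm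
  refine ⟨hE, ?_⟩
  change μ {ω | ((h 0 ω, Z ω), s 0 ω) ∈ S} = _
  -- Averaging over the intended symbol alone; injectivity of the constellation makes the cell index
  -- unique.
  have e1 : ∀ ω, ∫⁻ ω', S.indicator 1 ((h 0 ω, Z ω), s 0 ω') ∂μ =
      ∑ p, ENNReal.ofReal (1 / ((K ^ 2 : ℕ) : ℝ)) * (D p).indicator 1 (Z ω / c (h 0 ω)) := by
    intro ω
    rw [← (H.law_s 0).lintegral_comp (f := fun a => S.indicator 1 ((h 0 ω, Z ω), a))
      ((measurable_one.indicator hSm).comp measurable_prodMk_left).aemeasurable |>.symm,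
      lintegral_uniformOn_qam hK]
    refine Finset.sum_congr rfl fun p _ => ?_
    congr 1
    have : ((h 0 ω, Z ω), qam K p) ∈ S ↔ Z ω / c (h 0 ω) ∈ D p :=
      ⟨fun ⟨q, hq, hq'⟩ => qam_injective hK hq ▸ hq', fun hp => ⟨p, rfl, hp⟩⟩
    by_cases hp : Z ω / c (h 0 ω) ∈ D p
    · rw [indicator_of_mem hp, indicator_of_mem (this.2 hp)]; rfl
    · rw [indicator_of_notMem hp, indicator_of_notMem fun hq => hp (this.1 hq)]
  -- The conditional variance `(v + N₀) / |c g|²` of the normalized disturbance, i.e. the reciprocal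
  -- SINR when `g ≠ 0`.
  set σ : ℂ → ℝ≥0 → ℝ≥0 := fun g v => ‖((√((v : ℝ) + N₀) : ℝ) : ℂ) / c g‖₊ ^ 2 with hσ
  -- Writing the cell mass as an integral over a fixed Gaussian yields its joint measurability in
  -- `(g, v)`.
  have e0 : ∀ p g v, complexGaussian (σ g v) (D p) =
      ∫⁻ z, (D p).indicator (1 : ℂ → ℝ≥0∞) (((√((v : ℝ) + N₀) : ℝ) : ℂ) * z / c g)
        ∂(complexGaussian 1) := by
    intro p g v
    rw [← mul_one (σ g v), ← map_mul_complexGaussian,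
      Measure.map_apply (measurable_const_mul _) (hDm p),
      ← lintegral_indicator_one (measurable_const_mul _ (hDm p))]
    refine lintegral_congr fun z => ?_
    rw [mul_div_right_comm]
    rfl
  have hk : ∀ p, Measurable fun q : ℂ × ℝ≥0 => complexGaussian (σ q.1 q.2) (D p) := by
    intro p
    simp only [e0]
    have : Measurable fun q : (ℂ × ℝ≥0) × ℂ => (D p).indicator (1 : ℂ → ℝ≥0∞)
        (((√((q.1.2 : ℝ) + N₀) : ℝ) : ℂ) * q.2 / c q.1.1) :=
      (measurable_one.indicator (hDm p)).comp (by fun_prop)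
    exact this.lintegral_prod_right'
  have hF : ∀ p, Measurable fun q : ℂ × ℂ => (D p).indicator (1 : ℂ → ℝ≥0∞) (q.2 / c q.1) :=
    fun p => (measurable_one.indicator (hDm p)).comp (by fun_prop)
  have e2 : ∀ p, ∫⁻ ω, (D p).indicator (1 : ℂ → ℝ≥0∞) (Z ω / c (h 0 ω)) ∂μ =
      ∫⁻ g, ∫⁻ v : ℝ≥0, complexGaussian (σ g v) (D p) ∂ν ∂(complexGaussian 1) := by
    intro p
    have hp : Measurable fun q : ℝ≥0 × ℂ => ((√((q.1 : ℝ) + N₀) : ℝ) : ℂ) * q.2 := by fun_prop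
    rw [lintegral_prodMk_of_indepFun hm0 hZm H.indep_h_zero_disturbance (hF p)]
    have e3 : ∀ g : ℂ, ∫⁻ ω', (D p).indicator (1 : ℂ → ℝ≥0∞) (Z ω' / c g) ∂μ =
        ∫⁻ v : ℝ≥0, complexGaussian (σ g v) (D p) ∂ν := by
      intro g
      have hFg : Measurable fun z : ℂ => (D p).indicator (1 : ℂ → ℝ≥0∞) (z / c g) :=
        (hF p).comp measurable_prodMk_left
      have hGg : Measurable fun q : ℝ≥0 × ℂ => (D p).indicator (1 : ℂ → ℝ≥0∞)
          (((√((q.1 : ℝ) + N₀) : ℝ) : ℂ) * q.2 / c g) := hFg.comp hp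
      rw [← lintegral_map hFg hZm, H.map_disturbance hν, lintegral_map hFg hp,
        lintegral_prod _ hGg.aemeasurable]
      simp only [e0]
    simp only [e3]
    exact (H.law_h 0).lintegral_comp (hk p).lintegral_prod_right'.aemeasurable
  have hcell : ∀ g : ℂ, g ≠ 0 → ∀ v : ℝ≥0,
      ∑ p, ENNReal.ofReal (1 / ((K ^ 2 : ℕ) : ℝ)) * complexGaussian (σ g v) (D p) =
        ENNReal.ofReal (1 - qamSEP (K ^ 2) (condSINR P η r₀ N₀ g v)) := by
    intro g hg v
    have hvN : (0 : ℝ) < v + N₀ := by positivity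
    have hσv : (σ g v : ℝ) = (condSINR P η r₀ N₀ g v)⁻¹ := by
      simp only [hσ, hc, NNReal.coe_pow, coe_nnnorm]
      rw [norm_div, div_pow, norm_interference_coeff_sq hP.le _ _ hr₀.le, Complex.norm_real,
        Real.norm_of_nonneg (Real.sqrt_nonneg _), Real.sq_sqrt hvN.le, condSINR, inv_div,
        add_comm]
    refine sum_complexGaussian_cells hK hA hAo (fun h0 => ?_) hσv
    rw [h0, NNReal.coe_zero, eq_comm, inv_eq_zero] at hσv
    have : 0 < ‖g‖ := norm_pos_iff.2 hg
    have : 0 < condSINR P η r₀ N₀ g v := by unfold condSINR; positivity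
    exact this.ne' hσv
  have hg0 : ∀ᵐ g ∂(complexGaussian 1), g ≠ 0 := by
    rw [ae_iff]
    simpa using complexGaussian_singleton_zero one_ne_zero
  have hq : Measurable fun q : ℝ≥0 × ℂ =>
      ENNReal.ofReal (1 - qamSEP (K ^ 2) (condSINR P η r₀ N₀ q.2 q.1)) :=
    (((measurable_qamSEP _).comp (measurable_condSINR P η r₀ N₀)).const_sub 1).ennreal_ofReal
  have hDω : ∀ p, Measurable fun ω => (D p).indicator (1 : ℂ → ℝ≥0∞) (Z ω / c (h 0 ω)) :=
    fun p => (hF p).comp (hm0.prodMk hZm)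
  rw [← lintegral_indicator_one hE]
  calc ∫⁻ ω, {ω | ((h 0 ω, Z ω), s 0 ω) ∈ S}.indicator 1 ω ∂μ
      = ∫⁻ ω, ∫⁻ ω', S.indicator 1 ((h 0 ω, Z ω), s 0 ω') ∂μ ∂μ :=
        lintegral_prodMk_of_indepFun (hm0.prodMk hZm) (H.measurable_s 0)
          H.indep_s_zero_disturbance.symm (F := S.indicator 1) (measurable_one.indicator hSm)
    _ = ∑ p, ENNReal.ofReal (1 / ((K ^ 2 : ℕ) : ℝ)) *
          ∫⁻ g, ∫⁻ v : ℝ≥0, complexGaussian (σ g v) (D p) ∂ν ∂(complexGaussian 1) := by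
        simp only [e1]
        rw [lintegral_finsetSum _ fun p _ => (hDω p).const_mul _]
        refine Finset.sum_congr rfl fun p _ => ?_
        rw [lintegral_const_mul _ (hDω p), e2]
    _ = ∫⁻ g, ∫⁻ v : ℝ≥0, ∑ p, ENNReal.ofReal (1 / ((K ^ 2 : ℕ) : ℝ)) *
          complexGaussian (σ g v) (D p) ∂ν ∂(complexGaussian 1) := by
        exact (lintegral_lintegral_sum_const_mul hk _).symm
    _ = ∫⁻ g, ∫⁻ v : ℝ≥0, ENNReal.ofReal (1 - qamSEP (K ^ 2) (condSINR P η r₀ N₀ g v)) ∂ν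
          ∂(complexGaussian 1) :=
        lintegral_congr_ae (hg0.mono fun g hg => lintegral_congr (hcell g hg))
    _ = _ := (lintegral_prod_symm _ hq.aemeasurable).symm

/-- The probability that the normalized disturbance lies in the cell of the transmitted symbol. -/
lemma measureReal_cells (H : IsDownlink μ lam r₀ N₀ K x s h n) (hK : 2 ≤ K) (hP : 0 < P)
    (hr₀ : 0 < r₀) (hN₀ : 0 < N₀) {ν : Measure ℝ≥0}
    [IsProbabilityMeasure ν] (hν : IsEiDRepresentation μ (interference P η x s h) ν)
    {A : Fin K → Set ℝ} (hA : ∀ i, MeasurableSet (A i))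
    (hAo : ∀ w : ℝ≥0, w ≠ 0 → ∀ i,
      gaussianReal 0 w (A i) = gaussianReal 0 w (openSlab K √(qamBeta (K ^ 2)) i)) :
    MeasurableSet {ω | ∃ p, s 0 ω = qam K p ∧
      ((interference P η x s h ω + n ω) / gain P η r₀ h ω).re ∈ A p.1 ∧
      ((interference P η x s h ω + n ω) / gain P η r₀ h ω).im ∈ A p.2} ∧
    μ.real {ω | ∃ p, s 0 ω = qam K p ∧
      ((interference P η x s h ω + n ω) / gain P η r₀ h ω).re ∈ A p.1 ∧
      ((interference P η x s h ω + n ω) / gain P η r₀ h ω).im ∈ A p.2} =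
      1 - averageSEP (K ^ 2) P η r₀ N₀ ν := by
  obtain ⟨hE, hlin⟩ := H.measure_cells hK hP hr₀ hN₀ hν hA hAo
  refine ⟨hE, ?_⟩
  have hm : Measurable fun q : ℝ≥0 × ℂ => qamSEP (K ^ 2) (condSINR P η r₀ N₀ q.2 q.1) :=
    (measurable_qamSEP _).comp (measurable_condSINR P η r₀ N₀)
  have hi : Integrable (fun q : ℝ≥0 × ℂ => qamSEP (K ^ 2) (condSINR P η r₀ N₀ q.2 q.1))
      (ν.prod (complexGaussian 1)) :=
    Integrable.mono' (integrable_const _) hm.aestronglyMeasurable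
      (ae_of_all _ fun q => abs_qamSEP_le _ _)
  have hsub := integral_sub (integrable_const (1 : ℝ)) hi
  rw [integral_const, probReal_univ, one_smul] at hsub
  rw [averageSEP, ← hsub, integral_eq_lintegral_of_nonneg_ae
    (ae_of_all _ fun q => sub_nonneg.2 (qamSEP_le_one hK _))
    (hm.const_sub 1).aestronglyMeasurable, ← hlin]
  rfl

/-- The symbol error probability of the coherent maximum likelihood detector is the conditional
symbol error probability averaged over the representation of the interference. -/
theorem measureReal_ne_of_isMLDecision (H : IsDownlink μ lam r₀ N₀ K x s h n) (hK : 2 ≤ K)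
    (hP : 0 < P) (hr₀ : 0 < r₀) (hN₀ : 0 < N₀) {ν : Measure ℝ≥0}
    [IsProbabilityMeasure ν] (hν : IsEiDRepresentation μ (interference P η x s h) ν)
    {v : Ω → ℝ} {shat : Ω → ℂ} (hv : ∀ ω, 0 < v ω)
    (hML : ∀ ω, IsMLDecision (range (qam K)) (v ω) (gain P η r₀ h ω)
      (received P η r₀ x s h n ω) (shat ω)) :
    μ.real {ω | shat ω ≠ s 0 ω} = averageSEP (K ^ 2) P η r₀ N₀ ν := by
  obtain ⟨mo, ho⟩ := H.measureReal_cells hK hP hr₀ hN₀ hν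
    (measurableSet_openSlab K √(qamBeta (K ^ 2))) fun _ _ _ => rfl
  obtain ⟨mc, hc⟩ := H.measureReal_cells hK hP hr₀ hN₀ hν
    (measurableSet_closedSlab K √(qamBeta (K ^ 2))) fun _ hw _ => gaussianReal_closedSlab hw _ _ _
  have hML' : ∀ ω, IsMLDecision (range (qam K)) (v ω) (gain P η r₀ h ω)
      (gain P η r₀ h ω * s 0 ω + (interference P η x s h ω + n ω)) (shat ω) := fun ω => by
    rw [← add_assoc]
    exact hML ω
  -- Up to null sets, the error event contains the complement of the closed-cell event and lies in
  -- the complement of the open-cell event, and these have equal measure. Monotonicity alone is used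
  -- for the error event, so `shat` need not be measurable.
  refine le_antisymm ?_ ?_
  · rw [← sub_sub_cancel 1 (averageSEP _ _ _ _ _ _), ← ho, ← probReal_compl_eq_one_sub mo]
    refine ENNReal.toReal_mono (measure_ne_top _ _) (measure_mono_ae ?_)
    filter_upwards [H.ae_gain_ne_zero hP hr₀] with ω hg hne hmem
    obtain ⟨p, hp, h1, h2⟩ := hmem
    have := hML' ω
    rw [hp] at this
    exact hne ((this.eq_of_mem_openSlab hK (hv ω) hg h1 h2).trans hp.symm)
  · rw [← sub_sub_cancel 1 (averageSEP _ _ _ _ _ _), ← hc, ← probReal_compl_eq_one_sub mc]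
    refine ENNReal.toReal_mono (measure_ne_top _ _) (measure_mono_ae ?_)
    filter_upwards [H.ae_gain_ne_zero hP hr₀, H.ae_symbol_mem 0] with ω hg hs hmem heq
    obtain ⟨p, hp⟩ := hs
    have := hML' ω
    rw [heq, ← hp] at this
    exact hmem ⟨p, hp.symm, this.mem_closedSlab hK (hv ω) hg⟩

end IsDownlink

end CellularASEP

end

/-! ### Assembly of the theorem -/

theorem mainTheorem4 {Ω : Type*} [MeasurableSpace Ω] (μ : Measure Ω) [IsProbabilityMeasure μ]
    (K : ℕ) (hK : 2 ≤ K) (P η r₀ lam : ℝ) (N₀ : ℝ≥0)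
    (hP : 0 < P) (hη : 2 < η) (hr₀ : 0 < r₀) (hlam : 0 < lam) (hN₀ : 0 < N₀)
    (x : ℕ → Ω → EuclideanSpace ℝ (Fin 2)) (s h : ℕ → Ω → ℂ) (n : Ω → ℂ)
    (hmodel : CellularASEP.IsDownlink μ lam r₀ N₀ K x s h n) :
    -- the aggregate interference converges almost surely
    (∀ᵐ ω ∂μ, ∃ i : ℂ,
      Tendsto (fun N => CellularASEP.partialInterference P η x s h N ω) atTop (𝓝 i)) ∧
    -- the integrals of the closed form converge
    (∀ c ∈ Finset.Icc 1 2,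
      IntegrableOn (CellularASEP.asepIntegrand K P η r₀ lam N₀ c) (Ioi 0)) ∧
    -- the interference has a conditionally Gaussian equivalent-in-distribution representation
    (∃ ν : Measure ℝ≥0, IsProbabilityMeasure ν ∧
      CellularASEP.IsEiDRepresentation μ (CellularASEP.interference P η x s h) ν) ∧
    -- for each such representation, the averaged conditional error probability is the closed form
    (∀ ν : Measure ℝ≥0, IsProbabilityMeasure ν →
      CellularASEP.IsEiDRepresentation μ (CellularASEP.interference P η x s h) ν →
      CellularASEP.averageSEP (K ^ 2) P η r₀ N₀ ν = CellularASEP.asepFormula K P η r₀ lam N₀) ∧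
    -- the closed form is the symbol error probability of the coherent ML detector
    (∀ (v : Ω → ℝ) (shat : Ω → ℂ), (∀ ω, 0 < v ω) →
      (∀ ω, CellularASEP.IsMLDecision (range (CellularASEP.qam K)) (v ω)
        (CellularASEP.gain P η r₀ h ω) (CellularASEP.received P η r₀ x s h n ω) (shat ω)) →
      μ.real {ω | shat ω ≠ s 0 ω} = CellularASEP.asepFormula K P η r₀ lam N₀) := by
  -- The convergence of the integrals and the detector's error probability do not mention a
  -- representation; they are proved through this one.
  obtain ⟨ν₀, hν₀, hrep⟩ := hmodel.exists_isEiDRepresentation hP hη hr₀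
  have hlap := fun (ν : Measure ℝ≥0) (_ : IsProbabilityMeasure ν)
      (hν : CellularASEP.IsEiDRepresentation μ (CellularASEP.interference P η x s h) ν) (t : ℝ)
      (ht : 0 ≤ t) => hmodel.integral_exp_of_isEiDRepresentation hK hP hη hr₀ hlam hν ht
  refine ⟨hmodel.ae_exists_tendsto_partialInterference hP hη hr₀, fun c _ =>
    CellularASEP.integrableOn_asepIntegrand hK hP hr₀ hN₀ (hlap ν₀ hν₀ hrep) c,
    ⟨ν₀, hν₀, hrep⟩, fun ν hν hν' =>
      CellularASEP.averageSEP_eq_asepFormula hK hP hr₀ hN₀ (hlap ν hν hν'),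
    fun v shat hv hML => ?_⟩
  rw [hmodel.measureReal_ne_of_isMLDecision hK hP hr₀ hN₀ hrep hv hML,
    CellularASEP.averageSEP_eq_asepFormula hK hP hr₀ hN₀ (hlap ν₀ hν₀ hrep)]
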